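/- Let $N\ge 1$ and $0\le m\le N$. Let $V=\mathbb C^3$ with basis $v_{-1},v_0,v_1$ and let $E^{(i,j)}$ be the matrix unit sending $v_j$ to $v_i$. Put $$\mathbf e=\sum_{i,j\in\{-1,0,1\}}\bigl(E^{(i,j)}\otimes E^{(j,i)}-E^{(j,j)}\otimes E^{(i,i)}\bigr)t^{\frac12\mathrm{sign}(j-i)},\qquad \mathbf f(\rho,\sigma)=\rho\,(E^{(-1,1)}-E^{(1,1)})+\sigma\,(E^{(1,-1)}-E^{(-1,-1)}),$$ $$\alpha=\frac{(t^{1/2}-t^{-1/2})ab}{(a-1)(b-1)},\quad \gamma=\frac{t^{-1/2}-t^{1/2}}{(a-1)(b-1)},\quad \beta=\frac{(t^{1/2}-t^{-1/2})cd}{(c-1)(d-1)},\quad \delta=\frac{t^{-1/2}-t^{1/2}}{(c-1)(d-1)}.$$ On $V^{\otimes N}$ (with $\mathbf e_i$ acting on the sites $i,i+1$ and $\mathbf f_i$ on the site $i$) set $$\check R_i(z)=1+\frac{z-1}{t^{1/2}z-t^{-1/2}}\,\mathbf e_i,\quad K_1(z)=1+\frac{z^2-1}{(z-a)(z-b)}\,\gamma^{-1}\mathbf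 f_1(\gamma,\alpha),\quad K_N(z)=1+\frac{1-z^2}{(cz-1)(dz-1)}\,\delta^{-1}\mathbf f_N(\beta,\delta).$$ Let $H_{N,m}$ be the span of the basis vectors $v_{w_1}\otimes\cdots\otimes v_{w_N}$ with exactly $m$ indices $k$ such that $w_k=0$. Let $\mathbf s_i$ ($1\le i\le N-1$) exchange $z_i$ and $z_{i+1}$, let $\mathbf s_0$ replace $z_1$ by $z_1^{-1}$ and let $\mathbf s_N$ replace $z_N$ by $z_N^{-1}$. Consider, for an $H_{N,m}$-valued rational function $\Psi(\mathbf z)$ of $\mathbf z=(z_1,\dots,z_N)$, the exchange–reflection system $$\check R_i(z_iz_{i+1}^{-1})\Psi=\mathbf s_i\Psi\ \ (1\le i\le N-1),\qquad K_1(z_1)\Psi=\mathbf s_0\Psi,\qquad K_N(z_N)\Psi=\mathbf s_N\Psi .$$ **Theorem.** Suppose that either 1. $t>0$, $t\neq1$ and $a,b,c,d$ are real with $\alpha,\beta,\gamma,\delta>0$; or 2. $(t^{1/2},a,b,c,d)\in\mathbb C^5$ is generic, that is, $t\ne 0,1$, $a,b,c,d\ne1$, and the point lies outside the zero set of a certain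 nonzero polynomial that depends only on $N$ and $m$. Then the system has a nonzero Laurent polynomial solution $\Psi\in H_{N,m}\otimes\mathbb C[z_1^{\pm1},\dots,z_N^{\pm1}]$, and it is unique up to multiplication by an invariant function: the rational solutions $\Phi$ of the system are exactly the vectors $\Phi=f\,\Psi$ with $f\in\mathbb C(z_1,\dots,z_N)$ satisfying $\mathbf s_if=f$ for all $0\le i\le N$. -/

import Mathlib

namespace OpenASEP

noncomputable section

/-! ### Local configurations and the local generators

A site is in one of the states `-1` (empty), `0` (second class particle), `1` (first class
particle).  These are the elements of `SignType`; the vector space `V` has the basis `v_x`,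
`x : SignType`, and `V ⊗ ⋯ ⊗ V` (`N` factors) has the basis of words `Fin N → SignType`. -/

/-- The matrix unit `E^{(i,j)}`, which sends `v_j` to `v_i`. -/
def unitE (F : Type*) [Field F] (i j : SignType) : Matrix SignType SignType F :=
  Matrix.single i j 1

/-- The bulk generator `𝐞 ∈ End (V ⊗ V)`, where `s = t^{1/2}`:
`𝐞 = ∑_{i,j} (E^{(i,j)} ⊗ E^{(j,i)} - E^{(j,j)} ⊗ E^{(i,i)}) s^{sign (j - i)}`. -/
def bulkGen {F : Type*} [Field F] (s : F) :
    Matrix (SignType × SignType) (SignType × SignType) F :=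
  ∑ i : SignType, ∑ j : SignType,
    s ^ ((SignType.sign ((j : ℤ) - (i : ℤ)) : SignType) : ℤ) •
      (Matrix.kronecker (unitE F i j) (unitE F j i) -
        Matrix.kronecker (unitE F j j) (unitE F i i))

/-- The boundary generator `𝐟(ρ,σ) ∈ End V`:
particles are removed at rate `ρ` and injected at rate `σ`. -/
def bdryGen {F : Type*} [Field F] (ρ σ : F) : Matrix SignType SignType F :=
  ρ • (unitE F (-1) 1 - unitE F 1 1) + σ • (unitE F 1 (-1) - unitE F (-1) (-1))

/-- The operator `A ∈ End (V ⊗ V)` acting on the two sites `i`, `j`, as a matrix on words. -/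
def onTwo {F : Type*} [Field F] {N : ℕ} (i j : Fin N)
    (A : Matrix (SignType × SignType) (SignType × SignType) F) :
    Matrix (Fin N → SignType) (Fin N → SignType) F :=
  fun w w' => if ∀ k, k ≠ i → k ≠ j → w k = w' k then A (w i, w j) (w' i, w' j) else 0

/-- The operator `A ∈ End V` acting on the site `i`, as a matrix on words. -/
def onOne {F : Type*} [Field F] {N : ℕ} (i : Fin N) (A : Matrix SignType SignType F) :
    Matrix (Fin N → SignType) (Fin N → SignType) F :=
  fun w w' => if ∀ k, k ≠ i → w k = w' k then A (w i) (w' i) else 0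

/-! ### Boundary rates -/

/-- Injection rate `α` at the left end (`s = t^{1/2}`). -/
def rateAlpha {F : Type*} [Field F] (s a b : F) : F :=
  (s - s⁻¹) * (a * b) / ((a - 1) * (b - 1))

/-- Removal rate `γ` at the left end. -/
def rateGamma {F : Type*} [Field F] (s a b : F) : F :=
  (s⁻¹ - s) / ((a - 1) * (b - 1))

/-- Removal rate `β` at the right end. -/
def rateBeta {F : Type*} [Field F] (s c d : F) : F :=
  (s - s⁻¹) * (c * d) / ((c - 1) * (d - 1))

/-- Injection rate `δ` at the right end. -/
def rateDelta {F : Type*} [Field F] (s c d : F) : F :=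
  (s⁻¹ - s) / ((c - 1) * (d - 1))

/-! ### The matrices `Ř` and `K` -/

/-- `Ř(z)` acting on the sites `i`, `j` (to be used with `j = i + 1`). -/
def matR {F : Type*} [Field F] {N : ℕ} (s : F) (i j : Fin N) (z : F) :
    Matrix (Fin N → SignType) (Fin N → SignType) F :=
  1 + ((z - 1) / (s * z - s⁻¹)) • onTwo i j (bulkGen s)

/-- The left boundary matrix `K₁(z|a,b)`, acting on the site `k` (to be used for the first). -/
def matKLeft {F : Type*} [Field F] {N : ℕ} (s a b : F) (k : Fin N) (z : F) :
    Matrix (Fin N → SignType) (Fin N → SignType) F :=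
  1 + ((z ^ 2 - 1) / ((z - a) * (z - b))) • (rateGamma s a b)⁻¹ •
    onOne k (bdryGen (rateGamma s a b) (rateAlpha s a b))

/-- The right boundary matrix `K_N(z|c,d)`, acting on the site `k` (to be used for the last). -/
def matKRight {F : Type*} [Field F] {N : ℕ} (s c d : F) (k : Fin N) (z : F) :
    Matrix (Fin N → SignType) (Fin N → SignType) F :=
  1 + ((1 - z ^ 2) / ((c * z - 1) * (d * z - 1))) • (rateDelta s c d)⁻¹ •
    onOne k (bdryGen (rateBeta s c d) (rateDelta s c d))

/-! ### Laurent polynomials, rational functions and the action of the generators -/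

/-- The ring `ℂ[z₁^{±1}, …, z_N^{±1}]`: the group algebra of `ℤ^N`. -/
abbrev Laurent (N : ℕ) : Type := AddMonoidAlgebra ℂ (Fin N → ℤ)

/-- The field `ℂ(z₁, …, z_N)` of rational functions. -/
abbrev RatFun (N : ℕ) : Type := FractionRing (Laurent N)

/-- The variable `z_k`, as a rational function. -/
def var {N : ℕ} (k : Fin N) : RatFun N :=
  algebraMap (Laurent N) (RatFun N) (AddMonoidAlgebra.single (Pi.single k 1) 1)

/-- Exchange of the `i`-th and the `j`-th exponent. -/
def swapExp {N : ℕ} (i j : Fin N) : (Fin N → ℤ) ≃+ (Fin N → ℤ) where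
  toFun v := fun k => v (Equiv.swap i j k)
  invFun v := fun k => v (Equiv.swap i j k)
  left_inv v := by funext k; simp
  right_inv v := by funext k; simp
  map_add' _ _ := rfl

/-- Change of sign of the `k`-th exponent. -/
def negExp {N : ℕ} (k : Fin N) : (Fin N → ℤ) ≃+ (Fin N → ℤ) where
  toFun v := fun l => if l = k then -v l else v l
  invFun v := fun l => if l = k then -v l else v l
  left_inv v := by funext l; by_cases h : l = k <;> simp [h]
  right_inv v := by funext l; by_cases h : l = k <;> simp [h]
  map_add' v v' := by
    funext l
    by_cases h : l = k
    · simp [h]; ring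
    · simp [h]

/-- The automorphism of `ℂ(z₁, …, z_N)` that an automorphism of the exponent lattice induces. -/
def monomialAut {N : ℕ} (g : (Fin N → ℤ) ≃+ (Fin N → ℤ)) : RatFun N ≃+* RatFun N :=
  IsFractionRing.ringEquivOfRingEquiv (AddMonoidAlgebra.domCongr ℂ ℂ g).toRingEquiv

/-- The exchange `z_i ↔ z_j`. -/
def swapVar {N : ℕ} (i j : Fin N) : RatFun N ≃+* RatFun N := monomialAut (swapExp i j)

/-- The inversion `z_k ↔ z_k⁻¹`. -/
def invVar {N : ℕ} (k : Fin N) : RatFun N ≃+* RatFun N := monomialAut (negExp k)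

/-- `f` is invariant under `s₁, …, s_{N-1}` (exchanges of neighbouring variables),
`s₀` (inversion of the first variable) and `s_N` (inversion of the last variable). -/
def IsInvariant {N : ℕ} (f : RatFun N) : Prop :=
  (∀ i j : Fin N, (j : ℕ) = i + 1 → swapVar i j f = f) ∧
  (∀ k : Fin N, (k : ℕ) = 0 → invVar k f = f) ∧
  (∀ k : Fin N, (k : ℕ) + 1 = N → invVar k f = f)

/-! ### The exchange-reflection system -/

/-- The sector `H_{N,m}` (with coefficients in `ℂ(z₁, …, z_N)`): the vectors supported on the
words with exactly `m` second class particles. -/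
def sector (N m : ℕ) : Submodule (RatFun N) ((Fin N → SignType) → RatFun N) where
  carrier := {Φ | ∀ w, (Finset.univ.filter fun k => w k = 0).card ≠ m → Φ w = 0}
  zero_mem' _ _ := rfl
  add_mem' hx hy w hw := by simp [hx w hw, hy w hw]
  smul_mem' r x hx w hw := by simp [hx w hw]

/-- A complex number as a constant rational function. -/
def const (N : ℕ) (x : ℂ) : RatFun N :=
  algebraMap (Laurent N) (RatFun N) (AddMonoidAlgebra.single 0 x)

/-- `Φ ∈ H_{N,m}`, with rational components, solves the exchange-reflection system
`Ř_i(z_i / z_{i+1}) Φ = s_i Φ`, `K₁(z₁) Φ = s₀ Φ`, `K_N(z_N) Φ = s_N Φ`;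
here `s = t^{1/2}`, and the `s_i` act on vectors componentwise. -/
def IsExchangeSolution (N m : ℕ) (s a b c d : ℂ) (Φ : (Fin N → SignType) → RatFun N) : Prop :=
  Φ ∈ sector N m ∧
  (∀ i j : Fin N, (j : ℕ) = i + 1 →
    (matR (const N s) i j (var i * (var j)⁻¹)).mulVec Φ = fun w => swapVar i j (Φ w)) ∧
  (∀ k : Fin N, (k : ℕ) = 0 →
    (matKLeft (const N s) (const N a) (const N b) k (var k)).mulVec Φ =
      fun w => invVar k (Φ w)) ∧
  (∀ k : Fin N, (k : ℕ) + 1 = N →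
    (matKRight (const N s) (const N c) (const N d) k (var k)).mulVec Φ =
      fun w => invVar k (Φ w))

/-- A vector of Laurent polynomials, seen as a vector of rational functions. -/
def toRatFun {N : ℕ} (Ψ : (Fin N → SignType) → Laurent N) : (Fin N → SignType) → RatFun N :=
  fun w => algebraMap (Laurent N) (RatFun N) (Ψ w)

/-- The exchange-reflection system has a nonzero Laurent polynomial solution `Ψ`, and the
(rational) solutions are exactly the multiples of `Ψ` by invariant functions. -/
def HasUniqueLaurentSolution (N m : ℕ) (s a b c d : ℂ) : Prop :=
  ∃ Ψ : (Fin N → SignType) → Laurent N,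
    Ψ ≠ 0 ∧ IsExchangeSolution N m s a b c d (toRatFun Ψ) ∧
    ∀ Φ : (Fin N → SignType) → RatFun N,
      IsExchangeSolution N m s a b c d Φ ↔
        ∃ f : RatFun N, IsInvariant f ∧ Φ = f • toRatFun Ψ

end

end OpenASEP

namespace OpenASEP

noncomputable section

open Matrix

/-! ### Generators with unnormalised rates -/

section Generators

variable {R : Type*} [CommRing R] {N : ℕ}

/-! Applying `s_i` to both sides turns each equation of the system into a fixed point equation for a
semilinear operator: a matrix combined with an automorphism of the field of rational functions.
These operators are involutions (unitarity) and satisfy the braid, reflection and commutation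
relations of the affine Weyl group of type C (Yang–Baxter and reflection equations). The relations
hold for all parameters: the bulk and boundary generators satisfy Hecke-type relations, so only
scalar identities between the coefficients remain (`baxterized_braid`, `baxterized_reflection`).

In this group take the translation that carries the first particle to the right end, reflects it
there, brings it back and reflects it at the left end. Its field automorphisms cancel, so it acts
linearly, by a scattering matrix (`leftAct_mul_palindrome`). All generators preserve the number of
second class particles and are compatible with the sum of the components. If the scattering matrix
has exactly one fixed vector `v` of component sum 1 in the sector, then `v` is fixed by the whole
group (`fixed_of_unique_fixed`): most generators commute with the translation, and the remaining
ones are handled by its being a product of two involutions and by its commuting with a conjugate of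
itself.

Existence and uniqueness of this fixed vector follow from the nonvanishing of one determinant, which
after clearing denominators is a polynomial in all parameters and spectral variables (`scatDet`).
Nonvanishing may therefore be tested at a single point. Put all variables other than the first equal
to 1 and the inverse of the first close to 1. For positive rates and a suitable side of 1, every
factor then has nonnegative entries, column sums 1 and positive diagonal, and together the factors
connect the whole sector. The maximum principle for an irreducible stochastic matrix shows that the
determinant is nonzero (`det_ne_zero_of_irreducible`). This settles the real case; for the complex
case the determinant at one fixed spectral value is the required polynomial in the parameters, and
it is nonzero because it is so at a real sample point.

Finally, `v` is multiplied by a denominator invariant under all signed permutations of the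
variables, which gives a Laurent polynomial solution. The component sum `f` of any solution `Φ` is
invariant, and `Φ - f • v` is a solution with component sum zero, hence zero. -/

/-- The rate at which the pair `y x` on two neighbouring sites turns into `x y`. -/
def hopRate (t : R) (x y : SignType) : R := if x < y then t else if y < x then 1 else 0

/-- The rate at which `-x` turns into `x` on a boundary site. -/
def flipRate (ρ σ : R) (x : SignType) : R := if x = -1 then ρ else if x = 1 then σ else 0

/-- The exchange generator on the sites `i`, `j`, with rates `t` and `1`. -/
def hopGen (t : R) (i j : Fin N) : Matrix (Fin N → SignType) (Fin N → SignType) R :=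
  fun w w' => (if w' = w ∘ Equiv.swap i j then hopRate t (w i) (w j) else 0) -
    if w' = w then hopRate t (w j) (w i) else 0

/-- The flip generator on the site `k`, with removal rate `ρ` and injection rate `σ`. -/
def flipGen (ρ σ : R) (k : Fin N) : Matrix (Fin N → SignType) (Fin N → SignType) R :=
  fun w w' => (if w' = Function.update w k (-w k) then flipRate ρ σ (w k) else 0) -
    if w' = w then flipRate ρ σ (-w k) else 0

theorem hopGen_mulVec (t : R) (i j : Fin N) (Φ : (Fin N → SignType) → R) (w : Fin N → SignType) :
    (hopGen t i j *ᵥ Φ) w =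
      hopRate t (w i) (w j) * Φ (w ∘ Equiv.swap i j) - hopRate t (w j) (w i) * Φ w := by
  simp [hopGen, mulVec, dotProduct, sub_mul, Finset.sum_sub_distrib]

theorem flipGen_mulVec (ρ σ : R) (k : Fin N) (Φ : (Fin N → SignType) → R)
    (w : Fin N → SignType) :
    (flipGen ρ σ k *ᵥ Φ) w =
      flipRate ρ σ (w k) * Φ (Function.update w k (-w k)) - flipRate ρ σ (-w k) * Φ w := by
  simp [flipGen, mulVec, dotProduct, sub_mul, Finset.sum_sub_distrib]

theorem hopGen_map {R' : Type*} [CommRing R'] (φ : R →+* R') (t : R) (i j : Fin N) :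
    (hopGen t i j).map φ = hopGen (φ t) i j := by
  ext w w'
  simp only [hopGen, hopRate, Matrix.map_apply, map_sub]
  split_ifs <;> simp

theorem flipGen_map {R' : Type*} [CommRing R'] (φ : R →+* R') (ρ σ : R) (k : Fin N) :
    (flipGen ρ σ k).map φ = flipGen (φ ρ) (φ σ) k := by
  ext w w'
  simp only [flipGen, flipRate, Matrix.map_apply, map_sub]
  split_ifs <;> simp

/-- The word `w` with the letters `x`, `y`, `z` put on the sites `i`, `j`, `k`. -/
def putThree (w : Fin N → SignType) (i j k : Fin N) (x y z : SignType) : Fin N → SignType :=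
  fun l => if l = i then x else if l = j then y else if l = k then z else w l

theorem putThree_self (w : Fin N → SignType) (i j k : Fin N) :
    putThree w i j k (w i) (w j) (w k) = w := by
  funext l
  unfold putThree
  split_ifs <;> simp_all

theorem hopGen_mulVec_putThree_left {i j k : Fin N} (hij : i ≠ j) (hik : i ≠ k) (hjk : j ≠ k)
    (t : R) (Φ : (Fin N → SignType) → R) (w : Fin N → SignType) (x y z : SignType) :
    (hopGen t i j *ᵥ Φ) (putThree w i j k x y z) =
      hopRate t x y * Φ (putThree w i j k y x z) -
        hopRate t y x * Φ (putThree w i j k x y z) := by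
  rw [hopGen_mulVec]
  have h1 : putThree w i j k x y z i = x := by simp [putThree]
  have h2 : putThree w i j k x y z j = y := by simp [putThree, hij.symm]
  have h3 : putThree w i j k x y z ∘ Equiv.swap i j = putThree w i j k y x z := by
    funext l
    simp only [Function.comp, Equiv.swap_apply_def, putThree]
    split_ifs <;> simp_all
  rw [h1, h2, h3]

theorem hopGen_mulVec_putThree_right {i j k : Fin N} (hij : i ≠ j) (hik : i ≠ k) (hjk : j ≠ k)
    (t : R) (Φ : (Fin N → SignType) → R) (w : Fin N → SignType) (x y z : SignType) :
    (hopGen t j k *ᵥ Φ) (putThree w i j k x y z) =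
      hopRate t y z * Φ (putThree w i j k x z y) -
        hopRate t z y * Φ (putThree w i j k x y z) := by
  rw [hopGen_mulVec]
  have h1 : putThree w i j k x y z j = y := by simp [putThree, hij.symm]
  have h2 : putThree w i j k x y z k = z := by simp [putThree, hik.symm, hjk.symm]
  have h3 : putThree w i j k x y z ∘ Equiv.swap j k = putThree w i j k x z y := by
    funext l
    simp only [Function.comp, Equiv.swap_apply_def, putThree]
    split_ifs <;> simp_all
  rw [h1, h2, h3]

/-! ### Hecke-type relations between the generators -/

theorem matrix_ext_mulVec {ι : Type*} [Fintype ι] [DecidableEq ι] {A B : Matrix ι ι R}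
    (h : ∀ Φ : ι → R, A *ᵥ Φ = B *ᵥ Φ) : A = B :=
  Matrix.toLin'.injective (LinearMap.ext fun Φ => by simpa using h Φ)

/-- On two distinct letters this is the generator of a two-state Markov chain with rates `t` and
`1`, whose eigenvalues are `0` and minus the total rate; on equal letters it vanishes. -/
theorem hopGen_mul_self (i j : Fin N) (t : R) :
    hopGen t i j * hopGen t i j = (-(1 + t)) • hopGen t i j := by
  refine matrix_ext_mulVec fun Φ => ?_
  funext w
  have h : (w ∘ Equiv.swap i j) ∘ Equiv.swap i j = w := by funext l; simp
  simp only [← mulVec_mulVec, smul_mulVec, Pi.smul_apply, hopGen_mulVec, h, Function.comp,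
    Equiv.swap_apply_left, Equiv.swap_apply_right, smul_eq_mul]
  generalize w i = x
  generalize w j = y
  unfold hopRate
  rcases lt_trichotomy x y with h | h | h <;> simp [h, h.not_gt] <;> ring

theorem flipGen_mul_self (k : Fin N) (ρ σ : R) :
    flipGen ρ σ k * flipGen ρ σ k = (-(ρ + σ)) • flipGen ρ σ k := by
  refine matrix_ext_mulVec fun Φ => ?_
  funext w
  simp only [← mulVec_mulVec, smul_mulVec, Pi.smul_apply, flipGen_mulVec, Function.update_idem,
    Function.update_self, neg_neg, Function.update_eq_self, smul_eq_mul]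
  generalize Φ (Function.update w k (-w k)) = p
  generalize Φ w = q
  generalize w k = x
  cases x <;> simp [flipRate] <;> ring_nf

/-- Only three letters matter, so after `putThree` the relation is checked on the 27 triples. It is
the Hecke braid relation, written for generators that annihilate the stationary vector; the shift by
a scalar produces the right-hand side. -/
theorem hopGen_braid {i j k : Fin N} (hij : i ≠ j) (hik : i ≠ k) (hjk : j ≠ k) (t : R) :
    hopGen t i j * hopGen t j k * hopGen t i j - hopGen t j k * hopGen t i j * hopGen t j k =
      t • (hopGen t i j - hopGen t j k) := by
  refine matrix_ext_mulVec fun Φ => ?_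
  funext w
  rw [← putThree_self w i j k]
  simp only [← mulVec_mulVec, smul_mulVec, sub_mulVec, Pi.smul_apply, Pi.sub_apply,
    hopGen_mulVec_putThree_left hij hik hjk, hopGen_mulVec_putThree_right hij hik hjk,
    smul_eq_mul]
  generalize w i = x
  generalize w j = y
  generalize w k = z
  generalize putThree w i j k = u
  cases x <;> cases y <;> cases z <;> simp [hopRate] <;> ring_nf

/-- The word `w` with the letters `x`, `y` put on the sites `i`, `j`. -/
def putTwo (w : Fin N → SignType) (i j : Fin N) (x y : SignType) : Fin N → SignType :=
  fun l => if l = i then x else if l = j then y else w l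

theorem putTwo_self (w : Fin N → SignType) (i j : Fin N) : putTwo w i j (w i) (w j) = w := by
  funext l
  unfold putTwo
  split_ifs <;> simp_all

theorem hopGen_mulVec_putTwo {i j : Fin N} (hij : i ≠ j) (t : R) (Φ : (Fin N → SignType) → R)
    (w : Fin N → SignType) (x y : SignType) :
    (hopGen t i j *ᵥ Φ) (putTwo w i j x y) =
      hopRate t x y * Φ (putTwo w i j y x) - hopRate t y x * Φ (putTwo w i j x y) := by
  rw [hopGen_mulVec]
  have h1 : putTwo w i j x y i = x := by simp [putTwo]
  have h2 : putTwo w i j x y j = y := by simp [putTwo, hij.symm]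
  have h3 : putTwo w i j x y ∘ Equiv.swap i j = putTwo w i j y x := by
    funext l
    simp only [Function.comp, Equiv.swap_apply_def, putTwo]
    split_ifs <;> simp_all
  rw [h1, h2, h3]

theorem flipGen_mulVec_putTwo_left {i j : Fin N} (ρ σ : R)
    (Φ : (Fin N → SignType) → R) (w : Fin N → SignType) (x y : SignType) :
    (flipGen ρ σ i *ᵥ Φ) (putTwo w i j x y) =
      flipRate ρ σ x * Φ (putTwo w i j (-x) y) - flipRate ρ σ (-x) * Φ (putTwo w i j x y) := by
  rw [flipGen_mulVec]
  have h1 : putTwo w i j x y i = x := by simp [putTwo]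
  have h3 : Function.update (putTwo w i j x y) i (-x) = putTwo w i j (-x) y := by
    funext l
    simp only [Function.update_apply, putTwo]
    split_ifs <;> simp_all
  rw [h1, h3]

theorem flipGen_mulVec_putTwo_right {i j : Fin N} (hij : i ≠ j) (ρ σ : R)
    (Φ : (Fin N → SignType) → R) (w : Fin N → SignType) (x y : SignType) :
    (flipGen ρ σ j *ᵥ Φ) (putTwo w i j x y) =
      flipRate ρ σ y * Φ (putTwo w i j x (-y)) - flipRate ρ σ (-y) * Φ (putTwo w i j x y) := by
  rw [flipGen_mulVec]
  have h1 : putTwo w i j x y j = y := by simp [putTwo, hij.symm]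
  have h3 : Function.update (putTwo w i j x y) j (-y) = putTwo w i j x (-y) := by
    funext l
    simp only [Function.update_apply, putTwo]
    split_ifs <;> simp_all
  rw [h1, h3]

/-- The four-term braid relation of type B, again up to a shift of the generators by scalars. It is
checked on the nine pairs of letters. At the right end the roles of the two boundary rates are
interchanged. -/
theorem flipGen_hopGen_left {i j : Fin N} (hij : i ≠ j) (t ρ σ : R) :
    flipGen ρ σ i * hopGen t i j * flipGen ρ σ i * hopGen t i j -
        hopGen t i j * flipGen ρ σ i * hopGen t i j * flipGen ρ σ i =
      (t * ρ + σ) • (flipGen ρ σ i * hopGen t i j - hopGen t i j * flipGen ρ σ i) := by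
  refine matrix_ext_mulVec fun Φ => ?_
  funext w
  rw [← putTwo_self w i j]
  simp only [← mulVec_mulVec, smul_mulVec, sub_mulVec, Pi.smul_apply, Pi.sub_apply,
    hopGen_mulVec_putTwo hij, flipGen_mulVec_putTwo_left, smul_eq_mul]
  generalize w i = x
  generalize w j = y
  generalize putTwo w i j = u
  cases x <;> cases y <;> simp [hopRate, flipRate] <;> ring_nf

theorem flipGen_hopGen_right {i j : Fin N} (hij : i ≠ j) (t ρ σ : R) :
    flipGen ρ σ j * hopGen t i j * flipGen ρ σ j * hopGen t i j -
        hopGen t i j * flipGen ρ σ j * hopGen t i j * flipGen ρ σ j =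
      (ρ + t * σ) • (flipGen ρ σ j * hopGen t i j - hopGen t i j * flipGen ρ σ j) := by
  refine matrix_ext_mulVec fun Φ => ?_
  funext w
  rw [← putTwo_self w i j]
  simp only [← mulVec_mulVec, smul_mulVec, sub_mulVec, Pi.smul_apply, Pi.sub_apply,
    hopGen_mulVec_putTwo hij, flipGen_mulVec_putTwo_right hij, smul_eq_mul]
  generalize w i = x
  generalize w j = y
  generalize putTwo w i j = u
  cases x <;> cases y <;> simp [hopRate, flipRate] <;> ring_nf

theorem hopGen_commute {i j k l : Fin N} (hik : i ≠ k) (hil : i ≠ l) (hjk : j ≠ k) (hjl : j ≠ l)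
    (t : R) : Commute (hopGen t i j) (hopGen t k l) := by
  refine matrix_ext_mulVec fun Φ => ?_
  funext w
  have h : (w ∘ Equiv.swap i j) ∘ Equiv.swap k l = (w ∘ Equiv.swap k l) ∘ Equiv.swap i j := by
    have h := Equiv.mul_swap_eq_swap_mul (Equiv.swap i j) k l
    rw [Equiv.swap_apply_of_ne_of_ne hik.symm hjk.symm,
      Equiv.swap_apply_of_ne_of_ne hil.symm hjl.symm] at h
    funext x
    exact congrArg w (DFunLike.congr_fun h x)
  simp only [← mulVec_mulVec, hopGen_mulVec, h, Function.comp,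
    Equiv.swap_apply_of_ne_of_ne hik hil, Equiv.swap_apply_of_ne_of_ne hjk hjl,
    Equiv.swap_apply_of_ne_of_ne hik.symm hjk.symm, Equiv.swap_apply_of_ne_of_ne hil.symm hjl.symm]
  ring

theorem flipGen_commute_hopGen {i j k : Fin N} (hki : k ≠ i) (hkj : k ≠ j) (t ρ σ : R) :
    Commute (flipGen ρ σ k) (hopGen t i j) := by
  refine matrix_ext_mulVec fun Φ => ?_
  funext w
  have h : Function.update w k (-w k) ∘ Equiv.swap i j =
      Function.update (w ∘ Equiv.swap i j) k (-w k) := by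
    funext x
    by_cases hx : x = k
    · subst hx
      simp [Equiv.swap_apply_of_ne_of_ne hki hkj]
    · have : Equiv.swap i j x ≠ k := by
        rw [Equiv.swap_apply_def]
        split_ifs <;> simp_all [eq_comm]
      simp [hx, this]
  simp only [← mulVec_mulVec, hopGen_mulVec, flipGen_mulVec, h, Function.comp,
    Equiv.swap_apply_of_ne_of_ne hki hkj, Function.update_of_ne hki.symm,
    Function.update_of_ne hkj.symm]
  ring

theorem flipGen_commute {k l : Fin N} (hkl : k ≠ l) (ρ σ ρ' σ' : R) :
    Commute (flipGen ρ σ k) (flipGen ρ' σ' l) := by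
  refine matrix_ext_mulVec fun Φ => ?_
  funext w
  simp only [← mulVec_mulVec, flipGen_mulVec, Function.update_of_ne hkl,
    Function.update_of_ne hkl.symm, Function.update_comm hkl]
  ring

end Generators

/-! ### Automorphisms of the field of rational functions -/

section Automorphisms

variable {N : ℕ}

/-- The monomial with exponent `v`, as a rational function. -/
def mono (v : Fin N → ℤ) : RatFun N :=
  algebraMap (Laurent N) (RatFun N) (AddMonoidAlgebra.single v 1)

theorem mono_zero : mono (0 : Fin N → ℤ) = 1 := by
  rw [mono, ← AddMonoidAlgebra.one_def, map_one]

theorem mono_add (u v : Fin N → ℤ) : mono (u + v) = mono u * mono v := by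
  rw [mono, mono, mono, ← map_mul, AddMonoidAlgebra.single_mul_single, one_mul]

theorem mono_neg (v : Fin N → ℤ) : mono (-v) = (mono v)⁻¹ :=
  eq_inv_of_mul_eq_one_left (by rw [← mono_add, neg_add_cancel, mono_zero])

theorem mono_ne_zero (v : Fin N → ℤ) : mono v ≠ 0 := by
  intro h
  have h2 := mono_add v (-v)
  rw [add_neg_cancel, mono_zero, h, zero_mul] at h2
  exact one_ne_zero h2

theorem var_eq_mono (k : Fin N) : var k = mono (Pi.single k 1) := rfl

theorem var_ne_zero (k : Fin N) : var k ≠ 0 := mono_ne_zero _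

/-- Constants as a ring homomorphism. -/
def constHom (N : ℕ) : ℂ →+* RatFun N :=
  (algebraMap (Laurent N) (RatFun N)).comp AddMonoidAlgebra.singleZeroRingHom

theorem const_eq_constHom (x : ℂ) : const N x = constHom N x := rfl

theorem constHom_apply (x : ℂ) :
    constHom N x = algebraMap (Laurent N) (RatFun N) (AddMonoidAlgebra.single 0 x) := rfl

theorem constHom_mul_mono (x : ℂ) (v : Fin N → ℤ) :
    constHom N x * mono v = algebraMap (Laurent N) (RatFun N) (AddMonoidAlgebra.single v x) := by
  rw [constHom_apply, mono, ← map_mul, AddMonoidAlgebra.single_mul_single, zero_add, mul_one]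

/-- The coefficient at the exponent `v` is `-1`, whatever `x` is. The elementary denominators of the
operators have this form up to sign, so they vanish for no value of the parameters. -/
theorem constHom_mul_mono_sub_ne_zero (x : ℂ) {u v : Fin N → ℤ} (h : u ≠ v) :
    constHom N x * mono u - mono v ≠ 0 := by
  rw [constHom_mul_mono, mono, ← map_sub]
  intro h0
  have h1 := (map_eq_zero_iff _ (IsFractionRing.injective (Laurent N) (RatFun N))).1 h0
  have h2 := congrArg (fun f : Laurent N => f.coeff v) h1
  simp [h] at h2

theorem monomialAut_algebraMap (g : (Fin N → ℤ) ≃+ (Fin N → ℤ)) (p : Laurent N) :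
    monomialAut g (algebraMap _ _ p) =
      algebraMap _ (RatFun N) (AddMonoidAlgebra.domCongr ℂ ℂ g p) := by
  simp [monomialAut]

theorem monomialAut_mono (g : (Fin N → ℤ) ≃+ (Fin N → ℤ)) (v : Fin N → ℤ) :
    monomialAut g (mono v) = mono (g v) := by
  rw [mono, monomialAut_algebraMap, AddMonoidAlgebra.domCongr_single, mono]

theorem monomialAut_constHom (g : (Fin N → ℤ) ≃+ (Fin N → ℤ)) (x : ℂ) :
    monomialAut g (constHom N x) = constHom N x := by
  rw [constHom_apply, monomialAut_algebraMap, AddMonoidAlgebra.domCongr_single, map_zero]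

theorem monomialAut_trans (g h : (Fin N → ℤ) ≃+ (Fin N → ℤ)) :
    monomialAut (h.trans g) = (monomialAut g * monomialAut h : RingAut (RatFun N)) := by
  have key : (monomialAut (h.trans g) : RatFun N →+* RatFun N) =
      ((monomialAut g * monomialAut h : RingAut (RatFun N)) : RatFun N →+* RatFun N) := by
    refine IsLocalization.ringHom_ext (nonZeroDivisors (Laurent N)) ?_
    refine RingHom.ext fun p => ?_
    simp only [RingHom.comp_apply, RingHom.coe_coe, RingAut.mul_apply, monomialAut_algebraMap]
    rw [← AddMonoidAlgebra.trans_domCongr_domCongr]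
    rfl
  exact RingEquiv.ext fun x => DFunLike.congr_fun key x

theorem swapExp_single (i j k : Fin N) (x : ℤ) :
    swapExp i j (Pi.single k x) = Pi.single (Equiv.swap i j k) x := by
  funext l
  simp only [swapExp, AddEquiv.coe_mk, Equiv.coe_fn_mk, Pi.single_apply]
  congr 1
  rw [eq_iff_iff, Equiv.swap_apply_eq_iff]

theorem swapVar_var (i j k : Fin N) : swapVar i j (var k) = var (Equiv.swap i j k) := by
  rw [swapVar, var_eq_mono, monomialAut_mono, swapExp_single, var_eq_mono]

theorem invVar_var_self (k : Fin N) : invVar k (var k) = (var k)⁻¹ := by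
  rw [invVar, var_eq_mono, monomialAut_mono, ← mono_neg]
  congr 1
  funext l
  by_cases h : l = k <;> simp [negExp, h]

theorem invVar_var_of_ne {k l : Fin N} (h : l ≠ k) : invVar k (var l) = var l := by
  rw [invVar, var_eq_mono, monomialAut_mono]
  congr 1
  funext x
  by_cases hx : x = k
  · subst hx; simp [negExp, h.symm]
  · simp [negExp, hx]

theorem swapVar_constHom (i j : Fin N) (x : ℂ) : swapVar i j (constHom N x) = constHom N x :=
  monomialAut_constHom _ _

theorem invVar_constHom (k : Fin N) (x : ℂ) : invVar k (constHom N x) = constHom N x :=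
  monomialAut_constHom _ _

theorem monomialAut_one : monomialAut (AddEquiv.refl (Fin N → ℤ)) = (1 : RingAut (RatFun N)) := by
  have h := monomialAut_trans (AddEquiv.refl (Fin N → ℤ)) (AddEquiv.refl _)
  exact mul_eq_left.1 h.symm

theorem swapVar_mul_self (i j : Fin N) :
    (swapVar i j * swapVar i j : RingAut (RatFun N)) = 1 := by
  rw [swapVar, ← monomialAut_trans, ← monomialAut_one]
  congr 1
  ext v k
  simp [swapExp]

theorem invVar_mul_self (k : Fin N) : (invVar k * invVar k : RingAut (RatFun N)) = 1 := by
  rw [invVar, ← monomialAut_trans, ← monomialAut_one]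
  congr 1
  ext v l
  by_cases h : l = k <;> simp [negExp, h]

theorem swapVar_mul_invVar (i j k : Fin N) :
    (swapVar i j * invVar k : RingAut (RatFun N)) =
      invVar (Equiv.swap i j k) * swapVar i j := by
  rw [swapVar, invVar, invVar, ← monomialAut_trans, ← monomialAut_trans]
  congr 1
  ext v l
  simp [negExp, swapExp, Equiv.swap_apply_eq_iff]

theorem swapVar_mul_swapVar (i j k l : Fin N) :
    (swapVar i j * swapVar k l : RingAut (RatFun N)) =
      swapVar (Equiv.swap i j k) (Equiv.swap i j l) * swapVar i j := by
  rw [swapVar, swapVar, swapVar, ← monomialAut_trans, ← monomialAut_trans]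
  congr 1
  ext v x
  have := DFunLike.congr_fun (Equiv.mul_swap_eq_swap_mul (Equiv.swap i j) k l)
    (Equiv.swap i j x)
  simp only [Equiv.Perm.mul_apply, Equiv.swap_apply_self] at this
  simp [swapExp, ← this]

theorem invVar_mul_invVar (k l : Fin N) :
    (invVar k * invVar l : RingAut (RatFun N)) = invVar l * invVar k := by
  rw [invVar, invVar, ← monomialAut_trans, ← monomialAut_trans]
  congr 1
  ext v x
  change (if x = k then -(if x = l then -v x else v x) else if x = l then -v x else v x) =
    if x = l then -(if x = k then -v x else v x) else if x = k then -v x else v x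
  split_ifs <;> rfl

end Automorphisms

/-! ### Semilinear operators -/

section Semilinear

variable {N : ℕ} {K : Type*} [Field K]

/-- The semilinear operator `Φ ↦ M (g Φ)`. -/
def semilin (g : RingAut K) (M : Matrix (Fin N → SignType) (Fin N → SignType) K) :
    AddMonoid.End ((Fin N → SignType) → K) where
  toFun Φ := M *ᵥ fun w => g (Φ w)
  map_zero' := by simp [← Pi.zero_def]
  map_add' Φ Φ' := by
    rw [← mulVec_add]
    congr 1
    funext w
    simp

theorem semilin_apply (g : RingAut K) (M : Matrix (Fin N → SignType) (Fin N → SignType) K)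
    (Φ : (Fin N → SignType) → K) : semilin g M Φ = M *ᵥ fun w => g (Φ w) := rfl

/-- Moving `g` past the second matrix applies it to the entries. Relations between the operators
thus split into relations between automorphisms and matrix identities with transformed coefficients.
-/
theorem semilin_mul (g h : RingAut K) (M M' : Matrix (Fin N → SignType) (Fin N → SignType) K) :
    semilin g M * semilin h M' = semilin (g * h) (M * M'.map g) := by
  refine AddMonoidHom.ext fun Φ => ?_
  change M *ᵥ (fun w => g ((M' *ᵥ fun w => h (Φ w)) w)) = (M * M'.map g) *ᵥ fun w => (g * h) (Φ w)
  rw [← mulVec_mulVec]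
  congr 1
  funext w
  exact RingHom.map_mulVec (g : K →+* K) M' _ w

theorem semilin_one : semilin (1 : RingAut K)
    (1 : Matrix (Fin N → SignType) (Fin N → SignType) K) = 1 := by
  refine AddMonoidHom.ext fun Φ => ?_
  change (1 : Matrix _ _ K) *ᵥ _ = _
  rw [one_mulVec]
  rfl

theorem map_one_add_smul (g : RingAut K) (r : K)
    (G : Matrix (Fin N → SignType) (Fin N → SignType) K) :
    (1 + r • G).map g = 1 + g r • G.map g := by
  ext w w'
  simp only [Matrix.map_apply, Matrix.add_apply, Matrix.smul_apply, smul_eq_mul, map_add, map_mul,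
    Matrix.one_apply]
  split_ifs <;> simp

theorem one_add_smul_commute {r r' : K} {G G' : Matrix (Fin N → SignType) (Fin N → SignType) K}
    (h : Commute G G') : (1 + r • G) * (1 + r' • G') = (1 + r' • G') * (1 + r • G) := by
  have : Commute (1 + r • G) (1 + r' • G') :=
    (Commute.one_left _).add_left ((Commute.one_right _).add_right ((h.smul_left r).smul_right r'))
  exact this

end Semilinear

/-! ### Algebraic forms of the Yang-Baxter and reflection equations -/

section Baxterization

variable {K A : Type*} [Field K] [Ring A] [Algebra K A]

theorem one_add_smul_mul_of_quadratic {E : A} {κ x y : K} (hE : E * E = (-κ) • E)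
    (h : x + y - κ * x * y = 0) : (1 + x • E) * (1 + y • E) = 1 := by
  have h0 : (x + y - κ * x * y) • E = 0 := by rw [h, zero_smul]
  simp only [add_mul, mul_add, one_mul, mul_one, smul_mul_smul_comm, hE, smul_smul]
  refine sub_eq_zero.1 (Eq.trans ?_ h0)
  module

/-- Modulo the quadratic and the braid relation, the difference of the two sides is a scalar
multiple of `E₁ - E₂`; the hypothesis `h` says that this scalar is zero. -/
theorem baxterized_braid {E₁ E₂ : A} {κ τ x y z : K} (h₁ : E₁ * E₁ = (-κ) • E₁)
    (h₂ : E₂ * E₂ = (-κ) • E₂)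
    (hb : E₁ * E₂ * E₁ - E₂ * E₁ * E₂ = τ • (E₁ - E₂))
    (h : x + z - κ * x * z + τ * x * y * z - y = 0) :
    (1 + x • E₁) * (1 + y • E₂) * (1 + z • E₁) = (1 + z • E₂) * (1 + y • E₁) * (1 + x • E₂) := by
  have h0 : (x + z - κ * x * z + τ * x * y * z - y) • (E₁ - E₂) = 0 := by rw [h, zero_smul]
  have e : E₁ * E₂ * E₁ = E₂ * E₁ * E₂ + τ • (E₁ - E₂) := by rw [← hb]; abel
  simp only [add_mul, mul_add, one_mul, mul_one, smul_mul_assoc, mul_smul_comm, h₁, h₂, e,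
    smul_add, smul_sub, smul_smul]
  refine sub_eq_zero.1 (Eq.trans ?_ h0)
  module

/-- The same mechanism: what survives is a scalar multiple of the commutator of `F` and `E`. -/
theorem baxterized_reflection {E F : A} {κ φ l k₁ k₂ x y : K} (hE : E * E = (-κ) • E)
    (hF : F * F = (-φ) • F)
    (hb : F * E * F * E - E * F * E * F = l • (F * E - E * F))
    (h : k₁ * x + k₁ * y + k₂ * y - κ * k₁ * x * y - φ * k₁ * k₂ * y - k₂ * x +
      l * k₁ * k₂ * x * y = 0) :
    (1 + k₁ • F) * (1 + x • E) * (1 + k₂ • F) * (1 + y • E) =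
      (1 + y • E) * (1 + k₂ • F) * (1 + x • E) * (1 + k₁ • F) := by
  have h0 : (k₁ * x + k₁ * y + k₂ * y - κ * k₁ * x * y - φ * k₁ * k₂ * y - k₂ * x +
      l * k₁ * k₂ * x * y) • (F * E - E * F) = 0 := by rw [h, zero_smul]
  have e : F * E * F * E = E * F * E * F + l • (F * E - E * F) := by rw [← hb]; abel
  have hE' (X : A) : X * E * E = (-κ) • (X * E) := by rw [mul_assoc, hE, mul_smul_comm]
  have hF' (X : A) : X * F * F = (-φ) • (X * F) := by rw [mul_assoc, hF, mul_smul_comm]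
  simp only [add_mul, mul_add, one_mul, mul_one, smul_mul_assoc, mul_smul_comm, hE, hF, hE', hF',
    e, smul_add, smul_sub, smul_smul]
  refine sub_eq_zero.1 (Eq.trans ?_ h0)
  module

end Baxterization

/-! ### The abstract affine group -/

section Group

variable {G : Type*} [Monoid G]

/-- The product `c (l-1) ⋯ c 0 R c 0 ⋯ c (l-1)`. -/
def palindrome (R : G) (c : ℕ → G) : ℕ → G
  | 0 => R
  | l + 1 => c l * palindrome R c l * c l

variable {R : G} {c : ℕ → G} {n : ℕ}

theorem palindrome_mul_self (hR : R * R = 1) (hc : ∀ i < n, c i * c i = 1) :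
    ∀ l ≤ n, palindrome R c l * palindrome R c l = 1
  | 0, _ => hR
  | l + 1, h => by
    have ih := palindrome_mul_self hR hc l (by omega)
    have h1 := hc l (by omega)
    calc c l * palindrome R c l * c l * (c l * palindrome R c l * c l)
        = c l * (palindrome R c l * (c l * c l) * palindrome R c l) * c l := by
          simp only [mul_assoc]
      _ = 1 := by rw [h1, mul_one, ih, mul_one, h1]

theorem commute_palindrome {x : G} (hR : Commute x R) :
    ∀ l, (∀ i < l, Commute x (c i)) → Commute x (palindrome R c l)
  | 0, _ => hR
  | l + 1, h => by
    have h1 := h l (by omega)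
    exact (h1.mul_right (commute_palindrome hR l fun i hi => h i (by omega))).mul_right h1

/-- The generators inside the palindrome commute with it. -/
theorem palindrome_commute_inner (hfar : ∀ i j, i < n → j < n → i + 2 ≤ j → Commute (c i) (c j))
    (hRc : ∀ i, i < n → 1 ≤ i → Commute R (c i))
    (hbraid : ∀ i, i + 1 < n → c i * c (i + 1) * c i = c (i + 1) * c i * c (i + 1)) :
    ∀ l, l < n → ∀ i < l, Commute (c i) (palindrome R c (l + 1))
  | l, hl, i, hi => by
    rcases Nat.lt_or_ge (i + 1) l with h | h
    · obtain ⟨l, rfl⟩ : ∃ k, l = k + 1 := ⟨l - 1, by omega⟩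
      have h1 := hfar i (l + 1) (by omega) (by omega) (by omega)
      exact (h1.mul_right (palindrome_commute_inner hfar hRc hbraid l (by omega) i
        (by omega))).mul_right h1
    · obtain rfl : l = i + 1 := by omega
      have hZ : Commute (c (i + 1)) (palindrome R c i) :=
        commute_palindrome (hRc _ hl (by omega)).symm _
          fun j hj => (hfar j (i + 1) (by omega) (by omega) (by omega)).symm
      have hb := hbraid i hl
      change c i * (c (i + 1) * (c i * palindrome R c i * c i) * c (i + 1)) =
        c (i + 1) * (c i * palindrome R c i * c i) * c (i + 1) * c i
      calc c i * (c (i + 1) * (c i * palindrome R c i * c i) * c (i + 1))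
          = (c i * c (i + 1) * c i) * palindrome R c i * c i * c (i + 1) := by
            simp only [mul_assoc]
        _ = c (i + 1) * c i * (c (i + 1) * palindrome R c i) * c i * c (i + 1) := by
            rw [hb]; simp only [mul_assoc]
        _ = c (i + 1) * c i * palindrome R c i * (c (i + 1) * c i * c (i + 1)) := by
            rw [hZ.eq]; simp only [mul_assoc]
        _ = c (i + 1) * (c i * palindrome R c i * c i) * c (i + 1) * c i := by
            rw [← hb]; simp only [mul_assoc]

theorem palindrome_commute_end (hfar : ∀ i, i < n → 1 ≤ i → Commute R (c i))
    (h4 : 0 < n → R * c 0 * R * c 0 = c 0 * R * c 0 * R) :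
    ∀ l < n, Commute R (palindrome R c (l + 1))
  | 0, hl => by
    change R * (c 0 * R * c 0) = c 0 * R * c 0 * R
    rw [← h4 hl]
    simp only [mul_assoc]
  | l + 1, hl => by
    have h1 := hfar (l + 1) hl (by omega)
    exact (h1.mul_right (palindrome_commute_end hfar h4 l (by omega))).mul_right h1

/-- Induction along the chain: the four-term relation passes from the pair `z`, `e` to the pair `e *
z * e`, `d` when `d` commutes with `z` and satisfies the braid relation with `e`. Thus a longer
palindrome behaves like a boundary reflection for the next generator. -/
theorem palindrome_reflection (hc : ∀ i < n, c i * c i = 1)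
    (hfar : ∀ i j, i < n → j < n → i + 2 ≤ j → Commute (c i) (c j))
    (hRc : ∀ i, i < n → 1 ≤ i → Commute R (c i))
    (hbraid : ∀ i, i + 1 < n → c i * c (i + 1) * c i = c (i + 1) * c i * c (i + 1))
    (h4 : 0 < n → R * c 0 * R * c 0 = c 0 * R * c 0 * R) :
    ∀ l < n, palindrome R c l * c l * palindrome R c l * c l =
      c l * palindrome R c l * c l * palindrome R c l
  | 0, h => h4 h
  | l + 1, h => by
    have ih := palindrome_reflection hc hfar hRc hbraid h4 l (by omega)
    have hb := hbraid l h
    have hx : Commute (c (l + 1)) (palindrome R c l) :=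
        commute_palindrome (hRc _ h (by omega)).symm _
          fun j hj => (hfar j (l + 1) (by omega) (by omega) (by omega)).symm
    change c l * palindrome R c l * c l * c (l + 1) * (c l * palindrome R c l * c l) * c (l + 1) =
      c (l + 1) * (c l * palindrome R c l * c l) * c (l + 1) * (c l * palindrome R c l * c l)
    generalize palindrome R c l = z at *
    generalize c (l + 1) = d at *
    generalize c l = e at *
    have hx := hx.eq
    calc e * z * e * d * (e * z * e) * d
        = e * z * (e * d * e) * z * e * d := by simp only [mul_assoc]
      _ = e * (z * d) * e * (d * z) * e * d := by rw [hb]; simp only [mul_assoc]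
      _ = e * d * z * e * (d * z) * e * d := by rw [← hx]; simp only [mul_assoc]
      _ = e * d * (z * e * z) * (d * e * d) := by rw [hx]; simp only [mul_assoc]
      _ = e * d * (z * e * z * e) * d * e := by rw [← hb]; simp only [mul_assoc]
      _ = (e * d * e) * z * e * (z * d) * e := by rw [ih]; simp only [mul_assoc]
      _ = d * e * (d * z) * e * d * z * e := by rw [hb, ← hx]; simp only [mul_assoc]
      _ = d * e * z * (d * e * d) * z * e := by rw [hx]; simp only [mul_assoc]
      _ = d * (e * z * e) * d * (e * z * e) := by rw [← hb]; simp only [mul_assoc]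

end Group

/-! ### Scalar identities -/

section ScalarIdentities

variable {K : Type*} [Field K]

theorem exchange_scalar_unitarity {t x y : K} (h₁ : t * y - x ≠ 0) (h₂ : t * x - y ≠ 0) :
    (y - x) / (t * y - x) + (x - y) / (t * x - y) -
      (1 + t) * ((y - x) / (t * y - x)) * ((x - y) / (t * x - y)) = 0 := by
  generalize hp : t * y - x = p at *
  generalize hq : t * x - y = q at *
  field_simp
  subst hp hq
  ring

theorem exchange_scalar_braid {t x y z : K} (h₁ : t * y - x ≠ 0) (h₂ : t * z - x ≠ 0)
    (h₃ : t * z - y ≠ 0) :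
    (y - x) / (t * y - x) + (z - y) / (t * z - y) -
      (1 + t) * ((y - x) / (t * y - x)) * ((z - y) / (t * z - y)) +
      t * ((y - x) / (t * y - x)) * ((z - x) / (t * z - x)) * ((z - y) / (t * z - y)) -
      (z - x) / (t * z - x) = 0 := by
  generalize hp : t * y - x = p at *
  generalize hq : t * z - x = q at *
  generalize hr : t * z - y = r at *
  field_simp
  subst hp hq hr
  ring

theorem left_scalar_unitarity {a b z : K} (hz : z ≠ 0) (h₁ : 1 - a * z ≠ 0) (h₂ : 1 - b * z ≠ 0)
    (h₃ : 1 - a * z⁻¹ ≠ 0) (h₄ : 1 - b * z⁻¹ ≠ 0) :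
    (1 - z ^ 2) / ((1 - a * z) * (1 - b * z)) +
      (1 - z⁻¹ ^ 2) / ((1 - a * z⁻¹) * (1 - b * z⁻¹)) -
      (1 + -(a * b)) * ((1 - z ^ 2) / ((1 - a * z) * (1 - b * z))) *
        ((1 - z⁻¹ ^ 2) / ((1 - a * z⁻¹) * (1 - b * z⁻¹))) = 0 := by
  have e : 1 = z * z⁻¹ := (mul_inv_cancel₀ hz).symm
  generalize z⁻¹ = w at *
  generalize hp : 1 - a * z = p at *
  generalize hq : 1 - b * z = q at *
  generalize hr : 1 - a * w = r at *
  generalize hs : 1 - b * w = s at *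
  field_simp
  subst hp hq hr hs
  -- After clearing denominators, with `w` in place of the inverse of `z`, the expression is a
  -- multiple of `1 - z * w`; the coefficient is the cofactor.
  linear_combination (1 + z * w - a * z - a * w - b * z - b * w + a * b * (1 + z * w)) * e

theorem right_scalar_unitarity {c d z : K} (hz : z ≠ 0) (h₁ : c - z ≠ 0) (h₂ : d - z ≠ 0)
    (h₃ : c - z⁻¹ ≠ 0) (h₄ : d - z⁻¹ ≠ 0) :
    (z ^ 2 - 1) / ((c - z) * (d - z)) + (z⁻¹ ^ 2 - 1) / ((c - z⁻¹) * (d - z⁻¹)) -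
      (-(c * d) + 1) * ((z ^ 2 - 1) / ((c - z) * (d - z))) *
        ((z⁻¹ ^ 2 - 1) / ((c - z⁻¹) * (d - z⁻¹))) = 0 := by
  have e : 1 = z * z⁻¹ := (mul_inv_cancel₀ hz).symm
  generalize z⁻¹ = w at *
  generalize hp : c - z = p at *
  generalize hq : d - z = q at *
  generalize hr : c - w = r at *
  generalize hs : d - w = s at *
  field_simp
  subst hp hq hr hs
  linear_combination (-1 - z * w + c * z + c * w + d * z + d * w - c * d * (1 + z * w)) * e

theorem left_scalar_reflection {t a b x y : K} (hx : x ≠ 0) (h₁ : 1 - a * x ≠ 0)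
    (h₂ : 1 - b * x ≠ 0) (h₃ : 1 - a * y ≠ 0) (h₄ : 1 - b * y ≠ 0) (h₅ : t * y - x ≠ 0)
    (h₆ : t * y - x⁻¹ ≠ 0) {k₁ k₂ u v : K}
    (hk₁ : k₁ = (1 - x ^ 2) / ((1 - a * x) * (1 - b * x)))
    (hk₂ : k₂ = (1 - y ^ 2) / ((1 - a * y) * (1 - b * y)))
    (hu : u = (y - x⁻¹) / (t * y - x⁻¹)) (hv : v = (y - x) / (t * y - x)) :
    k₁ * u + k₁ * v + k₂ * v - (1 + t) * k₁ * u * v - (1 + -(a * b)) * k₁ * k₂ * v - k₂ * u +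
      (t * 1 + -(a * b)) * k₁ * k₂ * u * v = 0 := by
  have h₆' : t * y * x - 1 ≠ 0 := fun h => h₆ <| by
    rw [eq_inv_of_mul_eq_one_left (sub_eq_zero.1 h), sub_self]
  have e : u = (y * x - 1) / (t * y * x - 1) := by
    rw [hu, div_eq_div_iff h₆ h₆']
    field_simp
  rw [e, hk₁, hk₂, hv]
  generalize hp₁ : 1 - a * x = p₁ at *
  generalize hp₂ : 1 - b * x = p₂ at *
  generalize hp₃ : 1 - a * y = p₃ at *
  generalize hp₄ : 1 - b * y = p₄ at *
  generalize hp₅ : t * y - x = p₅ at *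
  generalize hp₆ : t * y * x - 1 = p₆ at *
  field_simp
  subst hp₁ hp₂ hp₃ hp₄ hp₅ hp₆
  ring

theorem right_scalar_reflection {t c d x y : K} (hy : y ≠ 0) (h₁ : c - x ≠ 0)
    (h₂ : d - x ≠ 0) (h₃ : c - y ≠ 0) (h₄ : d - y ≠ 0) (h₅ : t * y - x ≠ 0)
    (h₆ : t * y⁻¹ - x ≠ 0) {k₁ k₂ u v : K}
    (hk₁ : k₁ = (y ^ 2 - 1) / ((c - y) * (d - y)))
    (hk₂ : k₂ = (x ^ 2 - 1) / ((c - x) * (d - x)))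
    (hu : u = (y⁻¹ - x) / (t * y⁻¹ - x)) (hv : v = (y - x) / (t * y - x)) :
    k₁ * u + k₁ * v + k₂ * v - (1 + t) * k₁ * u * v - (-(c * d) + 1) * k₁ * k₂ * v - k₂ * u +
      (-(c * d) + t * 1) * k₁ * k₂ * u * v = 0 := by
  have h₆' : t - x * y ≠ 0 := fun h => h₆ <| by
    rw [sub_eq_zero.1 h, mul_inv_cancel_right₀ hy, sub_self]
  have e : u = (1 - x * y) / (t - x * y) := by
    rw [hu, div_eq_div_iff h₆ h₆']
    field_simp
  rw [e, hk₁, hk₂, hv]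
  generalize hp₁ : c - x = p₁ at *
  generalize hp₂ : d - x = p₂ at *
  generalize hp₃ : c - y = p₃ at *
  generalize hp₄ : d - y = p₄ at *
  generalize hp₅ : t * y - x = p₅ at *
  generalize hp₆ : t - x * y = p₆ at *
  field_simp
  subst hp₁ hp₂ hp₃ hp₄ hp₅ hp₆
  ring

end ScalarIdentities

/-! ### The exchange and reflection operators -/

section Operators

variable {K : Type*} [Field K] {N : ℕ}

/-- The operator `Φ ↦ g Ř(x / y) Φ`, when `g` exchanges `x` and `y`. -/
def exchangeOp (g : RingAut K) (t x y : K) (i j : Fin N) :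
    AddMonoid.End ((Fin N → SignType) → K) :=
  semilin g (1 + ((y - x) / (t * y - x)) • hopGen t i j)

/-- The operator `Φ ↦ g K₁(z) Φ`, when `g` inverts `z`. -/
def leftOp (g : RingAut K) (a b z : K) (k : Fin N) : AddMonoid.End ((Fin N → SignType) → K) :=
  semilin g (1 + ((1 - z ^ 2) / ((1 - a * z) * (1 - b * z))) • flipGen 1 (-(a * b)) k)

/-- The operator `Φ ↦ g K_N(z) Φ`, when `g` inverts `z`. -/
def rightOp (g : RingAut K) (c d z : K) (k : Fin N) : AddMonoid.End ((Fin N → SignType) → K) :=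
  semilin g (1 + ((z ^ 2 - 1) / ((c - z) * (d - z))) • flipGen (-(c * d)) 1 k)

theorem semilin_mul_one_add_smul {g h : RingAut K} (r : K)
    (M G : Matrix (Fin N → SignType) (Fin N → SignType) K) (hG : G.map g = G) :
    semilin g M * semilin h (1 + r • G) = semilin (g * h) (M * (1 + g r • G)) := by
  rw [semilin_mul, map_one_add_smul, hG]

theorem hopGen_map_of_fixed {g : RingAut K} {t : K} (hg : g t = t) (i j : Fin N) :
    (hopGen t i j).map g = hopGen t i j := by
  have := hopGen_map (g : K →+* K) t i j
  rwa [RingHom.coe_coe, hg] at this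

theorem flipGen_map_of_fixed {g : RingAut K} {ρ σ : K} (hρ : g ρ = ρ) (hσ : g σ = σ)
    (k : Fin N) : (flipGen ρ σ k).map g = flipGen ρ σ k := by
  have := flipGen_map (g : K →+* K) ρ σ k
  rwa [RingHom.coe_coe, hρ, hσ] at this

theorem exchangeOp_mul_self {g : RingAut K} (hg : g * g = 1) {t x y : K} (ht : g t = t)
    (hx : g x = y) (hy : g y = x) (h₁ : t * y - x ≠ 0) (h₂ : t * x - y ≠ 0) (i j : Fin N) :
    exchangeOp g t x y i j * exchangeOp g t x y i j = 1 := by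
  unfold exchangeOp
  rw [semilin_mul_one_add_smul _ _ _ (hopGen_map_of_fixed ht _ _), hg]
  simp only [map_div₀, map_sub, map_mul, ht, hx, hy]
  exact (congrArg _ (one_add_smul_mul_of_quadratic (hopGen_mul_self _ _ t)
    (exchange_scalar_unitarity h₁ h₂))).trans semilin_one

theorem leftOp_mul_self {g : RingAut K} (hg : g * g = 1) {a b z : K} (ha : g a = a)
    (hb : g b = b) (hz : g z = z⁻¹) (hz0 : z ≠ 0) (h₁ : 1 - a * z ≠ 0) (h₂ : 1 - b * z ≠ 0)
    (h₃ : 1 - a * z⁻¹ ≠ 0) (h₄ : 1 - b * z⁻¹ ≠ 0) (k : Fin N) :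
    leftOp g a b z k * leftOp g a b z k = 1 := by
  unfold leftOp
  rw [semilin_mul_one_add_smul _ _ _
    (flipGen_map_of_fixed (map_one g) (by rw [map_neg, map_mul, ha, hb]) _), hg]
  simp only [map_div₀, map_sub, map_mul, map_pow, map_one, ha, hb, hz]
  exact (congrArg _ (one_add_smul_mul_of_quadratic (flipGen_mul_self k _ _)
    (left_scalar_unitarity hz0 h₁ h₂ h₃ h₄))).trans semilin_one

theorem rightOp_mul_self {g : RingAut K} (hg : g * g = 1) {c d z : K} (hc : g c = c)
    (hd : g d = d) (hz : g z = z⁻¹) (hz0 : z ≠ 0) (h₁ : c - z ≠ 0) (h₂ : d - z ≠ 0)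
    (h₃ : c - z⁻¹ ≠ 0) (h₄ : d - z⁻¹ ≠ 0) (k : Fin N) :
    rightOp g c d z k * rightOp g c d z k = 1 := by
  unfold rightOp
  rw [semilin_mul_one_add_smul _ _ _
    (flipGen_map_of_fixed (by rw [map_neg, map_mul, hc, hd]) (map_one g) _), hg]
  simp only [map_div₀, map_sub, map_mul, map_pow, map_one, hc, hd, hz]
  exact (congrArg _ (one_add_smul_mul_of_quadratic (flipGen_mul_self k _ _)
    (right_scalar_unitarity hz0 h₁ h₂ h₃ h₄))).trans semilin_one

/-- Once the automorphisms are collected on one side, the three coefficients belong to the pairs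
`(x, y)`, `(x, z)`, `(y, z)`, and the claim becomes the Yang–Baxter equation for matrices over `K`.
-/
theorem exchangeOp_braid {g h : RingAut K} (hgh : g * h * g = h * g * h) {t x y z : K}
    (gt : g t = t) (ht : h t = t) (gx : g x = y) (gy : g y = x) (gz : g z = z) (hx : h x = x)
    (hy : h y = z) (hz : h z = y) (h₁ : t * y - x ≠ 0) (h₂ : t * z - x ≠ 0)
    (h₃ : t * z - y ≠ 0) {i j k : Fin N} (hij : i ≠ j) (hik : i ≠ k) (hjk : j ≠ k) :
    exchangeOp g t x y i j * exchangeOp h t y z j k * exchangeOp g t x y i j =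
      exchangeOp h t y z j k * exchangeOp g t x y i j * exchangeOp h t y z j k := by
  unfold exchangeOp
  rw [semilin_mul_one_add_smul _ _ _ (hopGen_map_of_fixed gt _ _),
    semilin_mul_one_add_smul _ _ _ (hopGen_map_of_fixed ht _ _),
    semilin_mul_one_add_smul _ _ _ (hopGen_map_of_fixed (by rw [RingAut.mul_apply, ht, gt]) _ _),
    semilin_mul_one_add_smul _ _ _ (hopGen_map_of_fixed (by rw [RingAut.mul_apply, gt, ht]) _ _),
    hgh]
  simp only [RingAut.mul_apply, map_div₀, map_sub, map_mul, gt, ht, gx, gy, gz, hx, hy, hz]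
  exact congrArg _ (baxterized_braid (hopGen_mul_self _ _ _) (hopGen_mul_self _ _ _)
      (hopGen_braid hij hik hjk _) (exchange_scalar_braid h₁ h₂ h₃))

theorem leftOp_reflection {g h : RingAut K} (hgh : g * h * g * h = h * g * h * g)
    {t a b x y : K} (gt : g t = t) (ga : g a = a) (gb : g b = b) (ht : h t = t) (ha : h a = a)
    (hb : h b = b) (gx : g x = x⁻¹) (gy : g y = y) (hx : h x = y) (hy : h y = x) (hx0 : x ≠ 0)
    (hy0 : y ≠ 0) (h₁ : 1 - a * x ≠ 0) (h₂ : 1 - b * x ≠ 0) (h₃ : 1 - a * y ≠ 0)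
    (h₄ : 1 - b * y ≠ 0) (h₅ : t * y - x ≠ 0) (h₆ : t * y - x⁻¹ ≠ 0) (h₇ : t * x - y⁻¹ ≠ 0)
    (h₈ : t * x⁻¹ - y⁻¹ ≠ 0) {i j : Fin N} (hij : i ≠ j) :
    leftOp g a b x i * exchangeOp h t x y i j * leftOp g a b x i * exchangeOp h t x y i j =
      exchangeOp h t x y i j * leftOp g a b x i * exchangeOp h t x y i j * leftOp g a b x i := by
  have fix (f : RingAut K) (fa : f a = a) (fb : f b = b) :
      (flipGen 1 (-(a * b)) i).map f = flipGen 1 (-(a * b)) i :=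
    flipGen_map_of_fixed (map_one f) (by rw [map_neg, map_mul, fa, fb]) i
  -- The exchange coefficient depends only on the quotient of its two arguments: here both sides are
  -- functions of `x * y`, and in `e'` of the quotient of `x` and `y`.
  have e : (x - y⁻¹) / (t * x - y⁻¹) = (y - x⁻¹) / (t * y - x⁻¹) := by
    rw [div_eq_div_iff h₇ h₆]
    field_simp
  have e' : (x⁻¹ - y⁻¹) / (t * x⁻¹ - y⁻¹) = (y - x) / (t * y - x) := by
    rw [div_eq_div_iff h₈ h₅]
    field_simp
  unfold exchangeOp leftOp
  rw [semilin_mul_one_add_smul _ _ _ (hopGen_map_of_fixed gt _ _),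
    semilin_mul_one_add_smul _ _ _ (fix _ (by rw [RingAut.mul_apply, ha, ga])
      (by rw [RingAut.mul_apply, hb, gb])),
    semilin_mul_one_add_smul _ _ _ (hopGen_map_of_fixed
      (by rw [RingAut.mul_apply, RingAut.mul_apply, gt, ht, gt]) _ _),
    semilin_mul_one_add_smul _ _ _ (fix _ ha hb),
    semilin_mul_one_add_smul _ _ _ (hopGen_map_of_fixed (by rw [RingAut.mul_apply, gt, ht]) _ _),
    semilin_mul_one_add_smul _ _ _ (fix _
      (by rw [RingAut.mul_apply, RingAut.mul_apply, ha, ga, ha])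
      (by rw [RingAut.mul_apply, RingAut.mul_apply, hb, gb, hb])), hgh]
  simp only [RingAut.mul_apply, map_div₀, map_sub, map_mul, map_pow, map_one, map_inv₀, gt, ga,
    gb, ht, ha, hb, gx, gy, hx, hy, e, e']
  exact congrArg _ (baxterized_reflection (hopGen_mul_self _ _ _) (flipGen_mul_self _ _ _)
      (flipGen_hopGen_left hij _ _ _)
      (left_scalar_reflection hx0 h₁ h₂ h₃ h₄ h₅ h₆ rfl rfl rfl rfl))

theorem rightOp_reflection {g h : RingAut K} (hgh : g * h * g * h = h * g * h * g)
    {t c d x y : K} (gt : g t = t) (gc : g c = c) (gd : g d = d) (ht : h t = t) (hc : h c = c)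
    (hd : h d = d) (gx : g x = x) (gy : g y = y⁻¹) (hx : h x = y) (hy : h y = x) (hx0 : x ≠ 0)
    (hy0 : y ≠ 0) (h₁ : c - x ≠ 0) (h₂ : d - x ≠ 0) (h₃ : c - y ≠ 0)
    (h₄ : d - y ≠ 0) (h₅ : t * y - x ≠ 0) (h₆ : t * y⁻¹ - x ≠ 0) (h₇ : t * x⁻¹ - y ≠ 0)
    (h₈ : t * x⁻¹ - y⁻¹ ≠ 0) {i j : Fin N} (hij : i ≠ j) :
    rightOp g c d y j * exchangeOp h t x y i j * rightOp g c d y j * exchangeOp h t x y i j =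
      exchangeOp h t x y i j * rightOp g c d y j * exchangeOp h t x y i j *
        rightOp g c d y j := by
  have fix (f : RingAut K) (fc : f c = c) (fd : f d = d) :
      (flipGen (-(c * d)) 1 j).map f = flipGen (-(c * d)) 1 j :=
    flipGen_map_of_fixed (by rw [map_neg, map_mul, fc, fd]) (map_one f) j
  have e : (x⁻¹ - y) / (t * x⁻¹ - y) = (y⁻¹ - x) / (t * y⁻¹ - x) := by
    rw [div_eq_div_iff h₇ h₆]
    field_simp
  have e' : (x⁻¹ - y⁻¹) / (t * x⁻¹ - y⁻¹) = (y - x) / (t * y - x) := by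
    rw [div_eq_div_iff h₈ h₅]
    field_simp
  unfold exchangeOp rightOp
  rw [semilin_mul_one_add_smul _ _ _ (hopGen_map_of_fixed gt _ _),
    semilin_mul_one_add_smul _ _ _ (fix _ (by rw [RingAut.mul_apply, hc, gc])
      (by rw [RingAut.mul_apply, hd, gd])),
    semilin_mul_one_add_smul _ _ _ (hopGen_map_of_fixed
      (by rw [RingAut.mul_apply, RingAut.mul_apply, gt, ht, gt]) _ _),
    semilin_mul_one_add_smul _ _ _ (fix _ hc hd),
    semilin_mul_one_add_smul _ _ _ (hopGen_map_of_fixed (by rw [RingAut.mul_apply, gt, ht]) _ _),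
    semilin_mul_one_add_smul _ _ _ (fix _
      (by rw [RingAut.mul_apply, RingAut.mul_apply, hc, gc, hc])
      (by rw [RingAut.mul_apply, RingAut.mul_apply, hd, gd, hd])), hgh]
  simp only [RingAut.mul_apply, map_div₀, map_sub, map_mul, map_pow, map_one, map_inv₀, gt, gc,
    gd, ht, hc, hd, gx, gy, hx, hy, e, e']
  exact congrArg _ (baxterized_reflection (hopGen_mul_self _ _ _) (flipGen_mul_self _ _ _)
      (flipGen_hopGen_right hij _ _ _)
      (right_scalar_reflection hy0 h₁ h₂ h₃ h₄ h₅ h₆ rfl rfl rfl rfl))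

theorem exchangeOp_commute {g h : RingAut K} (hgh : g * h = h * g) {t x y z u : K}
    (gt : g t = t) (ht : h t = t) (gz : g z = z) (gu : g u = u) (hx : h x = x) (hy : h y = y)
    {i j k l : Fin N} (hik : i ≠ k) (hil : i ≠ l) (hjk : j ≠ k) (hjl : j ≠ l) :
    Commute (exchangeOp g t x y i j) (exchangeOp h t z u k l) := by
  unfold exchangeOp Commute SemiconjBy
  rw [semilin_mul_one_add_smul _ _ _ (hopGen_map_of_fixed gt _ _),
    semilin_mul_one_add_smul _ _ _ (hopGen_map_of_fixed ht _ _), hgh]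
  simp only [map_div₀, map_sub, map_mul, gt, gz, gu, ht, hx, hy]
  rw [one_add_smul_commute (hopGen_commute hik hil hjk hjl _)]

theorem leftOp_commute_exchangeOp {g h : RingAut K} (hgh : g * h = h * g) {t a b x y z : K}
    (gt : g t = t) (ha : h a = a) (hb : h b = b) (gx : g x = x) (gy : g y = y) (hz : h z = z)
    {i j k : Fin N} (hki : k ≠ i) (hkj : k ≠ j) :
    Commute (leftOp g a b z k) (exchangeOp h t x y i j) := by
  unfold exchangeOp leftOp Commute SemiconjBy
  rw [semilin_mul_one_add_smul _ _ _ (hopGen_map_of_fixed gt _ _),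
    semilin_mul_one_add_smul _ _ _ (flipGen_map_of_fixed (map_one h)
      (by rw [map_neg, map_mul, ha, hb]) _), hgh]
  simp only [map_div₀, map_sub, map_mul, map_one, map_pow, gt, gx, gy, ha, hb, hz]
  rw [one_add_smul_commute (flipGen_commute_hopGen hki hkj _ _ _)]

theorem rightOp_commute_exchangeOp {g h : RingAut K} (hgh : g * h = h * g) {t c d x y z : K}
    (gt : g t = t) (hc : h c = c) (hd : h d = d) (gx : g x = x) (gy : g y = y) (hz : h z = z)
    {i j k : Fin N} (hki : k ≠ i) (hkj : k ≠ j) :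
    Commute (rightOp g c d z k) (exchangeOp h t x y i j) := by
  unfold exchangeOp rightOp Commute SemiconjBy
  rw [semilin_mul_one_add_smul _ _ _ (hopGen_map_of_fixed gt _ _),
    semilin_mul_one_add_smul _ _ _ (flipGen_map_of_fixed
      (by rw [map_neg, map_mul, hc, hd]) (map_one h) _), hgh]
  simp only [map_div₀, map_sub, map_mul, map_one, map_pow, gt, gx, gy, hc, hd, hz]
  rw [one_add_smul_commute (flipGen_commute_hopGen hki hkj _ _ _)]

theorem leftOp_commute_rightOp {g h : RingAut K} (hgh : g * h = h * g) {a b c d x y : K}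
    (ha : h a = a) (hb : h b = b) (hx : h x = x) (gc : g c = c) (gd : g d = d) (gy : g y = y)
    {k l : Fin N} (hkl : k ≠ l) : Commute (leftOp g a b x k) (rightOp h c d y l) := by
  unfold leftOp rightOp Commute SemiconjBy
  rw [semilin_mul_one_add_smul _ _ _ (flipGen_map_of_fixed
      (by rw [map_neg, map_mul, gc, gd]) (map_one g) _),
    semilin_mul_one_add_smul _ _ _ (flipGen_map_of_fixed (map_one h)
      (by rw [map_neg, map_mul, ha, hb]) _), hgh]
  simp only [map_div₀, map_sub, map_mul, map_one, map_pow, gc, gd, gy, ha, hb, hx]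
  rw [one_add_smul_commute (flipGen_commute hkl _ _ _ _)]

end Operators

/-! ### Denominators -/

section Denominators

variable {N : ℕ}

theorem exchange_den_ne_zero (t : ℂ) {i j : Fin N} (h : i ≠ j) :
    constHom N t * var j - var i ≠ 0 :=
  constHom_mul_mono_sub_ne_zero t fun e => by
    have := congrFun e i
    simp [h] at this

theorem left_den_ne_zero (a : ℂ) (k : Fin N) : 1 - constHom N a * var k ≠ 0 := by
  rw [← neg_sub, neg_ne_zero, ← mono_zero]
  exact constHom_mul_mono_sub_ne_zero a fun e => by
    have := congrFun e k
    simp at this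

theorem left_den_inv_ne_zero (a : ℂ) (k : Fin N) : 1 - constHom N a * (var k)⁻¹ ≠ 0 := by
  rw [← neg_sub, neg_ne_zero, ← mono_zero, var_eq_mono, ← mono_neg]
  exact constHom_mul_mono_sub_ne_zero a fun e => by
    have := congrFun e k
    simp at this

theorem right_den_ne_zero (c : ℂ) (k : Fin N) : constHom N c - var k ≠ 0 := by
  rw [← mul_one (constHom N c), ← mono_zero]
  exact constHom_mul_mono_sub_ne_zero c fun e => by
    have := congrFun e k
    simp at this

theorem right_den_inv_ne_zero (c : ℂ) (k : Fin N) : constHom N c - (var k)⁻¹ ≠ 0 := by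
  rw [← mul_one (constHom N c), ← mono_zero, var_eq_mono, ← mono_neg]
  exact constHom_mul_mono_sub_ne_zero c fun e => by
    have := congrFun e k
    simp at this

theorem exchange_den_inv_left_ne_zero (t : ℂ) {i j : Fin N} (h : i ≠ j) :
    constHom N t * var j - (var i)⁻¹ ≠ 0 := by
  rw [var_eq_mono i, ← mono_neg]
  exact constHom_mul_mono_sub_ne_zero t fun e => by
    have := congrFun e i
    simp [h] at this

theorem exchange_den_inv_right_ne_zero (t : ℂ) {i j : Fin N} (h : i ≠ j) :
    constHom N t * (var j)⁻¹ - var i ≠ 0 := by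
  rw [var_eq_mono j, ← mono_neg]
  exact constHom_mul_mono_sub_ne_zero t fun e => by
    have := congrFun e i
    simp [h] at this

theorem exchange_den_inv_inv_ne_zero (t : ℂ) {i j : Fin N} (h : i ≠ j) :
    constHom N t * (var j)⁻¹ - (var i)⁻¹ ≠ 0 := by
  rw [var_eq_mono j, var_eq_mono i, ← mono_neg, ← mono_neg]
  exact constHom_mul_mono_sub_ne_zero t fun e => by
    have := congrFun e i
    simp [h] at this

end Denominators

/-! ### Common fixed vectors -/

section FixedVectors

variable {V : Type*} [AddCommGroup V] {L R : AddMonoid.End V} {c : ℕ → AddMonoid.End V} {n : ℕ}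

theorem palindrome_preserves {S : V → Prop} (hR : ∀ u, S u → S (R u))
    (hc : ∀ i < n, ∀ u, S u → S (c i u)) :
    ∀ l ≤ n, ∀ u, S u → S (palindrome R c l u)
  | 0, _, u, hu => hR u hu
  | l + 1, h, u, hu => hc l (by omega) _
      (palindrome_preserves hR hc l (by omega) _ (hc l (by omega) _ hu))

/-- If the fixed vectors in `S` of the translation `L * palindrome R c n` reduce to `v`, then `v`
is fixed by all generators. -/
theorem fixed_of_unique_fixed (hL : L * L = 1) (hR : R * R = 1) (hc : ∀ i < n, c i * c i = 1)
    (hfar : ∀ i j, i < n → j < n → i + 2 ≤ j → Commute (c i) (c j))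
    (hRc : ∀ i, i < n → 1 ≤ i → Commute R (c i))
    (hLc : ∀ i, i + 1 < n → Commute L (c i))
    (hLR : 0 < n → Commute L R)
    (hbraid : ∀ i, i + 1 < n → c i * c (i + 1) * c i = c (i + 1) * c i * c (i + 1))
    (hR4 : 0 < n → R * c 0 * R * c 0 = c 0 * R * c 0 * R)
    (hL4 : ∀ k, n = k + 1 → L * c k * L * c k = c k * L * c k * L)
    {S : V → Prop} (SL : ∀ u, S u → S (L u)) (SR : ∀ u, S u → S (R u))
    (Sc : ∀ i < n, ∀ u, S u → S (c i u)) {v : V} (hv : S v)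
    (hX : (L * palindrome R c n) v = v)
    (huniq : ∀ u, S u → (L * palindrome R c n) u = u → u = v) :
    L v = v ∧ R v = v ∧ ∀ i < n, c i v = v := by
  have hZ := palindrome_mul_self hR hc n le_rfl
  have hLL (u : V) : L (L u) = u := DFunLike.congr_fun hL u
  have hZZ (u : V) : palindrome R c n (palindrome R c n u) = u := DFunLike.congr_fun hZ u
  have hX' : L (palindrome R c n v) = v := hX
  have hZv : palindrome R c n v = L v := by rw [← hLL (palindrome R c n v), hX']
  -- The translation is a product of two involutions, which therefore agree on a fixed vector `v`;
  -- hence `L v` is again fixed by the translation, and uniqueness applies.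
  have hLv : L v = v := huniq _ (SL _ hv) <| by
    change L (palindrome R c n (L v)) = L v
    rw [← hZv, hZZ]
    exact hZv.symm ▸ rfl
  have of_commute {g : AddMonoid.End V} (hg : Commute g (L * palindrome R c n))
      (Sg : S (g v)) : g v = v := huniq _ Sg <| by
    have h := DFunLike.congr_fun hg v
    change g ((L * palindrome R c n) v) = (L * palindrome R c n) (g v) at h
    rw [← h, hX]
  rcases n with _ | k
  · refine ⟨hLv, ?_, by simp⟩
    change R v = L v at hZv
    rw [hZv, hLv]
  · have hz : Commute L (palindrome R c k) :=
      commute_palindrome (hLR (by omega)) k fun i hi => hLc i (by omega)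
    refine ⟨hLv, ?_, fun i hi => ?_⟩
    · exact of_commute ((hLR (by omega)).symm.mul_right
        (palindrome_commute_end hRc hR4 k (by omega))) (SR _ hv)
    · rcases Nat.lt_or_ge i k with h | h
      · exact of_commute ((hLc i (by omega)).symm.mul_right
          (palindrome_commute_inner hfar hRc hbraid k (by omega) i h)) (Sc i hi _ hv)
      obtain rfl : i = k := by omega
      have href := palindrome_reflection hc hfar hRc hbraid hR4 i hi
      have hL4 := hL4 i rfl
      have hci := hc i hi
      have SX : ∀ u, S u → S ((L * palindrome R c (i + 1)) u) := fun u hu =>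
        SL _ (palindrome_preserves SR Sc (i + 1) le_rfl u hu)
      -- The last generator does not commute with the translation `X`, but its conjugate of `X`
      -- does: these are translations in two neighbouring coordinates. Hence `c i (X (c i v))` is
      -- fixed by `X` and equals `v`; so `c i v` is fixed by `X` and equals `v` as well.
      have hXX : (L * palindrome R c (i + 1)) * c i * (L * palindrome R c (i + 1)) * c i =
          c i * (L * palindrome R c (i + 1)) * c i * (L * palindrome R c (i + 1)) := by
        simp only [palindrome]
        generalize palindrome R c i = z at *
        generalize c i = e at *
        have hz := hz.eq
        calc L * (e * z * e) * e * (L * (e * z * e)) * e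
            = L * e * z * (e * e) * L * e * z * (e * e) := by simp only [mul_assoc]
          _ = L * e * (z * L) * e * z := by rw [hci]; simp only [mul_assoc, mul_one]
          _ = L * e * L * (e * e) * z * e * z := by
            rw [← hz, hci]; simp only [mul_assoc, mul_one]
          _ = (L * e * L * e) * (e * z * e * z) := by simp only [mul_assoc]
          _ = e * L * e * (L * z) * e * z * e := by rw [hL4, ← href]; simp only [mul_assoc]
          _ = e * L * e * z * (e * e) * L * e * z * e := by
            rw [hz, hci]; simp only [mul_assoc, mul_one]
          _ = e * (L * (e * z * e)) * e * (L * (e * z * e)) := by simp only [mul_assoc]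
      have hee (u : V) : c i (c i u) = u := DFunLike.congr_fun hci u
      generalize L * palindrome R c (i + 1) = X at *
      have h2 : c i (X (c i v)) = v := by
        refine huniq _ (Sc i hi _ (SX _ (Sc i hi _ hv))) ?_
        have h := DFunLike.congr_fun hXX v
        change X (c i (X (c i v))) = c i (X (c i (X v))) at h
        rw [h, hX]
      refine huniq _ (Sc i hi _ hv) ?_
      rw [← hee (X (c i v)), h2]

end FixedVectors

/-! ### Products of factors `den + num * gen` -/

section Factors

variable {R : Type*} [CommRing R] {N : ℕ}

/-- The data of a linear factor `den + num * gen`. -/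
@[ext]
structure GenFactor (R : Type*) (N : ℕ) where
  den : R
  num : R
  gen : Matrix (Fin N → SignType) (Fin N → SignType) R

/-- The image of a factor under a map of the coefficients. -/
def GenFactor.map {R' : Type*} (φ : R → R') (f : GenFactor R N) : GenFactor R' N :=
  ⟨φ f.den, φ f.num, f.gen.map φ⟩

/-- The product of the factors `den + num * gen`. -/
def polyProd (l : List (GenFactor R N)) : Matrix (Fin N → SignType) (Fin N → SignType) R :=
  (l.map fun f => f.den • (1 : Matrix (Fin N → SignType) (Fin N → SignType) R) +
    f.num • f.gen).prod

/-- The product of the denominators. -/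
def denProd (l : List (GenFactor R N)) : R := (l.map GenFactor.den).prod

/-- The product of the normalised factors `1 + (num / den) * gen`. -/
def normProd {K : Type*} [Field K] (l : List (GenFactor K N)) :
    Matrix (Fin N → SignType) (Fin N → SignType) K :=
  (l.map fun f => 1 + (f.num / f.den) • f.gen).prod

/-- Links the stochastic form of the product, used over fields, with the polynomial form, which can
be specialised along any ring homomorphism. -/
theorem polyProd_eq_smul_normProd {K : Type*} [Field K] (l : List (GenFactor K N))
    (h : ∀ f ∈ l, f.den ≠ 0) : polyProd l = denProd l • normProd l := by
  induction l with
  | nil => simp [polyProd, denProd, normProd]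
  | cons f l ih =>
    have ih := ih fun g hg => h g (by simp [hg])
    unfold polyProd denProd normProd at ih ⊢
    simp only [List.map_cons, List.prod_cons]
    rw [ih, ← smul_mul_smul_comm, smul_add, smul_smul, mul_div_cancel₀ _ (h f (by simp))]

theorem denProd_ne_zero {K : Type*} [Field K] (l : List (GenFactor K N))
    (h : ∀ f ∈ l, f.den ≠ 0) : denProd l ≠ 0 := by
  unfold denProd
  simpa [List.prod_eq_zero_iff] using h

theorem polyProd_map {R' : Type*} [CommRing R'] (φ : R →+* R') (l : List (GenFactor R N)) :
    polyProd (l.map (GenFactor.map φ)) = (polyProd l).map φ := by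
  induction l with
  | nil => simp [polyProd]
  | cons f l ih =>
    unfold polyProd at ih ⊢
    simp only [List.map_cons, List.prod_cons]
    rw [ih, Matrix.map_mul]
    congr 1
    ext w w'
    simp only [GenFactor.map, Matrix.add_apply, Matrix.smul_apply, Matrix.map_apply, smul_eq_mul,
      map_add, map_mul, Matrix.one_apply]
    split_ifs <;> simp

theorem denProd_map {R' : Type*} [CommRing R'] (φ : R →+* R') (l : List (GenFactor R N)) :
    denProd (l.map (GenFactor.map φ)) = φ (denProd l) := by
  unfold denProd
  rw [map_list_prod, List.map_map, List.map_map]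
  rfl

theorem normProd_map {K : Type*} [Field K] (g : RingAut K) (l : List (GenFactor K N)) :
    normProd (l.map (GenFactor.map g)) = (normProd l).map g := by
  induction l with
  | nil => simp [normProd]
  | cons f l ih =>
    unfold normProd at ih ⊢
    simp only [List.map_cons, List.prod_cons]
    have h := Matrix.map_mul (L := 1 + (f.num / f.den) • f.gen)
      (M := (l.map fun f => 1 + (f.num / f.den) • f.gen).prod) (f := (g : K →+* K))
    rw [RingHom.coe_coe] at h
    rw [ih, h, map_one_add_smul]
    simp [GenFactor.map]

/-- The site in position `l`, counted from the right end. -/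
def siteR (n l : ℕ) : Fin (n + 1) := ⟨n - l, by omega⟩

variable {n : ℕ}

theorem siteR_ne {k l : ℕ} (h : k ≠ l) (hk : k ≤ n) (hl : l ≤ n) : siteR n k ≠ siteR n l := by
  simp only [siteR, ne_eq, Fin.mk.injEq]
  omega

/-- The factors of the scattering matrix that takes a particle with spectral parameter `y`
from the position `l` to the right end and back. -/
def chainFactors (t c d y : R) (z : Fin (n + 1) → R) : ℕ → List (GenFactor R (n + 1))
  | 0 => [⟨(c - y) * (d - y), y ^ 2 - 1, flipGen (-(c * d)) 1 (siteR n 0)⟩]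
  | l + 1 => ⟨t * z (siteR n l) - y, z (siteR n l) - y, hopGen t (siteR n (l + 1)) (siteR n l)⟩ ::
      (chainFactors t c d y z l ++
        [⟨t - y * z (siteR n l), 1 - y * z (siteR n l), hopGen t (siteR n (l + 1)) (siteR n l)⟩])

/-- The factors of the full scattering matrix of the first particle. -/
def scatFactors (t a b c d y : R) (z : Fin (n + 1) → R) : List (GenFactor R (n + 1)) :=
  ⟨(y - a) * (y - b), y ^ 2 - 1, flipGen 1 (-(a * b)) (siteR n n)⟩ :: chainFactors t c d y z n

theorem chainFactors_map {R' : Type*} [CommRing R'] (φ : R →+* R') (t c d y : R)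
    (z : Fin (n + 1) → R) (l : ℕ) :
    (chainFactors t c d y z l).map (GenFactor.map φ) =
      chainFactors (φ t) (φ c) (φ d) (φ y) (φ ∘ z) l := by
  induction l with
  | zero => simp [chainFactors, GenFactor.map, flipGen_map]
  | succ l ih => simp [chainFactors, GenFactor.map, hopGen_map, ih]

theorem scatFactors_map {R' : Type*} [CommRing R'] (φ : R →+* R') (t a b c d y : R)
    (z : Fin (n + 1) → R) :
    (scatFactors t a b c d y z).map (GenFactor.map φ) =
      scatFactors (φ t) (φ a) (φ b) (φ c) (φ d) (φ y) (φ ∘ z) := by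
  simp [scatFactors, GenFactor.map, flipGen_map, chainFactors_map]

/-- A chain starting at position `l` meets only the variables at smaller positions. Automorphisms
that move other variables leave it alone, apart from their effect on `y`. -/
theorem chainFactors_congr (t c d y : R) {z z' : Fin (n + 1) → R} :
    ∀ l, (∀ j < l, z (siteR n j) = z' (siteR n j)) →
      chainFactors t c d y z l = chainFactors t c d y z' l
  | 0, _ => rfl
  | l + 1, h => by
    rw [chainFactors, chainFactors, chainFactors_congr t c d y l fun j hj => h j (by omega),
      h l (by omega)]

end Factors

/-! ### The operators on vectors of rational functions -/

section Concrete

variable (n : ℕ) (t a b c d : ℂ)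

/-- The exchange operator for the neighbouring sites in positions `l + 1` and `l`. -/
def bulkAct (l : ℕ) : AddMonoid.End ((Fin (n + 1) → SignType) → RatFun (n + 1)) :=
  exchangeOp (swapVar (siteR n (l + 1)) (siteR n l)) (constHom (n + 1) t) (var (siteR n (l + 1)))
    (var (siteR n l)) (siteR n (l + 1)) (siteR n l)

/-- The reflection operator for the last site. -/
def rightAct : AddMonoid.End ((Fin (n + 1) → SignType) → RatFun (n + 1)) :=
  rightOp (invVar (siteR n 0)) (constHom (n + 1) c) (constHom (n + 1) d) (var (siteR n 0))
    (siteR n 0)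

/-- The reflection operator for the first site. -/
def leftAct : AddMonoid.End ((Fin (n + 1) → SignType) → RatFun (n + 1)) :=
  leftOp (invVar (siteR n n)) (constHom (n + 1) a) (constHom (n + 1) b) (var (siteR n n))
    (siteR n n)

theorem swapVar_var_of_ne {N : ℕ} {i j k : Fin N} (hi : k ≠ i) (hj : k ≠ j) :
    swapVar i j (var k) = var k := by
  rw [swapVar_var, Equiv.swap_apply_of_ne_of_ne hi hj]

theorem swapVar_var_left {N : ℕ} (i j : Fin N) : swapVar i j (var i) = var j := by
  rw [swapVar_var, Equiv.swap_apply_left]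

theorem swapVar_var_right {N : ℕ} (i j : Fin N) : swapVar i j (var j) = var i := by
  rw [swapVar_var, Equiv.swap_apply_right]

theorem swapVar_commute_swapVar {N : ℕ} {i j k l : Fin N} (hik : i ≠ k) (hil : i ≠ l) (hjk : j ≠ k)
    (hjl : j ≠ l) : (swapVar i j * swapVar k l : RingAut (RatFun N)) =
      swapVar k l * swapVar i j := by
  rw [swapVar_mul_swapVar, Equiv.swap_apply_of_ne_of_ne hik.symm hjk.symm,
    Equiv.swap_apply_of_ne_of_ne hil.symm hjl.symm]

theorem invVar_commute_swapVar {N : ℕ} {i j k : Fin N} (hki : k ≠ i) (hkj : k ≠ j) :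
    (invVar k * swapVar i j : RingAut (RatFun N)) = swapVar i j * invVar k := by
  rw [swapVar_mul_invVar, Equiv.swap_apply_of_ne_of_ne hki hkj]

theorem swapVar_braid {N : ℕ} {i j k : Fin N} (hij : i ≠ j) (hik : i ≠ k) (hjk : j ≠ k) :
    (swapVar i j * swapVar j k * swapVar i j : RingAut (RatFun N)) =
      swapVar j k * swapVar i j * swapVar j k := by
  rw [swapVar_mul_swapVar i j j k, mul_assoc, swapVar_mul_self, mul_one,
    swapVar_mul_swapVar j k i j, mul_assoc, swapVar_mul_self, mul_one,
    Equiv.swap_apply_right, Equiv.swap_apply_left,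
    Equiv.swap_apply_of_ne_of_ne hik.symm hjk.symm, Equiv.swap_apply_of_ne_of_ne hij hik]

theorem invVar_swapVar_reflection {N : ℕ} (i j k : Fin N) :
    (invVar k * swapVar i j * invVar k * swapVar i j : RingAut (RatFun N)) =
      swapVar i j * invVar k * swapVar i j * invVar k := by
  have h := swapVar_mul_invVar i j k
  rw [mul_assoc _ (swapVar i j), h, ← mul_assoc, mul_assoc _ (swapVar i j), swapVar_mul_self,
    mul_one, mul_assoc (invVar _) (swapVar i j), swapVar_mul_self,
    mul_one, invVar_mul_invVar]

variable {n}

theorem bulkAct_mul_self {l : ℕ} (hl : l < n) : bulkAct n t l * bulkAct n t l = 1 := by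
  have h : siteR n (l + 1) ≠ siteR n l := siteR_ne (by omega) (by omega) (by omega)
  exact exchangeOp_mul_self (swapVar_mul_self _ _) (swapVar_constHom _ _ _) (swapVar_var_left _ _)
    (swapVar_var_right _ _) (exchange_den_ne_zero t h) (exchange_den_ne_zero t h.symm) _ _

theorem leftAct_mul_self : leftAct n a b * leftAct n a b = 1 :=
  leftOp_mul_self (invVar_mul_self _) (invVar_constHom _ _) (invVar_constHom _ _)
    (invVar_var_self _) (var_ne_zero _) (left_den_ne_zero _ _) (left_den_ne_zero _ _)
    (left_den_inv_ne_zero _ _) (left_den_inv_ne_zero _ _) _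

theorem rightAct_mul_self : rightAct n c d * rightAct n c d = 1 :=
  rightOp_mul_self (invVar_mul_self _) (invVar_constHom _ _) (invVar_constHom _ _)
    (invVar_var_self _) (var_ne_zero _) (right_den_ne_zero _ _) (right_den_ne_zero _ _)
    (right_den_inv_ne_zero _ _) (right_den_inv_ne_zero _ _) _

theorem bulkAct_braid {l : ℕ} (hl : l + 1 < n) :
    bulkAct n t l * bulkAct n t (l + 1) * bulkAct n t l =
      bulkAct n t (l + 1) * bulkAct n t l * bulkAct n t (l + 1) := by
  have hij : siteR n (l + 2) ≠ siteR n (l + 1) := siteR_ne (by omega) (by omega) (by omega)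
  have hik : siteR n (l + 2) ≠ siteR n l := siteR_ne (by omega) (by omega) (by omega)
  have hjk : siteR n (l + 1) ≠ siteR n l := siteR_ne (by omega) (by omega) (by omega)
  exact (exchangeOp_braid (swapVar_braid hij hik hjk) (swapVar_constHom _ _ _)
    (swapVar_constHom _ _ _) (swapVar_var_left _ _) (swapVar_var_right _ _)
    (swapVar_var_of_ne hik.symm hjk.symm) (swapVar_var_of_ne hij hik) (swapVar_var_left _ _)
    (swapVar_var_right _ _) (exchange_den_ne_zero t hij) (exchange_den_ne_zero t hik)
    (exchange_den_ne_zero t hjk) hij hik hjk).symm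

theorem bulkAct_commute {k l : ℕ} (hk : k < n) (hl : l < n) (hkl : k + 2 ≤ l) :
    Commute (bulkAct n t k) (bulkAct n t l) := by
  have h1 : siteR n (k + 1) ≠ siteR n (l + 1) := siteR_ne (by omega) (by omega) (by omega)
  have h2 : siteR n (k + 1) ≠ siteR n l := siteR_ne (by omega) (by omega) (by omega)
  have h3 : siteR n k ≠ siteR n (l + 1) := siteR_ne (by omega) (by omega) (by omega)
  have h4 : siteR n k ≠ siteR n l := siteR_ne (by omega) (by omega) (by omega)
  exact exchangeOp_commute (swapVar_commute_swapVar h1 h2 h3 h4) (swapVar_constHom _ _ _)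
    (swapVar_constHom _ _ _) (swapVar_var_of_ne h1.symm h3.symm) (swapVar_var_of_ne h2.symm h4.symm)
    (swapVar_var_of_ne h1 h2) (swapVar_var_of_ne h3 h4) h1 h2 h3 h4

theorem rightAct_commute_bulkAct {l : ℕ} (hl : l < n) (h1l : 1 ≤ l) :
    Commute (rightAct n c d) (bulkAct n t l) := by
  have h1 : siteR n 0 ≠ siteR n (l + 1) := siteR_ne (by omega) (by omega) (by omega)
  have h2 : siteR n 0 ≠ siteR n l := siteR_ne (by omega) (by omega) (by omega)
  exact rightOp_commute_exchangeOp (invVar_commute_swapVar h1 h2) (invVar_constHom _ _)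
    (swapVar_constHom _ _ _) (swapVar_constHom _ _ _) (invVar_var_of_ne h1.symm)
    (invVar_var_of_ne h2.symm) (swapVar_var_of_ne h1 h2) h1 h2

theorem leftAct_commute_bulkAct {l : ℕ} (hl : l + 1 < n) :
    Commute (leftAct n a b) (bulkAct n t l) := by
  have h1 : siteR n n ≠ siteR n (l + 1) := siteR_ne (by omega) (by omega) (by omega)
  have h2 : siteR n n ≠ siteR n l := siteR_ne (by omega) (by omega) (by omega)
  exact leftOp_commute_exchangeOp (invVar_commute_swapVar h1 h2) (invVar_constHom _ _)
    (swapVar_constHom _ _ _) (swapVar_constHom _ _ _) (invVar_var_of_ne h1.symm)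
    (invVar_var_of_ne h2.symm) (swapVar_var_of_ne h1 h2) h1 h2

theorem leftAct_commute_rightAct (hn : 0 < n) : Commute (leftAct n a b) (rightAct n c d) := by
  have h1 : siteR n n ≠ siteR n 0 := siteR_ne (by omega) (by omega) (by omega)
  exact leftOp_commute_rightOp (invVar_mul_invVar _ _) (invVar_constHom _ _)
    (invVar_constHom _ _) (invVar_var_of_ne h1) (invVar_constHom _ _)
    (invVar_constHom _ _) (invVar_var_of_ne h1.symm) h1

theorem rightAct_reflection (hn : 0 < n) :
    rightAct n c d * bulkAct n t 0 * rightAct n c d * bulkAct n t 0 =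
      bulkAct n t 0 * rightAct n c d * bulkAct n t 0 * rightAct n c d := by
  have h : siteR n 1 ≠ siteR n 0 := siteR_ne (by omega) (by omega) (by omega)
  exact rightOp_reflection (invVar_swapVar_reflection _ _ _) (invVar_constHom _ _)
    (invVar_constHom _ _) (invVar_constHom _ _) (swapVar_constHom _ _ _) (swapVar_constHom _ _ _)
    (swapVar_constHom _ _ _) (invVar_var_of_ne h) (invVar_var_self _) (swapVar_var_left _ _)
    (swapVar_var_right _ _) (var_ne_zero _) (var_ne_zero _) (right_den_ne_zero _ _)
    (right_den_ne_zero _ _) (right_den_ne_zero _ _) (right_den_ne_zero _ _)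
    (exchange_den_ne_zero _ h) (exchange_den_inv_right_ne_zero _ h)
    (exchange_den_inv_right_ne_zero _ h.symm) (exchange_den_inv_inv_ne_zero _ h.symm) h

theorem leftAct_reflection (k : ℕ) :
    leftAct (k + 1) a b * bulkAct (k + 1) t k * leftAct (k + 1) a b * bulkAct (k + 1) t k =
      bulkAct (k + 1) t k * leftAct (k + 1) a b * bulkAct (k + 1) t k * leftAct (k + 1) a b := by
  have h : siteR (k + 1) (k + 1) ≠ siteR (k + 1) k := siteR_ne (by omega) (by omega) (by omega)
  exact leftOp_reflection (invVar_swapVar_reflection _ _ _) (invVar_constHom _ _)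
    (invVar_constHom _ _) (invVar_constHom _ _) (swapVar_constHom _ _ _) (swapVar_constHom _ _ _)
    (swapVar_constHom _ _ _) (invVar_var_self _) (invVar_var_of_ne h.symm) (swapVar_var_left _ _)
    (swapVar_var_right _ _) (var_ne_zero _) (var_ne_zero _) (left_den_ne_zero _ _)
    (left_den_ne_zero _ _) (left_den_ne_zero _ _) (left_den_ne_zero _ _)
    (exchange_den_ne_zero _ h) (exchange_den_inv_left_ne_zero _ h)
    (exchange_den_inv_left_ne_zero _ h.symm) (exchange_den_inv_inv_ne_zero _ h.symm) h

/-! ### The scattering matrix -/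

theorem exchange_coeff_inv {K : Type*} [Field K] {x : K} (hx : x ≠ 0) (t y : K) :
    (x⁻¹ - y) / (t * x⁻¹ - y) = (1 - x * y) / (t - x * y) := by
  rw [← mul_div_mul_left _ _ hx, mul_sub, mul_sub, mul_inv_cancel₀ hx, mul_left_comm x t,
    mul_inv_cancel₀ hx, mul_one]

theorem left_coeff_inv {K : Type*} [Field K] {z : K} (hz : z ≠ 0) (a b : K) :
    (1 - z ^ 2) / ((1 - a * z) * (1 - b * z)) =
      (z⁻¹ ^ 2 - 1) / ((z⁻¹ - a) * (z⁻¹ - b)) := by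
  have h1 : 1 - z ^ 2 = z ^ 2 * (z⁻¹ ^ 2 - 1) := by field_simp
  have h2 : (1 - a * z) * (1 - b * z) = z ^ 2 * ((z⁻¹ - a) * (z⁻¹ - b)) := by field_simp
  rw [h1, h2, mul_div_mul_left _ _ (pow_ne_zero 2 hz)]

theorem right_coeff_inv {K : Type*} [Field K] {z : K} (hz : z ≠ 0) (c d : K) :
    (1 - z⁻¹ ^ 2) / ((c * z⁻¹ - 1) * (d * z⁻¹ - 1)) = (z ^ 2 - 1) / ((c - z) * (d - z)) := by
  have h1 : z ^ 2 - 1 = z ^ 2 * (1 - z⁻¹ ^ 2) := by field_simp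
  have h2 : (c - z) * (d - z) = z ^ 2 * ((c * z⁻¹ - 1) * (d * z⁻¹ - 1)) := by field_simp
  rw [h1, h2, mul_div_mul_left _ _ (pow_ne_zero 2 hz)]

/-- The factors of the generic scattering matrix. -/
abbrev genericFactors (n : ℕ) (t a b c d : ℂ) : List (GenFactor (RatFun (n + 1)) (n + 1)) :=
  scatFactors (constHom (n + 1) t) (constHom (n + 1) a) (constHom (n + 1) b) (constHom (n + 1) c)
    (constHom (n + 1) d) (var (siteR n n))⁻¹ var

theorem normProd_cons {K : Type*} [Field K] {N : ℕ} (f : GenFactor K N)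
    (l : List (GenFactor K N)) : normProd (f :: l) = (1 + (f.num / f.den) • f.gen) * normProd l :=
  rfl

theorem normProd_append {K : Type*} [Field K] {N : ℕ} (l l' : List (GenFactor K N)) :
    normProd (l ++ l') = normProd l * normProd l' := by
  simp [normProd]

theorem normProd_singleton {K : Type*} [Field K] {N : ℕ} (f : GenFactor K N) :
    normProd [f] = 1 + (f.num / f.den) • f.gen := by
  simp [normProd]

theorem normProd_chainFactors_map {g : RingAut (RatFun (n + 1))}
    (hg : ∀ x, g (constHom (n + 1) x) = constHom (n + 1) x) (y : RatFun (n + 1)) (l : ℕ)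
    (hv : ∀ j < l, g (var (siteR n j)) = var (siteR n j)) :
    (normProd (chainFactors (constHom (n + 1) t) (constHom (n + 1) c) (constHom (n + 1) d) y
      var l)).map g =
    normProd (chainFactors (constHom (n + 1) t) (constHom (n + 1) c) (constHom (n + 1) d) (g y)
      var l) := by
  have h := chainFactors_map (g : RatFun (n + 1) →+* RatFun (n + 1)) (constHom (n + 1) t)
    (constHom (n + 1) c) (constHom (n + 1) d) y var l
  simp only [RingHom.coe_coe, hg] at h
  rw [← normProd_map, h, chainFactors_congr _ _ _ _ l hv]

/-- Conjugating the inversion of one variable by an exchange gives the inversion of the neighbouring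
variable. The exchange replaces the moving spectral parameter by the new one, and the returning
exchange factor sees it inverted, which produces the product `y * z` in its coefficient. -/
theorem palindrome_eq_semilin : ∀ l ≤ n, palindrome (rightAct n c d) (bulkAct n t) l =
    semilin (invVar (siteR n l)) (normProd (chainFactors (constHom (n + 1) t) (constHom (n + 1) c)
      (constHom (n + 1) d) (var (siteR n l)) var l))
  | 0, _ => by
    rw [palindrome, chainFactors, normProd_singleton]
    rfl
  | l + 1, hl => by
    have h : siteR n (l + 1) ≠ siteR n l := siteR_ne (by omega) (by omega) (by omega)
    have e : (invVar (siteR n (l + 1)) * swapVar (siteR n (l + 1)) (siteR n l) :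
        RingAut (RatFun (n + 1))) ((var (siteR n l) - var (siteR n (l + 1))) /
          (constHom (n + 1) t * var (siteR n l) - var (siteR n (l + 1)))) =
        (1 - var (siteR n (l + 1)) * var (siteR n l)) /
          (constHom (n + 1) t - var (siteR n (l + 1)) * var (siteR n l)) := by
      simp only [RingAut.mul_apply, map_div₀, map_sub, map_mul, swapVar_var_left,
        swapVar_var_right, swapVar_constHom, invVar_constHom, invVar_var_self,
        invVar_var_of_ne h.symm]
      exact exchange_coeff_inv (var_ne_zero _) _ _
    rw [palindrome, palindrome_eq_semilin l (by omega)]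
    unfold bulkAct exchangeOp
    rw [semilin_mul, semilin_mul_one_add_smul _ _ _ (hopGen_map_of_fixed
      (by rw [RingAut.mul_apply, invVar_constHom, swapVar_constHom]) _ _),
      normProd_chainFactors_map _ _ _ (swapVar_constHom _ _) _ _ fun j hj => swapVar_var_of_ne
        (siteR_ne (by omega) (by omega) (by omega)) (siteR_ne (by omega) (by omega) (by omega)),
      swapVar_var_right, chainFactors, normProd_cons, normProd_append, normProd_singleton,
      swapVar_mul_invVar, Equiv.swap_apply_right, mul_assoc (invVar _), swapVar_mul_self,
      mul_one, e, mul_assoc]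

/-- Both factors carry the inversion of the first variable. The two inversions cancel, so the
translation is linear, and passing the first inversion through the chain replaces its parameter by
the inverse. -/
theorem leftAct_mul_palindrome : leftAct n a b * palindrome (rightAct n c d) (bulkAct n t) n =
    semilin 1 (normProd (genericFactors n t a b c d)) := by
  rw [palindrome_eq_semilin t c d n le_rfl]
  unfold leftAct leftOp
  rw [semilin_mul, invVar_mul_self, normProd_chainFactors_map _ _ _ (invVar_constHom _) _ _
    fun j hj => invVar_var_of_ne (siteR_ne (by omega) (by omega) (by omega)), invVar_var_self,
    genericFactors, scatFactors, normProd_cons, left_coeff_inv (var_ne_zero (siteR n n))]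

end Concrete

/-! ### Comparison with the exchange-reflection system -/

section Comparison

theorem bulkGen_apply {F : Type*} [Field F] {s : F} (hs : s ≠ 0) (x y x' y' : SignType) :
    bulkGen s (x, y) (x', y') =
      s⁻¹ * ((if x' = y ∧ y' = x then hopRate (s ^ 2) x y else 0) -
        if x' = x ∧ y' = y then hopRate (s ^ 2) y x else 0) := by
  have h2 : s⁻¹ * s ^ 2 = s := by rw [pow_two, inv_mul_cancel_left₀ hs]
  have e : bulkGen s (x, y) (x', y') =
      (if x' = y ∧ y' = x then s ^ ((SignType.sign ((y : ℤ) - (x : ℤ)) : SignType) : ℤ) else 0) -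
        if x' = x ∧ y' = y then s ^ ((SignType.sign ((x : ℤ) - (y : ℤ)) : SignType) : ℤ)
          else 0 := by
    simp only [bulkGen, unitE, Matrix.sum_apply, Matrix.smul_apply, Matrix.sub_apply,
      Matrix.kronecker, Matrix.kroneckerMap_apply, Matrix.single_apply, smul_eq_mul, mul_sub, Finset.sum_sub_distrib]
    congr 1
    · rw [Finset.sum_eq_single x, Finset.sum_eq_single y]
      · simp [eq_comm]; split_ifs <;> simp_all
      · intro b _ hb; simp [hb]
      · simp
      · intro b _ hb; simp [hb]
      · simp
    · rw [Finset.sum_eq_single y, Finset.sum_eq_single x]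
      · simp [eq_comm]; split_ifs <;> simp_all
      · intro b _ hb; simp [hb]
      · simp
      · intro b _ hb; simp [hb]
      · simp
  rw [e, mul_sub, mul_ite, mul_ite, mul_zero]
  cases x <;> cases y <;> simp [hopRate, h2]

theorem onTwo_bulkGen {F : Type*} [Field F] {N : ℕ} {s : F} (hs : s ≠ 0) (i j : Fin N) :
    onTwo i j (bulkGen s) = s⁻¹ • hopGen (s ^ 2) i j := by
  ext w w'
  rw [onTwo, bulkGen_apply hs, Matrix.smul_apply, hopGen, smul_eq_mul]
  by_cases h : ∀ k, k ≠ i → k ≠ j → w k = w' k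
  · have key (v : Fin N → SignType) (hv : ∀ k, k ≠ i → k ≠ j → w k = v k) :
        w' = v ↔ w' i = v i ∧ w' j = v j := by
      constructor
      · rintro rfl
        exact ⟨rfl, rfl⟩
      · rintro ⟨h1, h2⟩
        funext k
        by_cases hi : k = i
        · rw [hi, h1]
        · by_cases hj : k = j
          · rw [hj, h2]
          · rw [← h k hi hj, hv k hi hj]
    have h1 := key (w ∘ Equiv.swap i j) fun k hi hj => by
      rw [Function.comp, Equiv.swap_apply_of_ne_of_ne hi hj]
    have h2 := key w fun _ _ _ => rfl
    simp only [Function.comp, Equiv.swap_apply_left, Equiv.swap_apply_right] at h1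
    rw [if_pos h]
    simp only [h1, h2]
  · have h1 : w' ≠ w ∘ Equiv.swap i j := by
      rintro rfl
      exact h fun k hi hj => by rw [Function.comp, Equiv.swap_apply_of_ne_of_ne hi hj]
    have h2 : w' ≠ w := by
      rintro rfl
      exact h fun _ _ _ => rfl
    rw [if_neg h, if_neg h1, if_neg h2, sub_zero, mul_zero]

theorem onOne_bdryGen {F : Type*} [Field F] {N : ℕ} (ρ σ : F) (k : Fin N) :
    onOne k (bdryGen ρ σ) = flipGen ρ σ k := by
  ext w w'
  rw [onOne, flipGen]
  by_cases h : ∀ l, l ≠ k → w l = w' l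
  · have key (v : Fin N → SignType) (hv : ∀ l, l ≠ k → w l = v l) : w' = v ↔ w' k = v k := by
      constructor
      · rintro rfl
        rfl
      · intro h1
        funext l
        by_cases hl : l = k
        · rw [hl, h1]
        · rw [← h l hl, hv l hl]
    have h1 := key (Function.update w k (-w k)) fun l hl => by rw [Function.update_of_ne hl]
    have h2 := key w fun _ _ => rfl
    rw [Function.update_self] at h1
    rw [if_pos h]
    simp only [h1, h2]
    generalize w k = x
    generalize w' k = y
    simp only [bdryGen, unitE, flipRate, Matrix.add_apply, Matrix.smul_apply, Matrix.sub_apply,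
      Matrix.single_apply, smul_eq_mul]
    cases x <;> cases y <;> simp
  · have h1 : w' ≠ Function.update w k (-w k) := by
      rintro rfl
      exact h fun l hl => by rw [Function.update_of_ne hl]
    have h2 : w' ≠ w := by
      rintro rfl
      exact h fun _ _ => rfl
    rw [if_neg h, if_neg h1, if_neg h2, sub_zero]

theorem flipGen_smul {R : Type*} [CommRing R] {N : ℕ} (u ρ σ : R) (k : Fin N) :
    u • flipGen ρ σ k = flipGen (u * ρ) (u * σ) k := by
  ext w w'
  simp only [flipGen, flipRate, Matrix.smul_apply, smul_eq_mul]
  split_ifs <;> ring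

/-- Applying `g` to both sides of the equation on the left gives the one on the right, and
conversely, since `g` is an involution and commutes with evaluation up to transforming the entries
of `M`. -/
theorem semilin_map_fixed_iff {K : Type*} [Field K] {N : ℕ} {g : RingAut K} (hg : g * g = 1)
    (M : Matrix (Fin N → SignType) (Fin N → SignType) K) (Φ : (Fin N → SignType) → K) :
    M *ᵥ Φ = (fun w => g (Φ w)) ↔ semilin g (M.map g) Φ = Φ := by
  have hgg (x : K) : g (g x) = x := DFunLike.congr_fun hg x
  have e : semilin g (M.map g) Φ = fun w => g ((M *ᵥ Φ) w) :=
    (funext fun w => RingHom.map_mulVec (g : K →+* K) M Φ w).symm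
  rw [e]
  constructor
  · intro h
    rw [h]
    exact funext fun w => hgg _
  · intro h
    conv_rhs => rw [← h]
    exact funext fun w => (hgg _).symm

variable {n : ℕ}

theorem matR_fixed_iff {s : ℂ} (hs : s ≠ 0) {i j : Fin (n + 1)} (hij : i ≠ j)
    (Φ : (Fin (n + 1) → SignType) → RatFun (n + 1)) :
    (matR (const (n + 1) s) i j (var i * (var j)⁻¹) *ᵥ Φ = fun w => swapVar i j (Φ w)) ↔
      exchangeOp (swapVar i j) (constHom (n + 1) (s ^ 2)) (var i) (var j) i j Φ = Φ := by
  have hs' : constHom (n + 1) s ≠ 0 := by simpa using hs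
  have hj := var_ne_zero j
  have h1 : constHom (n + 1) (s ^ 2) * var i - var j ≠ 0 := exchange_den_ne_zero _ hij.symm
  have e : matR (const (n + 1) s) i j (var i * (var j)⁻¹) =
      1 + ((var i - var j) / (constHom (n + 1) (s ^ 2) * var i - var j)) •
        hopGen (constHom (n + 1) (s ^ 2)) i j := by
    rw [matR, const_eq_constHom, onTwo_bulkGen hs', smul_smul, map_pow]
    congr 2
    rw [map_pow] at h1
    generalize constHom (n + 1) s = u at *
    have h2 : u * (var i * (var j)⁻¹) - u⁻¹ = (u ^ 2 * var i - var j) / (u * var j) := by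
      field_simp
    rw [h2]
    generalize u ^ 2 * var i - var j = p at *
    field_simp
  rw [e, semilin_map_fixed_iff (swapVar_mul_self i j), map_one_add_smul,
    hopGen_map_of_fixed (swapVar_constHom _ _ _)]
  simp only [map_div₀, map_sub, map_mul, swapVar_var_left, swapVar_var_right, swapVar_constHom]
  rfl

theorem rateGamma_ne_zero {F : Type*} [Field F] {s a b : F} (hs : s ≠ 0) (hs1 : s ^ 2 ≠ 1)
    (ha : a ≠ 1) (hb : b ≠ 1) : rateGamma s a b ≠ 0 := by
  refine div_ne_zero ?_ (mul_ne_zero (sub_ne_zero.2 ha) (sub_ne_zero.2 hb))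
  intro h
  apply hs1
  rw [pow_two]
  nth_rewrite 1 [← sub_eq_zero.1 h]
  exact inv_mul_cancel₀ hs

/-- The boundary matrix involves only the ratio of the two rates, from which `s` drops out. This is
why the normalised flip generators have rates `1` and minus a product of two boundary parameters. -/
theorem inv_rateGamma_mul_rateAlpha {F : Type*} [Field F] {s a b : F} (h : rateGamma s a b ≠ 0) :
    (rateGamma s a b)⁻¹ * rateAlpha s a b = -(a * b) := by
  rw [inv_mul_eq_iff_eq_mul₀ h, rateAlpha, rateGamma]
  ring

theorem matKLeft_fixed_iff {s a b : ℂ} (hs : s ≠ 0) (hs1 : s ^ 2 ≠ 1) (ha : a ≠ 1) (hb : b ≠ 1)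
    (k : Fin (n + 1)) (Φ : (Fin (n + 1) → SignType) → RatFun (n + 1)) :
    (matKLeft (const (n + 1) s) (const (n + 1) a) (const (n + 1) b) k (var k) *ᵥ Φ =
      fun w => invVar k (Φ w)) ↔
      leftOp (invVar k) (constHom (n + 1) a) (constHom (n + 1) b) (var k) k Φ = Φ := by
  have hC := (constHom (n + 1)).injective
  have hγ : rateGamma (constHom (n + 1) s) (constHom (n + 1) a) (constHom (n + 1) b) ≠ 0 :=
    rateGamma_ne_zero (by simpa using hs) (fun h => hs1 (hC (by simpa using h)))
      (fun h => ha (hC (by simpa using h))) (fun h => hb (hC (by simpa using h)))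
  rw [matKLeft, const_eq_constHom, const_eq_constHom, const_eq_constHom, onOne_bdryGen,
    flipGen_smul, inv_mul_cancel₀ hγ, inv_rateGamma_mul_rateAlpha hγ,
    semilin_map_fixed_iff (invVar_mul_self k), map_one_add_smul,
    flipGen_map_of_fixed (map_one _) (by rw [map_neg, map_mul, invVar_constHom, invVar_constHom])]
  simp only [map_div₀, map_sub, map_mul, map_pow, map_one, invVar_var_self, invVar_constHom]
  rw [← left_coeff_inv (var_ne_zero k)]
  rfl

theorem matKRight_fixed_iff {s c d : ℂ} (hs : s ≠ 0) (hs1 : s ^ 2 ≠ 1) (hc : c ≠ 1) (hd : d ≠ 1)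
    (k : Fin (n + 1)) (Φ : (Fin (n + 1) → SignType) → RatFun (n + 1)) :
    (matKRight (const (n + 1) s) (const (n + 1) c) (const (n + 1) d) k (var k) *ᵥ Φ =
      fun w => invVar k (Φ w)) ↔
      rightOp (invVar k) (constHom (n + 1) c) (constHom (n + 1) d) (var k) k Φ = Φ := by
  have hC := (constHom (n + 1)).injective
  have hγ : rateGamma (constHom (n + 1) s) (constHom (n + 1) c) (constHom (n + 1) d) ≠ 0 :=
    rateGamma_ne_zero (by simpa using hs) (fun h => hs1 (hC (by simpa using h)))
      (fun h => hc (hC (by simpa using h))) (fun h => hd (hC (by simpa using h)))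
  have hδ : rateDelta (constHom (n + 1) s) (constHom (n + 1) c) (constHom (n + 1) d) =
    rateGamma (constHom (n + 1) s) (constHom (n + 1) c) (constHom (n + 1) d) := rfl
  have hβ : rateBeta (constHom (n + 1) s) (constHom (n + 1) c) (constHom (n + 1) d) =
    rateAlpha (constHom (n + 1) s) (constHom (n + 1) c) (constHom (n + 1) d) := rfl
  rw [matKRight, const_eq_constHom, const_eq_constHom, const_eq_constHom, onOne_bdryGen,
    flipGen_smul, hδ, hβ, inv_mul_cancel₀ hγ, inv_rateGamma_mul_rateAlpha hγ,
    semilin_map_fixed_iff (invVar_mul_self k), map_one_add_smul,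
    flipGen_map_of_fixed (by rw [map_neg, map_mul, invVar_constHom, invVar_constHom]) (map_one _)]
  simp only [map_div₀, map_sub, map_mul, map_pow, map_one, invVar_var_self, invVar_constHom]
  rw [right_coeff_inv (var_ne_zero k)]
  rfl

theorem siteR_sub (i : Fin (n + 1)) : siteR n (n - i) = i := by
  ext
  simp only [siteR]
  omega

/-- The solutions are the vectors of the sector that all the operators fix. -/
theorem isExchangeSolution_iff {m : ℕ} {s a b c d : ℂ} (hs : s ≠ 0) (hs1 : s ^ 2 ≠ 1) (ha : a ≠ 1)
    (hb : b ≠ 1) (hc : c ≠ 1) (hd : d ≠ 1) (Φ : (Fin (n + 1) → SignType) → RatFun (n + 1)) :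
    IsExchangeSolution (n + 1) m s a b c d Φ ↔ Φ ∈ sector (n + 1) m ∧
      leftAct n a b Φ = Φ ∧ rightAct n c d Φ = Φ ∧ ∀ l < n, bulkAct n (s ^ 2) l Φ = Φ := by
  refine and_congr_right fun _ => ?_
  constructor
  · rintro ⟨h1, h2, h3⟩
    refine ⟨?_, ?_, fun l hl => ?_⟩
    · exact (matKLeft_fixed_iff hs hs1 ha hb _ _).1 (h2 _ (by simp [siteR]))
    · exact (matKRight_fixed_iff hs hs1 hc hd _ _).1 (h3 _ (by simp [siteR]))
    · exact (matR_fixed_iff hs (siteR_ne (by omega) (by omega) (by omega)) _).1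
        (h1 _ _ (by simp only [siteR]; omega))
  · rintro ⟨h1, h2, h3⟩
    refine ⟨fun i j hij => ?_, fun k hk => ?_, fun k hk => ?_⟩
    · refine (matR_fixed_iff hs (fun h => by omega) _).2 ?_
      have h := h3 (n - j) (by omega)
      have hi : siteR n (n - j + 1) = i := by ext; simp only [siteR]; omega
      rw [bulkAct, hi, siteR_sub] at h
      exact h
    · obtain rfl : k = siteR n n := by ext; simp [siteR, hk]
      exact (matKLeft_fixed_iff hs hs1 ha hb _ _).2 h1
    · obtain rfl : k = siteR n 0 := by ext; simp only [siteR]; omega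
      exact (matKRight_fixed_iff hs hs1 hc hd _ _).2 h2

end Comparison

/-! ### Conservation laws -/

section Conservation

variable {R : Type*} [CommRing R] {N : ℕ}

/-- The number of second class particles of a word. -/
def numZeros (w : Fin N → SignType) : ℕ := (Finset.univ.filter fun k => w k = 0).card

theorem numZeros_comp (w : Fin N → SignType) (π : Equiv.Perm (Fin N)) :
    numZeros (w ∘ π) = numZeros w := by
  unfold numZeros
  rw [← Finset.card_map π.toEmbedding]
  congr 1
  ext k
  simp only [Finset.mem_map, Finset.mem_filter, Finset.mem_univ, true_and, Function.comp,
    Equiv.coe_toEmbedding]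
  exact ⟨fun ⟨l, hl, h⟩ => h ▸ hl, fun h => ⟨π.symm k, by simpa using h, by simp⟩⟩

theorem numZeros_update_neg (w : Fin N → SignType) (k : Fin N) :
    numZeros (Function.update w k (-w k)) = numZeros w := by
  unfold numZeros
  congr 1
  ext l
  by_cases h : l = k
  · subst h
    simp only [Finset.mem_filter, Finset.mem_univ, true_and, Function.update_self]
    generalize w l = x
    cases x <;> decide
  · simp [h]

/-- The matrix has no entries between words with different numbers of second class particles. -/
def PreservesZeros (M : Matrix (Fin N → SignType) (Fin N → SignType) R) : Prop :=
  ∀ w w', numZeros w ≠ numZeros w' → M w w' = 0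

theorem PreservesZeros.mul {M M' : Matrix (Fin N → SignType) (Fin N → SignType) R}
    (h : PreservesZeros M) (h' : PreservesZeros M') : PreservesZeros (M * M') := by
  intro w w' hw
  rw [Matrix.mul_apply]
  refine Finset.sum_eq_zero fun v _ => ?_
  by_cases hv : numZeros w = numZeros v
  · rw [h' v w' (hv ▸ hw), mul_zero]
  · rw [h w v hv, zero_mul]

theorem preservesZeros_one :
    PreservesZeros (1 : Matrix (Fin N → SignType) (Fin N → SignType) R) :=
  fun _ _ h => Matrix.one_apply_ne fun e => h (e ▸ rfl)

theorem PreservesZeros.add {M M' : Matrix (Fin N → SignType) (Fin N → SignType) R}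
    (h : PreservesZeros M) (h' : PreservesZeros M') : PreservesZeros (M + M') :=
  fun w w' hw => by rw [Matrix.add_apply, h w w' hw, h' w w' hw, add_zero]

theorem PreservesZeros.smul {M : Matrix (Fin N → SignType) (Fin N → SignType) R}
    (h : PreservesZeros M) (r : R) : PreservesZeros (r • M) :=
  fun w w' hw => by rw [Matrix.smul_apply, h w w' hw, smul_zero]

theorem preservesZeros_hopGen (t : R) (i j : Fin N) : PreservesZeros (hopGen t i j) := by
  intro w w' h
  rw [hopGen, if_neg, if_neg, sub_zero]
  · rintro rfl; exact h rfl
  · rintro rfl; exact h (numZeros_comp _ _).symm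

theorem preservesZeros_flipGen (ρ σ : R) (k : Fin N) : PreservesZeros (flipGen ρ σ k) := by
  intro w w' h
  rw [flipGen, if_neg, if_neg, sub_zero]
  · rintro rfl; exact h rfl
  · rintro rfl; exact h (numZeros_update_neg _ _).symm

/-- Conservation of probability: the rate out of a word in the diagonal term cancels the rate into
the exchanged word. -/
theorem one_vecMul_hopGen (t : R) (i j : Fin N) : 1 ᵥ* hopGen t i j = 0 := by
  funext w'
  simp only [vecMul, dotProduct, Pi.one_apply, one_mul, Pi.zero_apply, hopGen,
    Finset.sum_sub_distrib]
  have h (w : Fin N → SignType) : w' = w ∘ Equiv.swap i j ↔ w = w' ∘ Equiv.swap i j := by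
    constructor <;> rintro rfl <;> funext l <;> simp
  simp only [h, Finset.sum_ite_eq, Finset.sum_ite_eq', Finset.mem_univ, if_true, Function.comp,
    Equiv.swap_apply_left, Equiv.swap_apply_right, sub_self]

theorem one_vecMul_flipGen (ρ σ : R) (k : Fin N) : 1 ᵥ* flipGen ρ σ k = 0 := by
  funext w'
  simp only [vecMul, dotProduct, Pi.one_apply, one_mul, Pi.zero_apply, flipGen,
    Finset.sum_sub_distrib]
  have h (w : Fin N → SignType) :
      w' = Function.update w k (-w k) ↔ w = Function.update w' k (-w' k) := by
    constructor <;> rintro rfl <;> simp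
  simp only [h, Finset.sum_ite_eq, Finset.sum_ite_eq', Finset.mem_univ, if_true,
    Function.update_self, sub_self]

/-! ### Conservation laws for products of factors -/

variable {K : Type*} [Field K] {n : ℕ}

theorem forall_mem_chainFactors {t c d y : R} {z : Fin (n + 1) → R}
    {p : GenFactor R (n + 1) → Prop}
    (h0 : p ⟨(c - y) * (d - y), y ^ 2 - 1, flipGen (-(c * d)) 1 (siteR n 0)⟩)
    (h1 : ∀ l < n,
      p ⟨t * z (siteR n l) - y, z (siteR n l) - y, hopGen t (siteR n (l + 1)) (siteR n l)⟩)
    (h2 : ∀ l < n,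
      p ⟨t - y * z (siteR n l), 1 - y * z (siteR n l), hopGen t (siteR n (l + 1)) (siteR n l)⟩) :
    ∀ l ≤ n, ∀ f ∈ chainFactors t c d y z l, p f
  | 0, _, f, hf => by
    rw [chainFactors, List.mem_singleton] at hf
    exact hf ▸ h0
  | l + 1, hl, f, hf => by
    simp only [chainFactors, List.mem_cons, List.mem_append, List.not_mem_nil, or_false] at hf
    rcases hf with rfl | hf | rfl
    · exact h1 l (by omega)
    · exact forall_mem_chainFactors h0 h1 h2 l (by omega) f hf
    · exact h2 l (by omega)

theorem forall_mem_scatFactors {t a b c d y : R} {z : Fin (n + 1) → R}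
    {p : GenFactor R (n + 1) → Prop}
    (hL : p ⟨(y - a) * (y - b), y ^ 2 - 1, flipGen 1 (-(a * b)) (siteR n n)⟩)
    (h0 : p ⟨(c - y) * (d - y), y ^ 2 - 1, flipGen (-(c * d)) 1 (siteR n 0)⟩)
    (h1 : ∀ l < n,
      p ⟨t * z (siteR n l) - y, z (siteR n l) - y, hopGen t (siteR n (l + 1)) (siteR n l)⟩)
    (h2 : ∀ l < n,
      p ⟨t - y * z (siteR n l), 1 - y * z (siteR n l), hopGen t (siteR n (l + 1)) (siteR n l)⟩) :
    ∀ f ∈ scatFactors t a b c d y z, p f := by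
  intro f hf
  rw [scatFactors, List.mem_cons] at hf
  rcases hf with rfl | hf
  · exact hL
  · exact forall_mem_chainFactors h0 h1 h2 n le_rfl f hf

theorem one_vecMul_normProd (l : List (GenFactor K N)) (h : ∀ f ∈ l, 1 ᵥ* f.gen = 0) :
    1 ᵥ* normProd l = 1 := by
  induction l with
  | nil => exact vecMul_one _
  | cons f l ih =>
    rw [normProd_cons, ← vecMul_vecMul, vecMul_add, vecMul_one, vecMul_smul, h f (by simp),
      smul_zero, add_zero, ih fun g hg => h g (by simp [hg])]

theorem preservesZeros_normProd (l : List (GenFactor K N)) (h : ∀ f ∈ l, PreservesZeros f.gen) :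
    PreservesZeros (normProd l) := by
  induction l with
  | nil => exact preservesZeros_one
  | cons f l ih =>
    rw [normProd_cons]
    exact (preservesZeros_one.add ((h f (by simp)).smul _)).mul
      (ih fun g hg => h g (by simp [hg]))

theorem one_vecMul_scatFactors (t a b c d y : R) (z : Fin (n + 1) → R) :
    ∀ f ∈ scatFactors t a b c d y z, 1 ᵥ* f.gen = 0 :=
  forall_mem_scatFactors (one_vecMul_flipGen _ _ _) (one_vecMul_flipGen _ _ _)
    (fun _ _ => one_vecMul_hopGen _ _ _) (fun _ _ => one_vecMul_hopGen _ _ _)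

theorem preservesZeros_scatFactors (t a b c d y : R) (z : Fin (n + 1) → R) :
    ∀ f ∈ scatFactors t a b c d y z, PreservesZeros f.gen :=
  forall_mem_scatFactors (preservesZeros_flipGen _ _ _) (preservesZeros_flipGen _ _ _)
    (fun _ _ => preservesZeros_hopGen _ _ _) (fun _ _ => preservesZeros_hopGen _ _ _)

end Conservation

/-! ### The fixed vector in a sector -/

section Sector

variable {N m : ℕ}

/-- The words with `m` second class particles. -/
abbrev SectorWord (N m : ℕ) : Type := {w : Fin N → SignType // numZeros w = m}

/-- The block of a matrix on the words with `m` second class particles. -/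
def sectorBlock {R : Type*} (m : ℕ) (M : Matrix (Fin N → SignType) (Fin N → SignType) R) :
    Matrix (SectorWord N m) (SectorWord N m) R :=
  M.submatrix Subtype.val Subtype.val

/-- The matrix whose row `i₀` consists of ones, all other entries being zero. -/
def onesRow {ι : Type*} [DecidableEq ι] (R : Type*) [CommRing R] (i₀ : ι) : Matrix ι ι R :=
  fun i _ => if i = i₀ then 1 else 0

theorem sum_sectorWord {R : Type*} [CommRing R] (f : (Fin N → SignType) → R)
    (h : ∀ w, numZeros w ≠ m → f w = 0) : ∑ w : SectorWord N m, f w = ∑ w, f w := by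
  rw [← Finset.sum_subtype (Finset.univ.filter fun w => numZeros w = m) (by simp) f]
  exact Finset.sum_filter_of_ne fun w _ hw => by_contra fun h' => hw (h w h')

theorem onesRow_mulVec {ι R : Type*} [Fintype ι] [DecidableEq ι] [CommRing R] (i₀ : ι)
    (v : ι → R) : onesRow R i₀ *ᵥ v = (∑ i, v i) • Pi.single i₀ 1 := by
  funext i
  simp only [onesRow, mulVec, dotProduct, Pi.smul_apply, Pi.single_apply, smul_eq_mul]
  split_ifs <;> simp

variable {K : Type*} [Field K] {M : Matrix (Fin N → SignType) (Fin N → SignType) K}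

theorem sectorBlock_mulVec {v : (Fin N → SignType) → K} (hv : ∀ w, numZeros w ≠ m → v w = 0)
    (w : SectorWord N m) : (sectorBlock m M *ᵥ fun w : SectorWord N m => v w) w = (M *ᵥ v) w :=
  sum_sectorWord (fun w' => M w w' * v w') fun w' h => by rw [hv w' h, mul_zero]

/-- On vectors of sum zero the row of ones acts as zero, so such a fixed vector lies in the kernel
of the invertible matrix. -/
theorem eq_zero_of_fixed {w₀ : SectorWord N m}
    (hdet : (sectorBlock m M - 1 + onesRow K w₀).det ≠ 0) {v : (Fin N → SignType) → K}
    (hv : ∀ w, numZeros w ≠ m → v w = 0) (hsum : ∑ w, v w = 0) (hfix : M *ᵥ v = v) : v = 0 := by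
  have h : (sectorBlock m M - 1 + onesRow K w₀) *ᵥ (fun w : SectorWord N m => v w) = 0 := by
    rw [add_mulVec, sub_mulVec, one_mulVec, onesRow_mulVec, sum_sectorWord v hv, hsum, zero_smul,
      add_zero]
    funext w
    rw [Pi.sub_apply, sectorBlock_mulVec hv, hfix, sub_self, Pi.zero_apply]
  have h0 := Matrix.eq_zero_of_mulVec_eq_zero hdet h
  funext w
  by_cases hw : numZeros w = m
  · exact congrFun h0 ⟨w, hw⟩
  · exact hv w hw

/-- Solve `A a = e` for the basis vector `e` at `w₀`. The columns of `A` sum to 1, so pairing with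
the constant row shows that `a` has sum 1. The row of ones then already accounts for `e`, and what
is left says that `a` is fixed. -/
theorem exists_fixed {w₀ : SectorWord N m} (hP : PreservesZeros M) (h1 : 1 ᵥ* M = 1)
    (hdet : (sectorBlock m M - 1 + onesRow K w₀).det ≠ 0) :
    ∃ v : (Fin N → SignType) → K,
      (∀ w, numZeros w ≠ m → v w = 0) ∧ ∑ w, v w = 1 ∧ M *ᵥ v = v := by
  set A := sectorBlock m M - 1 + onesRow K w₀ with hA
  set a : SectorWord N m → K := A⁻¹ *ᵥ Pi.single w₀ 1 with ha
  have hAa : A *ᵥ a = Pi.single w₀ 1 := by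
    rw [ha, mulVec_mulVec, Matrix.mul_nonsing_inv _ (isUnit_iff_ne_zero.2 hdet), one_mulVec]
  have hcol (w' : SectorWord N m) : ∑ w : SectorWord N m, M w w' = 1 := by
    rw [sum_sectorWord (fun w => M w w') fun w hw => hP w w' fun e => hw (e.trans w'.2)]
    have := congrFun h1 w'
    simpa [vecMul, dotProduct] using this
  have h1A : (1 : SectorWord N m → K) ᵥ* A = 1 := by
    rw [hA, vecMul_add, vecMul_sub, vecMul_one]
    have e1 : (1 : SectorWord N m → K) ᵥ* sectorBlock m M = 1 := by
      funext w'
      simpa [vecMul, dotProduct, sectorBlock] using hcol w'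
    have e2 : (1 : SectorWord N m → K) ᵥ* onesRow K w₀ = 1 := by
      funext w'
      simp [vecMul, dotProduct, onesRow]
    rw [e1, e2, sub_self, zero_add]
  have hsum : ∑ w, a w = 1 := by
    have h := congrArg (fun x => (1 : SectorWord N m → K) ⬝ᵥ x) hAa
    simp only [dotProduct_mulVec, h1A] at h
    simpa [dotProduct] using h
  have hfix : sectorBlock m M *ᵥ a = a := by
    have h := hAa
    rw [hA, add_mulVec, sub_mulVec, one_mulVec, onesRow_mulVec, hsum, one_smul] at h
    exact sub_eq_zero.1 (add_eq_right.1 h)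
  set v : (Fin N → SignType) → K := fun w => if h : numZeros w = m then a ⟨w, h⟩ else 0 with hv
  have hv0 : ∀ w, numZeros w ≠ m → v w = 0 := fun w hw => dif_neg hw
  have hva : (fun w : SectorWord N m => v w) = a := funext fun w => dif_pos w.2
  refine ⟨v, hv0, ?_, ?_⟩
  · rw [← sum_sectorWord v hv0, ← hsum]
    exact Finset.sum_congr rfl fun w _ => congrFun hva w
  · funext w
    by_cases hw : numZeros w = m
    · have h := sectorBlock_mulVec (M := M) hv0 ⟨w, hw⟩
      rw [hva, hfix, ← hva] at h
      exact h.symm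
    · rw [hv0 w hw]
      refine Finset.sum_eq_zero fun w' _ => ?_
      change M w w' * v w' = 0
      by_cases hw' : numZeros w' = m
      · rw [hP w w' (hw' ▸ hw), zero_mul]
      · rw [hv0 w' hw', mul_zero]

end Sector

/-! ### Nonvanishing of the determinant at real parameters -/

section

open Filter Topology

/-! ### Connectedness of a sector -/

section Connectedness

variable {n : ℕ}

/-- A set of words that is stable under exchanges of neighbours and flips of the first letter
contains with a word all words with the same number of second class particles. -/
theorem word_induction {Q : (Fin (n + 1) → SignType) → Prop}
    (hswap : ∀ l < n, ∀ w, Q w → Q (w ∘ Equiv.swap (siteR n (l + 1)) (siteR n l)))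
    (hflip : ∀ w, Q w → Q (Function.update w (siteR n n) (-w (siteR n n))))
    {w w' : Fin (n + 1) → SignType} (h : numZeros w = numZeros w') (hw : Q w) : Q w' := by
  have hperm (π : Equiv.Perm (Fin (n + 1))) : ∀ w, Q w → Q (w ∘ π) := by
    have hπ : π ∈ Submonoid.closure
        (Set.range fun i : Fin n => Equiv.swap i.castSucc i.succ) := by
      rw [Equiv.Perm.mclosure_swap_castSucc_succ]
      trivial
    induction hπ using Submonoid.closure_induction with
    | mem π hπ =>
      obtain ⟨i, rfl⟩ := hπ
      intro w hw
      have h1 : siteR n (n - 1 - i + 1) = i.castSucc := by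
        ext; simp only [siteR, Fin.val_castSucc]; omega
      have h2 : siteR n (n - 1 - i) = i.succ := by
        ext; simp only [siteR, Fin.val_succ]; omega
      have := hswap (n - 1 - i) (by omega) w hw
      rwa [h1, h2] at this
    | one => exact fun w hw => hw
    | mul π ρ _ _ ih1 ih2 => exact fun w hw => ih2 _ (ih1 w hw)
  -- A flip at any site is the flip at the first site conjugated by a transposition.
  have hflip' (k : Fin (n + 1)) (w) (hw : Q w) : Q (Function.update w k (-w k)) := by
    have h := hperm (Equiv.swap (siteR n n) k) _
      (hflip _ (hperm (Equiv.swap (siteR n n) k) w hw))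
    convert h using 1
    funext l
    simp only [Function.comp, Function.update_apply, Equiv.swap_apply_left,
      Equiv.swap_apply_self, Equiv.swap_apply_eq_iff]
  have hset (S : Finset (Fin (n + 1))) : ∀ w, Q w → Q fun k => if k ∈ S then -w k else w k := by
    induction S using Finset.induction_on with
    | empty => exact fun w hw => by simpa using hw
    | insert a S ha ih =>
      intro w hw
      convert hflip' a _ (ih w hw) using 1
      funext k
      by_cases hk : k = a
      · subst hk; simp [ha]
      · simp [hk]
  have hcard : Fintype.card {k // w' k = 0} = Fintype.card {k // w k = 0} := by
    rw [Fintype.card_subtype, Fintype.card_subtype]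
    exact h.symm
  -- A bijection between the zero positions of the two words, extended to all sites. After this
  -- permutation the words can differ only by signs of nonzero letters, which flips correct.
  set π : Equiv.Perm (Fin (n + 1)) := (Fintype.equivOfCardEq hcard).extendSubtype with hπ
  have hπ0 (k) : w' k = 0 ↔ w (π k) = 0 :=
    ⟨fun hk => Equiv.extendSubtype_mem (Fintype.equivOfCardEq hcard) k hk, fun hk =>
      by_contra fun h' => Equiv.extendSubtype_not_mem (Fintype.equivOfCardEq hcard) k h' hk⟩
  convert hset (Finset.univ.filter fun k => w' k ≠ w (π k)) _ (hperm π w hw) using 1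
  funext k
  have hk := hπ0 k
  simp only [Finset.mem_filter, Finset.mem_univ, true_and, Function.comp]
  revert hk
  generalize w' k = x
  generalize w (π k) = y
  revert x y
  decide

end Connectedness

/-! ### Irreducible stochastic matrices -/

section Stochastic

/-- A left null vector `u` satisfies `∑ i, u i * P i j = u j - u i₀` for all `j`. Comparing with the
average at a maximum and at a minimum of `u` forces `u i₀ = 0`. Then `u` is harmonic, the set where
it is maximal is closed under positive transitions, and irreducibility makes `u` constant, hence
zero. -/
theorem det_ne_zero_of_irreducible {ι : Type*} [Fintype ι] [DecidableEq ι] {P : Matrix ι ι ℝ}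
    (hP : ∀ i j, 0 ≤ P i j) (hcol : ∀ j, ∑ i, P i j = 1)
    (hirr : ∀ Q : ι → Prop, (∀ i j, 0 < P i j → Q j → Q i) → ∀ i j, Q j → Q i) (i₀ : ι) :
    (P - 1 + onesRow ℝ i₀).det ≠ 0 := by
  intro hdet
  obtain ⟨u, hu0, hu⟩ := Matrix.exists_vecMul_eq_zero_iff.2 hdet
  have heq (j : ι) : ∑ i, u i * P i j - u j + u i₀ = 0 := by
    have h := congrFun hu j
    rw [vecMul_add, vecMul_sub, vecMul_one] at h
    simpa [vecMul, dotProduct, onesRow] using h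
  have hdiff (j : ι) (x : ℝ) : ∑ i, (x - u i) * P i j = x - u j + u i₀ := by
    have := heq j
    simp only [sub_mul, Finset.sum_sub_distrib, ← Finset.mul_sum, hcol]
    linarith
  have : Nonempty ι := ⟨i₀⟩
  obtain ⟨jmax, hmax⟩ := Finite.exists_max u
  obtain ⟨jmin, hmin⟩ := Finite.exists_min u
  have h1 : 0 ≤ u i₀ := by
    have h := hdiff jmax (u jmax)
    have h' : 0 ≤ ∑ i, (u jmax - u i) * P i jmax :=
      Finset.sum_nonneg fun i _ => mul_nonneg (sub_nonneg.2 (hmax i)) (hP _ _)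
    linarith
  have h2 : u i₀ ≤ 0 := by
    have h := hdiff jmin (u jmin)
    have h' : ∑ i, (u jmin - u i) * P i jmin ≤ 0 :=
      Finset.sum_nonpos fun i _ => mul_nonpos_of_nonpos_of_nonneg (sub_nonpos.2 (hmin i)) (hP _ _)
    linarith
  have h0 : u i₀ = 0 := le_antisymm h2 h1
  have hall := hirr (fun j => u j = u jmax) fun i j hij hj => by
    have h := hdiff j (u jmax)
    rw [h0, hj, sub_self, zero_add] at h
    have h' := (Finset.sum_eq_zero_iff_of_nonneg fun i _ =>
      mul_nonneg (sub_nonneg.2 (hmax i)) (hP i j)).1 h i (Finset.mem_univ i)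
    rcases mul_eq_zero.1 h' with h' | h'
    · linarith
    · exact absurd h' hij.ne'
  apply hu0
  funext i
  rw [hall i jmax rfl, ← hall i₀ jmax rfl, h0, Pi.zero_apply]

/-! ### Positivity of products of factors -/

variable {N : ℕ}

/-- A matrix with nonnegative entries and positive diagonal. -/
def DiagPositive (M : Matrix (Fin N → SignType) (Fin N → SignType) ℝ) : Prop :=
  (∀ w w', 0 ≤ M w w') ∧ ∀ w, 0 < M w w

theorem DiagPositive.le_mul {M M' : Matrix (Fin N → SignType) (Fin N → SignType) ℝ}
    (h : DiagPositive M) (h' : DiagPositive M') (w v w' : Fin N → SignType) :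
    M w v * M' v w' ≤ (M * M') w w' :=
  Finset.single_le_sum (f := fun v => M w v * M' v w')
    (fun v _ => mul_nonneg (h.1 w v) (h'.1 v w')) (Finset.mem_univ v)

theorem DiagPositive.mul {M M' : Matrix (Fin N → SignType) (Fin N → SignType) ℝ}
    (h : DiagPositive M) (h' : DiagPositive M') : DiagPositive (M * M') :=
  ⟨fun w w' => Finset.sum_nonneg fun v _ => mul_nonneg (h.1 w v) (h'.1 v w'),
    fun w => (mul_pos (h.2 w) (h'.2 w)).trans_le (h.le_mul h' w w w)⟩

theorem diagPositive_one : DiagPositive (1 : Matrix (Fin N → SignType) (Fin N → SignType) ℝ) :=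
  ⟨fun w w' => by rw [Matrix.one_apply]; split_ifs <;> norm_num, fun w => by simp⟩

theorem diagPositive_normProd (l : List (GenFactor ℝ N))
    (h : ∀ f ∈ l, DiagPositive (1 + (f.num / f.den) • f.gen)) : DiagPositive (normProd l) := by
  induction l with
  | nil => exact diagPositive_one
  | cons f l ih =>
    exact (h f (by simp)).mul (ih fun g hg => h g (by simp [hg]))

/-- Use the given transition in the factor `f` and stay put in all the others; the positive
diagonals give this path positive weight, and no other path contributes negatively. -/
theorem normProd_pos (l : List (GenFactor ℝ N))
    (h : ∀ f ∈ l, DiagPositive (1 + (f.num / f.den) • f.gen)) {f : GenFactor ℝ N} (hf : f ∈ l)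
    {w w' : Fin N → SignType} (hw : 0 < (1 + (f.num / f.den) • f.gen) w w') :
    0 < normProd l w w' := by
  induction l with
  | nil => simp at hf
  | cons g l ih =>
    have hg := h g (by simp)
    have hl := diagPositive_normProd l fun g hg => h g (by simp [hg])
    rw [normProd_cons]
    rcases List.mem_cons.1 hf with rfl | hf
    · exact (mul_pos hw (hl.2 w')).trans_le (hg.le_mul hl w w' w')
    · exact (mul_pos (hg.2 w) (ih (fun g hg => h g (by simp [hg])) hf)).trans_le
        (hg.le_mul hl w w w')

theorem hopRate_nonneg {t : ℝ} (ht : 0 < t) (x y : SignType) : 0 ≤ hopRate t x y := by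
  unfold hopRate
  split_ifs <;> linarith

theorem flipRate_nonneg {ρ σ : ℝ} (hρ : 0 < ρ) (hσ : 0 < σ) (x : SignType) :
    0 ≤ flipRate ρ σ x := by
  unfold flipRate
  split_ifs <;> linarith

/-- Off the diagonal the entries are nonnegative multiples of rates. On the diagonal one subtracts
from 1 at most the larger of `r` and `r * t`. -/
theorem diagPositive_hopGen {t r : ℝ} (ht : 0 < t) (hr : 0 < r) (h1 : r < 1) (hrt : r * t < 1)
    (i j : Fin N) : DiagPositive (1 + r • hopGen t i j) := by
  have hlt (x y : SignType) : r * hopRate t x y < 1 := by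
    unfold hopRate
    split_ifs <;> linarith
  have key (w w') : 0 ≤ (if w' = w ∘ Equiv.swap i j then hopRate t (w i) (w j) else 0) := by
    split_ifs
    · exact hopRate_nonneg ht _ _
    · exact le_rfl
  have hdiag (w) : 0 < (1 + r • hopGen t i j) w w := by
    have h1 := mul_nonneg hr.le (key w w)
    have h2 := hlt (w j) (w i)
    rw [Matrix.add_apply, Matrix.one_apply_eq, Matrix.smul_apply, hopGen, smul_eq_mul, mul_sub,
      if_pos (rfl : w = w)]
    linarith
  refine ⟨fun w w' => ?_, hdiag⟩
  by_cases h : w = w'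
  · subst h
    exact (hdiag w).le
  · rw [Matrix.add_apply, Matrix.one_apply_ne h, Matrix.smul_apply, hopGen, if_neg (Ne.symm h),
      sub_zero, zero_add]
    exact mul_nonneg hr.le (key w w')

theorem hopGen_swap_pos {t r : ℝ} (ht : 0 < t) (hr : 0 < r) (h1 : r < 1) (hrt : r * t < 1)
    (i j : Fin N) (w : Fin N → SignType) :
    0 < (1 + r • hopGen t i j) (w ∘ Equiv.swap i j) w := by
  have hD := diagPositive_hopGen ht hr h1 hrt i j
  by_cases h : w ∘ Equiv.swap i j = w
  · rw [h]
    exact hD.2 w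
  · have h' : w = (w ∘ Equiv.swap i j) ∘ Equiv.swap i j := by funext l; simp
    have hne : w i ≠ w j := by
      intro e
      apply h
      funext l
      simp only [Function.comp, Equiv.swap_apply_def]
      split_ifs with h1 h2
      · rw [h1, e]
      · rw [h2, e]
      · rfl
    rw [Matrix.add_apply, Matrix.one_apply_ne h, Matrix.smul_apply, hopGen, if_neg (Ne.symm h),
      sub_zero, zero_add, if_pos h']
    refine mul_pos hr ?_
    simp only [Function.comp, Equiv.swap_apply_left, Equiv.swap_apply_right, hopRate]
    rcases lt_or_gt_of_ne hne with h | h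
    · rw [if_neg h.not_gt, if_pos h]
      exact one_pos
    · rw [if_pos h]
      exact ht

theorem diagPositive_flipGen {ρ σ r : ℝ} (hρ : 0 < ρ) (hσ : 0 < σ) (hr : 0 < r) (h1 : r * ρ < 1)
    (h2 : r * σ < 1) (k : Fin N) : DiagPositive (1 + r • flipGen ρ σ k) := by
  have hlt (x : SignType) : r * flipRate ρ σ x < 1 := by
    unfold flipRate
    split_ifs <;> linarith
  have key (w w' : Fin N → SignType) :
      0 ≤ (if w' = Function.update w k (-w k) then flipRate ρ σ (w k) else 0) := by
    split_ifs
    · exact flipRate_nonneg hρ hσ _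
    · exact le_rfl
  have hdiag (w) : 0 < (1 + r • flipGen ρ σ k) w w := by
    have h1 := mul_nonneg hr.le (key w w)
    have h2 := hlt (-w k)
    rw [Matrix.add_apply, Matrix.one_apply_eq, Matrix.smul_apply, flipGen, smul_eq_mul, mul_sub,
      if_pos (rfl : w = w)]
    linarith
  refine ⟨fun w w' => ?_, hdiag⟩
  by_cases h : w = w'
  · subst h
    exact (hdiag w).le
  · rw [Matrix.add_apply, Matrix.one_apply_ne h, Matrix.smul_apply, flipGen, if_neg (Ne.symm h),
      sub_zero, zero_add]
    exact mul_nonneg hr.le (key w w')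

theorem flipGen_update_pos {ρ σ r : ℝ} (hρ : 0 < ρ) (hσ : 0 < σ) (hr : 0 < r) (h1 : r * ρ < 1)
    (h2 : r * σ < 1) (k : Fin N) (w : Fin N → SignType) :
    0 < (1 + r • flipGen ρ σ k) (Function.update w k (-w k)) w := by
  have hD := diagPositive_flipGen hρ hσ hr h1 h2 k
  by_cases h : Function.update w k (-w k) = w
  · rw [h]
    exact hD.2 w
  · have hne : w k ≠ 0 := by
      intro e
      apply h
      rw [e, neg_zero, ← e, Function.update_eq_self]
    rw [Matrix.add_apply, Matrix.one_apply_ne h, Matrix.smul_apply, flipGen, if_neg (Ne.symm h),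
      sub_zero, zero_add, if_pos (by simp)]
    refine mul_pos hr ?_
    rw [Function.update_self]
    revert hne
    generalize w k = x
    cases x <;> simp [flipRate, hρ, hσ]

/-! ### Irreducibility of the specialised scattering matrix -/

variable {n m : ℕ}

theorem exists_mem_chainFactors {R : Type*} [CommRing R] {t c d y : R} {z : Fin (n + 1) → R} :
    ∀ {l k : ℕ}, k < l → ⟨t * z (siteR n k) - y, z (siteR n k) - y,
      hopGen t (siteR n (k + 1)) (siteR n k)⟩ ∈ chainFactors t c d y z l
  | l + 1, k, h => by
    rw [chainFactors]
    rcases Nat.lt_succ_iff_lt_or_eq.1 h with h | rfl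
    · exact List.mem_cons_of_mem _ (List.mem_append_left _ (exists_mem_chainFactors h))
    · exact List.mem_cons_self

/-- At real parameters for which the rates are positive, the scattering matrix is an irreducible
stochastic matrix on each sector. -/
theorem det_scattering_ne_zero {t a b c d y : ℝ} (ht : 0 < t) (hab : 0 < -(a * b))
    (hcd : 0 < -(c * d)) {r u v : ℝ} (hr : r = (1 - y) / (t - y))
    (hu : u = (y ^ 2 - 1) / ((y - a) * (y - b))) (hv : v = (y ^ 2 - 1) / ((c - y) * (d - y)))
    (hr0 : 0 < r) (hr1 : r < 1) (hrt : r * t < 1) (hu0 : 0 < u) (hu1 : u < 1)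
    (huab : u * -(a * b) < 1) (hv0 : 0 < v) (hv1 : v < 1) (hvcd : v * -(c * d) < 1)
    (w₀ : SectorWord (n + 1) m) :
    (sectorBlock m (normProd (scatFactors t a b c d y fun _ : Fin (n + 1) => 1)) - 1 +
      onesRow ℝ w₀).det ≠ 0 := by
  have hD : ∀ f ∈ scatFactors t a b c d y fun _ : Fin (n + 1) => 1,
      DiagPositive (1 + (f.num / f.den) • f.gen) := by
    refine forall_mem_scatFactors ?_ ?_ ?_ ?_
    · rw [← hu]
      exact diagPositive_flipGen one_pos hab hu0 (by linarith) huab _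
    · rw [← hv]
      exact diagPositive_flipGen hcd one_pos hv0 hvcd (by linarith) _
    -- With all variables equal to 1, both exchange factors of each pair of sites, on the way out
    -- and on the way back, have the same coefficient `r`.
    · intro l _
      simp only [mul_one]
      rw [← hr]
      exact diagPositive_hopGen ht hr0 hr1 hrt _ _
    · intro l _
      simp only [mul_one]
      rw [← hr]
      exact diagPositive_hopGen ht hr0 hr1 hrt _ _
  have hpos := fun f hf w w' => normProd_pos (w := w) (w' := w') _ hD (f := f) hf
  have hnn := (diagPositive_normProd _ hD).1
  have h1 := one_vecMul_normProd _
    (one_vecMul_scatFactors t a b c d y fun _ : Fin (n + 1) => (1 : ℝ))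
  have hZ := preservesZeros_normProd _
    (preservesZeros_scatFactors t a b c d y fun _ : Fin (n + 1) => (1 : ℝ))
  have hswap : ∀ l < n, ∀ w, 0 < normProd (scatFactors t a b c d y fun _ : Fin (n + 1) => (1 : ℝ))
      (w ∘ Equiv.swap (siteR n (l + 1)) (siteR n l)) w := fun l hl w =>
    hpos _ (List.mem_cons_of_mem _ (exists_mem_chainFactors hl)) _ _ <| by
      simp only [mul_one]
      rw [← hr]
      exact hopGen_swap_pos ht hr0 hr1 hrt _ _ _
  have hflip : ∀ w, 0 < normProd (scatFactors t a b c d y fun _ : Fin (n + 1) => (1 : ℝ))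
      (Function.update w (siteR n n) (-w (siteR n n))) w := fun w =>
    hpos _ List.mem_cons_self _ _ <| by
      simp only
      rw [← hu]
      exact flipGen_update_pos one_pos hab hu0 (by linarith) huab _ _
  generalize normProd (scatFactors t a b c d y fun _ : Fin (n + 1) => (1 : ℝ)) = P at *
  refine det_ne_zero_of_irreducible (fun i j => hnn _ _) (fun w' => ?_) (fun Q hQ i j hj => ?_) w₀
  · change ∑ w : SectorWord (n + 1) m, P w w' = 1
    rw [sum_sectorWord (fun w => P w w') fun w hw => hZ w w' fun e => hw (e.trans w'.2)]
    have := congrFun h1 w'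
    simpa [vecMul, dotProduct] using this
  · have key := word_induction (Q := fun w => ∃ h : numZeros w = m, Q ⟨w, h⟩) (w := j) (w' := i)
      (fun l hl w ⟨h, hw⟩ => ⟨(numZeros_comp _ _).trans h, hQ _ _ (hswap l hl w) hw⟩)
      (fun w ⟨h, hw⟩ => ⟨(numZeros_update_neg _ _).trans h, hQ _ _ (hflip w) hw⟩)
      (j.2.trans i.2.symm) ⟨j.2, hj⟩
    exact key.2

theorem eventually_small {G : ℝ → ℝ} (hG : ContinuousAt G 0) (h0 : 0 < G 0) (C : ℝ) :
    ∀ᶠ ε in 𝓝[>] (0 : ℝ), 0 < ε * G ε ∧ ε * G ε < 1 ∧ ε * G ε * C < 1 := by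
  have h1 : ContinuousAt (fun ε => ε * G ε) 0 := continuousAt_id.mul hG
  have h2 : ContinuousAt (fun ε => ε * G ε * C) 0 := h1.mul continuousAt_const
  filter_upwards [self_mem_nhdsWithin, nhdsWithin_le_nhds (hG.eventually (lt_mem_nhds h0)),
    nhdsWithin_le_nhds (h1.eventually (gt_mem_nhds (by simp : (0 : ℝ) * G 0 < 1))),
    nhdsWithin_le_nhds (h2.eventually (gt_mem_nhds (by simp : (0 : ℝ) * G 0 * C < 1)))]
    with ε hε hp hs hc
  exact ⟨mul_pos hε hp, hs, hc⟩

/-- The spectral parameter can be chosen such that all transition probabilities are small. -/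
theorem exists_spectral_parameter {t a b c d : ℝ} (ht1 : t ≠ 1)
    (hab : 0 < (1 - t) / ((a - 1) * (b - 1))) (hcd : 0 < (1 - t) / ((c - 1) * (d - 1))) :
    ∃ y r u v : ℝ, y ≠ 0 ∧ r = (1 - y) / (t - y) ∧ u = (y ^ 2 - 1) / ((y - a) * (y - b)) ∧
      v = (y ^ 2 - 1) / ((c - y) * (d - y)) ∧ 0 < r ∧ r < 1 ∧ r * t < 1 ∧ 0 < u ∧ u < 1 ∧
      u * -(a * b) < 1 ∧ 0 < v ∧ v < 1 ∧ v * -(c * d) < 1 := by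
  have hne {x z : ℝ} (h : 0 < (1 - t) / ((x - 1) * (z - 1))) : x - 1 ≠ 0 ∧ z - 1 ≠ 0 := by
    constructor <;> intro h' <;> simp [h'] at h
  obtain ⟨ha, hb⟩ := hne hab
  obtain ⟨hc, hd⟩ := hne hcd
  -- For small positive `ε` this lies on the side of 1 away from `t`, so that `(1 - y) / (t - y)`
  -- equals `ε / (1 + ε)`. Moreover `y ^ 2 - 1` is `ε * (1 - t) * (y + 1)`, so the signs of `u` and
  -- `v` near `y = 1` are those in `hab` and `hcd`.
  set Y : ℝ → ℝ := fun ε => 1 - ε * (t - 1) with hY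
  have hYc : ContinuousAt Y 0 := by fun_prop
  have hY0 : Y 0 = 1 := by simp [hY]
  have hr := eventually_small (G := fun ε => (1 + ε)⁻¹)
    (ContinuousAt.inv₀ (by fun_prop) (by norm_num)) (by norm_num) t
  have hu := eventually_small (G := fun ε => (1 - t) * (Y ε + 1) / ((Y ε - a) * (Y ε - b)))
    (ContinuousAt.div (by fun_prop) (by fun_prop) (by
      rw [hY0, ← neg_sub a, ← neg_sub b, neg_mul_neg]
      exact mul_ne_zero ha hb)) (by
      have e : (1 - t) * (Y 0 + 1) / ((Y 0 - a) * (Y 0 - b)) =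
          2 * ((1 - t) / ((a - 1) * (b - 1))) := by
        rw [hY0, ← neg_sub a, ← neg_sub b, neg_mul_neg]
        ring
      rw [e]
      exact mul_pos two_pos hab) (-(a * b))
  have hv := eventually_small (G := fun ε => (1 - t) * (Y ε + 1) / ((c - Y ε) * (d - Y ε)))
    (ContinuousAt.div (by fun_prop) (by fun_prop) (by
      rw [hY0]
      exact mul_ne_zero hc hd)) (by
      have e : (1 - t) * (Y 0 + 1) / ((c - Y 0) * (d - Y 0)) =
          2 * ((1 - t) / ((c - 1) * (d - 1))) := by
        rw [hY0]
        ring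
      rw [e]
      exact mul_pos two_pos hcd) (-(c * d))
  have hy : ∀ᶠ ε in 𝓝[>] (0 : ℝ), Y ε ≠ 0 :=
    nhdsWithin_le_nhds (hYc.eventually_ne (by rw [hY0]; exact one_ne_zero))
  obtain ⟨ε, ⟨hr0, hr1, hrt⟩, ⟨hu0, hu1, huab⟩, ⟨hv0, hv1, hvcd⟩, hy, hε⟩ :=
    (hr.and (hu.and (hv.and (hy.and self_mem_nhdsWithin)))).exists
  have hε : 0 < ε := hε
  have e : Y ε ^ 2 - 1 = ε * ((1 - t) * (Y ε + 1)) := by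
    simp only [hY]
    ring
  refine ⟨Y ε, _, _, _, hy, ?_, ?_, ?_, hr0, hr1, hrt, hu0, hu1, huab, hv0, hv1, hvcd⟩
  · have h1 : 1 - Y ε = (t - 1) * ε := by simp only [hY]; ring
    have h2 : t - Y ε = (t - 1) * (1 + ε) := by simp only [hY]; ring
    rw [h1, h2, mul_div_mul_left _ _ (sub_ne_zero.2 ht1), div_eq_mul_inv]
  · rw [e]
    exact (mul_div_assoc _ _ _).symm
  · rw [e]
    exact (mul_div_assoc _ _ _).symm

end Stochastic

end

/-! ### The determinant of the scattering problem -/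

section ScatDet

variable {n m : ℕ}

/-- The determinant whose nonvanishing gives a unique normalised fixed vector of the scattering
matrix in the sector with `m` second class particles, with denominators cleared. -/
def scatDet {R : Type*} [CommRing R] (w₀ : SectorWord (n + 1) m) (t a b c d y : R)
    (z : Fin (n + 1) → R) : R :=
  (sectorBlock m (polyProd (scatFactors t a b c d y z)) -
    denProd (scatFactors t a b c d y z) • 1 +
    denProd (scatFactors t a b c d y z) • onesRow R w₀).det

/-- Compatibility with ring homomorphisms is what carries nonvanishing from one evaluation point
back to Laurent polynomials and to polynomials in the parameters. -/
theorem map_scatDet {R R' : Type*} [CommRing R] [CommRing R'] (φ : R →+* R')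
    (w₀ : SectorWord (n + 1) m) (t a b c d y : R) (z : Fin (n + 1) → R) :
    φ (scatDet w₀ t a b c d y z) =
      scatDet w₀ (φ t) (φ a) (φ b) (φ c) (φ d) (φ y) (φ ∘ z) := by
  unfold scatDet
  rw [RingHom.map_det, ← scatFactors_map, polyProd_map, denProd_map]
  congr 1
  ext w w'
  simp only [RingHom.mapMatrix_apply, Matrix.map_apply, Matrix.add_apply, Matrix.sub_apply,
    Matrix.smul_apply, smul_eq_mul, map_add, map_sub, map_mul, sectorBlock,
    Matrix.submatrix_apply, Matrix.one_apply, onesRow]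
  split_ifs <;> simp

theorem scatDet_eq {K : Type*} [Field K] (w₀ : SectorWord (n + 1) m) {t a b c d y : K}
    {z : Fin (n + 1) → K} (h : ∀ f ∈ scatFactors t a b c d y z, f.den ≠ 0) :
    scatDet w₀ t a b c d y z =
      denProd (scatFactors t a b c d y z) ^ Fintype.card (SectorWord (n + 1) m) *
        (sectorBlock m (normProd (scatFactors t a b c d y z)) - 1 + onesRow K w₀).det := by
  rw [scatDet, ← det_smul, polyProd_eq_smul_normProd _ h, smul_add, smul_sub]
  rfl

theorem scatDet_ne_zero_iff {K : Type*} [Field K] (w₀ : SectorWord (n + 1) m)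
    {t a b c d y : K} {z : Fin (n + 1) → K} (h : ∀ f ∈ scatFactors t a b c d y z, f.den ≠ 0) :
    scatDet w₀ t a b c d y z ≠ 0 ↔
      (sectorBlock m (normProd (scatFactors t a b c d y z)) - 1 + onesRow K w₀).det ≠ 0 := by
  rw [scatDet_eq w₀ h, mul_ne_zero_iff]
  exact and_iff_right (pow_ne_zero _ (denProd_ne_zero _ h))

theorem exists_scatDet_ne_zero (w₀ : SectorWord (n + 1) m) {t a b c d : ℝ} (ht : 0 < t)
    (ht1 : t ≠ 1) (hα : 0 < -(a * b)) (hγ : 0 < (1 - t) / ((a - 1) * (b - 1)))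
    (hβ : 0 < -(c * d)) (hδ : 0 < (1 - t) / ((c - 1) * (d - 1))) :
    ∃ y : ℝ, y ≠ 0 ∧ scatDet w₀ t a b c d y (fun _ => 1) ≠ 0 := by
  obtain ⟨y, r, u, v, hy, hr, hu, hv, hr0, hr1, hrt, hu0, hu1, huab, hv0, hv1, hvcd⟩ :=
    exists_spectral_parameter ht1 hγ hδ
  -- Division by zero gives zero, so positivity of a quotient already shows that its denominator is
  -- nonzero.
  have ne {p q x : ℝ} (hx : x = p / q) (h0 : 0 < x) : q ≠ 0 := by
    rintro rfl
    rw [div_zero] at hx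
    exact h0.ne' hx
  refine ⟨y, hy, (scatDet_ne_zero_iff w₀ ?_).2 ?_⟩
  · refine forall_mem_scatFactors (ne hu hu0) (ne hv hv0) (fun _ _ => ?_) fun _ _ => ?_
    · simpa using ne hr hr0
    · simpa using ne hr hr0
  · exact det_scattering_ne_zero ht hα hβ hr hu hv hr0 hr1 hrt hu0 hu1 huab hv0 hv1 hvcd w₀

/-- A word with `m` second class particles. -/
theorem nonempty_sectorWord (h : m ≤ n + 1) : Nonempty (SectorWord (n + 1) m) := by
  refine ⟨fun k => if (k : ℕ) < m then 0 else 1, ?_⟩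
  have e (k : Fin (n + 1)) :
      ((if (k : ℕ) < m then 0 else 1 : SignType) = 0) ↔ (k : ℕ) < m := by
    split_ifs with hk <;> simp [hk]
  simp only [numZeros, e]
  rw [Fin.card_filter_val_lt, min_eq_right h]

end ScatDet

/-! ### Invariance of the support and of the component sum -/

section NormalisedVectors

variable {K : Type*} [Field K] {N : ℕ}

theorem semilin_smul (g : RingAut K) (M : Matrix (Fin N → SignType) (Fin N → SignType) K) (f : K)
    (Φ : (Fin N → SignType) → K) : semilin g M (f • Φ) = g f • semilin g M Φ := by
  rw [semilin_apply, semilin_apply, ← mulVec_smul]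
  congr 1
  funext w
  simp

theorem sum_semilin (g : RingAut K) {M : Matrix (Fin N → SignType) (Fin N → SignType) K}
    (hM : 1 ᵥ* M = 1) (Φ : (Fin N → SignType) → K) :
    ∑ w, semilin g M Φ w = g (∑ w, Φ w) := by
  have h := dotProduct_mulVec 1 M fun w => g (Φ w)
  rw [hM, one_dotProduct, one_dotProduct] at h
  rw [semilin_apply, h, map_sum]

theorem semilin_support (g : RingAut K) {M : Matrix (Fin N → SignType) (Fin N → SignType) K}
    (hM : PreservesZeros M) {m : ℕ} {Φ : (Fin N → SignType) → K}
    (hΦ : ∀ w, numZeros w ≠ m → Φ w = 0) (w : Fin N → SignType) (hw : numZeros w ≠ m) :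
    semilin g M Φ w = 0 := by
  rw [semilin_apply, mulVec, dotProduct]
  refine Finset.sum_eq_zero fun w' _ => ?_
  by_cases h : numZeros w' = m
  · rw [hM w w' (h ▸ hw), zero_mul]
  · rw [hΦ w' h, map_zero, mul_zero]

/-- The operator `T` is semilinear over `g`, preserves the number of second class particles,
and the component sum up to `g`. -/
structure IsStochastic (g : RingAut K) (T : AddMonoid.End ((Fin N → SignType) → K)) : Prop where
  smul : ∀ (f : K) (Φ : (Fin N → SignType) → K), T (f • Φ) = g f • T Φ
  sum : ∀ Φ : (Fin N → SignType) → K, ∑ w, T Φ w = g (∑ w, Φ w)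
  support : ∀ (m : ℕ) (Φ : (Fin N → SignType) → K), (∀ w, numZeros w ≠ m → Φ w = 0) →
    ∀ w, numZeros w ≠ m → T Φ w = 0

theorem isStochastic_semilin (g : RingAut K) (r : K)
    {G : Matrix (Fin N → SignType) (Fin N → SignType) K} (hG : PreservesZeros G)
    (h1 : 1 ᵥ* G = 0) : IsStochastic g (semilin g (1 + r • G)) where
  smul := semilin_smul g _
  sum := sum_semilin g (by rw [vecMul_add, vecMul_one, vecMul_smul, h1, smul_zero, add_zero])
  support _ _ := semilin_support g (preservesZeros_one.add (hG.smul r))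

theorem isStochastic_bulkAct (n : ℕ) (t : ℂ) (l : ℕ) :
    IsStochastic (swapVar (siteR n (l + 1)) (siteR n l)) (bulkAct n t l) :=
  isStochastic_semilin _ _ (preservesZeros_hopGen _ _ _) (one_vecMul_hopGen _ _ _)

theorem isStochastic_rightAct (n : ℕ) (c d : ℂ) :
    IsStochastic (invVar (siteR n 0)) (rightAct n c d) :=
  isStochastic_semilin _ _ (preservesZeros_flipGen _ _ _) (one_vecMul_flipGen _ _ _)

theorem isStochastic_leftAct (n : ℕ) (a b : ℂ) :
    IsStochastic (invVar (siteR n n)) (leftAct n a b) :=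
  isStochastic_semilin _ _ (preservesZeros_flipGen _ _ _) (one_vecMul_flipGen _ _ _)

end NormalisedVectors

/-! ### The normalised solution -/

section NormalisedSolution

variable {n m : ℕ}

/-- The evaluation of Laurent polynomials at `z_k = y⁻¹`, all other variables being `1`. -/
def evalAt {N : ℕ} (k : Fin N) {y : ℂ} (hy : y ≠ 0) : Laurent N →ₐ[ℂ] ℂ :=
  AddMonoidAlgebra.lift ℂ ℂ (Fin N → ℤ)
    { toFun := fun v => y⁻¹ ^ (Multiplicative.toAdd v k)
      map_one' := by simp
      map_mul' := fun u v => by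
        rw [toAdd_mul, Pi.add_apply, zpow_add₀ (inv_ne_zero hy)] }

theorem evalAt_single {N : ℕ} (k : Fin N) {y : ℂ} (hy : y ≠ 0) (v : Fin N → ℤ) (x : ℂ) :
    evalAt k hy (AddMonoidAlgebra.single v x) = x * y⁻¹ ^ v k := by
  rw [evalAt, AddMonoidAlgebra.lift_single]
  rfl

/-- The chain does not contain the variable of the first site, which enters only through `y`.
Evaluating that variable at the inverse of `y` is therefore compatible with putting ones everywhere.
-/
theorem scatFactors_one_eq {R : Type*} [CommRing R] (t a b c d y : R) {z : Fin (n + 1) → R}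
    (hz : ∀ k, k ≠ siteR n n → z k = 1) :
    scatFactors t a b c d y z = scatFactors t a b c d y fun _ => 1 := by
  rw [scatFactors, scatFactors,
    chainFactors_congr (z' := fun _ => 1) t c d y n fun j hj => hz _ (siteR_ne hj.ne hj.le le_rfl)]

/-- The generic determinant is the image of a Laurent polynomial one, because its entries contain
the first variable only through monomials. The evaluation `evalAt` sends the latter to the given
nonzero number. -/
theorem scatDet_generic_ne_zero (w₀ : SectorWord (n + 1) m) {t a b c d y : ℂ} (hy : y ≠ 0)
    (h : scatDet w₀ t a b c d y (fun _ => 1) ≠ 0) :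
    scatDet w₀ (constHom (n + 1) t) (constHom (n + 1) a) (constHom (n + 1) b)
      (constHom (n + 1) c) (constHom (n + 1) d) (var (siteR n n))⁻¹ var ≠ 0 := by
  let C (x : ℂ) : Laurent (n + 1) := AddMonoidAlgebra.single 0 x
  let Y : Laurent (n + 1) := AddMonoidAlgebra.single (-Pi.single (siteR n n) 1) 1
  let Z (k : Fin (n + 1)) : Laurent (n + 1) := AddMonoidAlgebra.single (Pi.single k 1) 1
  have hC (x : ℂ) : evalAt (siteR n n) hy (C x) = x := by simp [C, evalAt_single]
  have hY : evalAt (siteR n n) hy Y = y := by simp [Y, evalAt_single]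
  have hZ (k : Fin (n + 1)) (hk : k ≠ siteR n n) : evalAt (siteR n n) hy (Z k) = 1 := by
    simp [Z, evalAt_single, hk.symm]
  have h1 : scatDet w₀ (C t) (C a) (C b) (C c) (C d) Y Z ≠ 0 := by
    intro h0
    have h2 := map_scatDet (evalAt (siteR n n) hy : Laurent (n + 1) →+* ℂ) w₀ (C t) (C a) (C b)
      (C c) (C d) Y Z
    rw [h0, map_zero, RingHom.coe_coe, hC, hC, hC, hC, hC, hY, scatDet,
      scatFactors_one_eq (z := evalAt (siteR n n) hy ∘ Z) _ _ _ _ _ _ hZ] at h2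
    exact h h2.symm
  have h3 := map_scatDet (algebraMap (Laurent (n + 1)) (RatFun (n + 1))) w₀ (C t) (C a) (C b)
      (C c) (C d) Y Z
  have h4 : algebraMap (Laurent (n + 1)) (RatFun (n + 1)) Y = (var (siteR n n))⁻¹ := mono_neg _
  rw [h4] at h3
  intro h5
  exact h1 ((map_eq_zero_iff _ (IsFractionRing.injective (Laurent (n + 1)) (RatFun (n + 1)))).1
    (h3.trans h5))

theorem genericFactors_den_ne_zero (t a b c d : ℂ) :
    ∀ f ∈ genericFactors n t a b c d, f.den ≠ 0 := by
  refine forall_mem_scatFactors ?_ ?_ (fun l hl => ?_) fun l hl => ?_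
  · have h (x : ℂ) : (var (siteR n n))⁻¹ - constHom (n + 1) x ≠ 0 := by
      rw [← neg_ne_zero, neg_sub]
      exact right_den_inv_ne_zero x _
    exact mul_ne_zero (h a) (h b)
  · exact mul_ne_zero (right_den_inv_ne_zero c _) (right_den_inv_ne_zero d _)
  · exact exchange_den_inv_left_ne_zero t (siteR_ne hl.ne' le_rfl hl.le)
  · have h : constHom (n + 1) t * mono 0 -
        mono (-Pi.single (siteR n n) 1 + Pi.single (siteR n l) 1) ≠ 0 := by
      refine constHom_mul_mono_sub_ne_zero t fun h => ?_
      have h' := congrFun h (siteR n n)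
      simp [Pi.single_eq_of_ne (siteR_ne hl.ne' le_rfl hl.le)] at h'
    rwa [mono_zero, mul_one, mono_add, mono_neg] at h

/-- `exists_fixed` supplies a normalised vector fixed by the scattering matrix, and
`fixed_of_unique_fixed`, applied to the normalised vectors of the sector, shows that all generators
fix it. Conversely, a common fixed vector is fixed by the scattering matrix, so it vanishes if its
sum is zero. -/
theorem exists_unique_normalised_solution (t a b c d : ℂ) (w₀ : SectorWord (n + 1) m)
    (h : scatDet w₀ (constHom (n + 1) t) (constHom (n + 1) a) (constHom (n + 1) b)
      (constHom (n + 1) c) (constHom (n + 1) d) (var (siteR n n))⁻¹ var ≠ 0) :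
    ∃ v : (Fin (n + 1) → SignType) → RatFun (n + 1),
      (∀ w, numZeros w ≠ m → v w = 0) ∧ ∑ w, v w = 1 ∧
      leftAct n a b v = v ∧ rightAct n c d v = v ∧ (∀ l < n, bulkAct n t l v = v) ∧
      ∀ u : (Fin (n + 1) → SignType) → RatFun (n + 1), (∀ w, numZeros w ≠ m → u w = 0) →
        ∑ w, u w = 0 → leftAct n a b u = u → rightAct n c d u = u →
        (∀ l < n, bulkAct n t l u = u) → u = 0 := by
  have hdet := (scatDet_ne_zero_iff w₀ (genericFactors_den_ne_zero t a b c d)).1 h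
  have hX (u) : (leftAct n a b * palindrome (rightAct n c d) (bulkAct n t) n) u =
      normProd (genericFactors n t a b c d) *ᵥ u := by
    rw [leftAct_mul_palindrome]
    rfl
  obtain ⟨v, hv, hv1, hfix⟩ := exists_fixed
    (preservesZeros_normProd _ (preservesZeros_scatFactors _ _ _ _ _ _ _))
    (one_vecMul_normProd _ (one_vecMul_scatFactors _ _ _ _ _ _ _)) hdet
  have huniq (u : (Fin (n + 1) → SignType) → RatFun (n + 1))
      (hu : ∀ w, numZeros w ≠ m → u w = 0) (hu0 : ∑ w, u w = 0)
      (hfu : (leftAct n a b * palindrome (rightAct n c d) (bulkAct n t) n) u = u) : u = 0 :=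
    eq_zero_of_fixed hdet hu hu0 ((hX u).symm.trans hfu)
  have hS {g : RingAut (RatFun (n + 1))}
      {T : AddMonoid.End ((Fin (n + 1) → SignType) → RatFun (n + 1))} (hT : IsStochastic g T)
      (u : (Fin (n + 1) → SignType) → RatFun (n + 1))
      (hu : (∀ w, numZeros w ≠ m → u w = 0) ∧ ∑ w, u w = 1) :
      (∀ w, numZeros w ≠ m → T u w = 0) ∧ ∑ w, T u w = 1 :=
    ⟨hT.support m u hu.1, by rw [hT.sum, hu.2, map_one]⟩
  obtain ⟨h1, h2, h3⟩ := fixed_of_unique_fixed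
    (S := fun u => (∀ w, numZeros w ≠ m → u w = 0) ∧ ∑ w, u w = 1)
    (leftAct_mul_self a b) (rightAct_mul_self c d) (fun l hl => bulkAct_mul_self t hl)
    (fun k l hk hl hkl => bulkAct_commute t hk hl hkl)
    (fun l hl h1l => rightAct_commute_bulkAct t c d hl h1l)
    (fun l hl => leftAct_commute_bulkAct t a b hl)
    (fun hn => leftAct_commute_rightAct a b c d hn)
    (fun l hl => bulkAct_braid t hl)
    (fun hn => rightAct_reflection t c d hn)
    (fun k hk => by subst hk; exact leftAct_reflection t a b k)
    (hS (isStochastic_leftAct n a b)) (hS (isStochastic_rightAct n c d))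
    (fun l _ => hS (isStochastic_bulkAct n t l)) ⟨hv, hv1⟩ ((hX v).trans hfix)
    (fun u hu hfu => sub_eq_zero.1 (huniq (u - v)
      (fun w hw => by rw [Pi.sub_apply, hu.1 w hw, hv w hw, sub_zero])
      (by simp only [Pi.sub_apply, Finset.sum_sub_distrib, hu.2, hv1, sub_self])
      (by rw [map_sub, hfu, hX v, hfix])))
  refine ⟨v, hv, hv1, h1, h2, h3, fun u hu hu0 hL hR hc => huniq u hu hu0 ?_⟩
  have hp : ∀ k ≤ n, palindrome (rightAct n c d) (bulkAct n t) k u = u := by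
    intro k hk
    induction k with
    | zero => exact hR
    | succ k ih =>
      change bulkAct n t k (palindrome (rightAct n c d) (bulkAct n t) k (bulkAct n t k u)) = u
      rw [hc k hk, ih (by omega), hc k hk]
  change leftAct n a b (palindrome (rightAct n c d) (bulkAct n t) n u) = u
  rw [hp n le_rfl, hL]

end NormalisedSolution

/-! ### Invariant denominators -/

section Denominators

variable {N : ℕ}

/-- A signed permutation of the exponents. -/
def signedPermExp (x : Equiv.Perm (Fin N) × (Fin N → ℤˣ)) : (Fin N → ℤ) ≃+ (Fin N → ℤ) where
  toFun v := fun k => x.2 k * v (x.1 k)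
  invFun v := fun k => x.2 (x.1.symm k) * v (x.1.symm k)
  left_inv v := by
    funext k
    simp only [Equiv.apply_symm_apply, ← mul_assoc, ← Units.val_mul, Int.units_mul_self,
      Units.val_one, one_mul]
  right_inv v := by
    funext k
    simp only [Equiv.symm_apply_apply, ← mul_assoc, ← Units.val_mul, Int.units_mul_self,
      Units.val_one, one_mul]
  map_add' u v := by
    funext k
    simp only [Pi.add_apply, mul_add]

/-- The product of all images of `p` under signed permutations of the variables. -/
def signedPermNorm (p : Laurent N) : Laurent N :=
  ∏ x : Equiv.Perm (Fin N) × (Fin N → ℤˣ), AddMonoidAlgebra.domCongr ℂ ℂ (signedPermExp x) p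

/-- Composing with `g` only permutes the factors of the norm. -/
theorem domCongr_signedPermNorm {g : (Fin N → ℤ) ≃+ (Fin N → ℤ)}
    (e : Equiv.Perm (Equiv.Perm (Fin N) × (Fin N → ℤˣ)))
    (h : ∀ x, (signedPermExp x).trans g = signedPermExp (e x)) (p : Laurent N) :
    AddMonoidAlgebra.domCongr ℂ ℂ g (signedPermNorm p) = signedPermNorm p := by
  rw [signedPermNorm, map_prod]
  refine (Finset.prod_congr rfl fun x _ => ?_).trans
    (Equiv.prod_comp e fun x => AddMonoidAlgebra.domCongr ℂ ℂ (signedPermExp x) p)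
  rw [← h, ← AddMonoidAlgebra.trans_domCongr_domCongr]
  rfl

theorem swapVar_signedPermNorm (i j : Fin N) (p : Laurent N) :
    swapVar i j (algebraMap _ _ (signedPermNorm p)) = algebraMap _ _ (signedPermNorm p) := by
  rw [swapVar, monomialAut_algebraMap, domCongr_signedPermNorm
    (Equiv.prodCongr (Equiv.mulRight (Equiv.swap i j))
      (Equiv.arrowCongr (Equiv.swap i j) (Equiv.refl ℤˣ)))]
  rintro ⟨π, ε⟩
  ext v k
  simp [swapExp, signedPermExp]

theorem invVar_signedPermNorm (k : Fin N) (p : Laurent N) :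
    invVar k (algebraMap _ _ (signedPermNorm p)) = algebraMap _ _ (signedPermNorm p) := by
  rw [invVar, monomialAut_algebraMap, domCongr_signedPermNorm
    (Equiv.prodCongr (Equiv.refl _) (Equiv.mulLeft (Pi.mulSingle k (-1))))]
  rintro ⟨π, ε⟩
  ext v l
  by_cases h : l = k
  · subst h; simp [negExp, signedPermExp]
  · simp [negExp, signedPermExp, h]

theorem dvd_signedPermNorm (p : Laurent N) : p ∣ signedPermNorm p := by
  have h : AddMonoidAlgebra.domCongr ℂ ℂ (signedPermExp (N := N) 1) p = p := by
    have e : signedPermExp (N := N) 1 = AddEquiv.refl _ := by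
      ext v k
      simp [signedPermExp]
    rw [e, AddMonoidAlgebra.domCongr_refl]
    rfl
  nth_rewrite 1 [← h]
  exact Finset.dvd_prod_of_mem (fun x => AddMonoidAlgebra.domCongr ℂ ℂ (signedPermExp x) p)
    (Finset.mem_univ 1)

theorem signedPermNorm_ne_zero {p : Laurent N} (hp : p ≠ 0) : signedPermNorm p ≠ 0 :=
  Finset.prod_ne_zero_iff.2 fun x _ =>
    (map_ne_zero_iff _ (AddMonoidAlgebra.domCongr ℂ ℂ (signedPermExp x)).injective).2 hp

/-- A vector of rational functions has a denominator that is invariant under all exchanges and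
inversions of the variables. -/
theorem exists_invariant_denominator {ι : Type*} [Finite ι] (v : ι → RatFun N) :
    ∃ q : RatFun N, q ≠ 0 ∧ (∀ i j, swapVar i j q = q) ∧ (∀ k, invVar k q = q) ∧
      ∃ Ψ : ι → Laurent N, ∀ w, algebraMap (Laurent N) (RatFun N) (Ψ w) = q * v w := by
  obtain ⟨p, hp⟩ := IsLocalization.exist_integer_multiples_of_finite
    (nonZeroDivisors (Laurent N)) v
  -- An arbitrary common denominator divides its norm, which is invariant and so can replace it.
  obtain ⟨r, hr⟩ := dvd_signedPermNorm (p : Laurent N)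
  choose Ψ hΨ using hp
  refine ⟨algebraMap _ _ (signedPermNorm (p : Laurent N)), ?_,
    fun i j => swapVar_signedPermNorm i j _, fun k => invVar_signedPermNorm k _, fun w => Ψ w * r, fun w => ?_⟩
  · exact (map_ne_zero_iff _ (IsFractionRing.injective _ _)).2
      (signedPermNorm_ne_zero (nonZeroDivisors.ne_zero p.2))
  · rw [map_mul, hΨ, hr, map_mul, Algebra.smul_def]
    ring

theorem isInvariant_iff {n : ℕ} (f : RatFun (n + 1)) :
    IsInvariant f ↔ invVar (siteR n n) f = f ∧ invVar (siteR n 0) f = f ∧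
      ∀ l < n, swapVar (siteR n (l + 1)) (siteR n l) f = f := by
  constructor
  · rintro ⟨h1, h2, h3⟩
    refine ⟨h2 _ (by simp [siteR]), h3 _ (by simp [siteR]), fun l hl => h1 _ _ ?_⟩
    simp only [siteR]
    omega
  · rintro ⟨h1, h2, h3⟩
    refine ⟨fun i j hij => ?_, fun k hk => ?_, fun k hk => ?_⟩
    · have h := h3 (n - j) (by omega)
      rwa [siteR_sub, show n - (j : ℕ) + 1 = n - i by omega, siteR_sub] at h
    · rwa [show k = siteR n n from Fin.ext (by simp [siteR, hk])]
    · rwa [show k = siteR n 0 from Fin.ext (by simp only [siteR]; omega)]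

end Denominators

/-! ### The main theorem -/

section Main

variable {n m : ℕ}

/-- The Laurent solution is `q • v`, with `v` the normalised solution and `q` an invariant
denominator. For a solution `Φ` the invariant factor is its component sum divided by `q`. -/
theorem hasUniqueLaurentSolution {s a b c d y : ℂ} (hs : s ≠ 0) (hs1 : s ^ 2 ≠ 1) (ha : a ≠ 1)
    (hb : b ≠ 1) (hc : c ≠ 1) (hd : d ≠ 1) (hy : y ≠ 0) (w₀ : SectorWord (n + 1) m)
    (h : scatDet w₀ (s ^ 2) a b c d y (fun _ => 1) ≠ 0) :
    HasUniqueLaurentSolution (n + 1) m s a b c d := by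
  obtain ⟨v, hv, hv1, hvL, hvR, hvc, huniq⟩ := exists_unique_normalised_solution (s ^ 2) a b c d w₀
    (scatDet_generic_ne_zero w₀ hy h)
  obtain ⟨q, hq0, hqs, hqi, Ψ, hΨ⟩ := exists_invariant_denominator v
  have hΨv : toRatFun Ψ = q • v := funext hΨ
  have sL := isStochastic_leftAct n a b
  have sR := isStochastic_rightAct n c d
  have sB := isStochastic_bulkAct n (s ^ 2)
  have hsol (f : RatFun (n + 1)) (hf : IsInvariant f) :
      IsExchangeSolution (n + 1) m s a b c d (f • v) := by
    rw [isInvariant_iff] at hf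
    refine (isExchangeSolution_iff hs hs1 ha hb hc hd _).2
      ⟨Submodule.smul_mem _ f hv, ?_, ?_, fun l hl => ?_⟩
    · rw [sL.smul, hf.1, hvL]
    · rw [sR.smul, hf.2.1, hvR]
    · rw [(sB l).smul, hf.2.2 l hl, hvc l hl]
  have hqinv : IsInvariant q := ⟨fun i j _ => hqs i j, fun k _ => hqi k, fun k _ => hqi k⟩
  refine ⟨Ψ, ?_, ?_, fun Φ => ⟨fun hΦ => ?_, ?_⟩⟩
  · rintro rfl
    have h0 : q • v = 0 := by
      rw [← hΨv]
      funext w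
      exact map_zero _
    rw [(smul_eq_zero_iff_right hq0).1 h0] at hv1
    simp at hv1
  · rw [hΨv]
    exact hsol q hqinv
  · obtain ⟨hΦs, hΦL, hΦR, hΦB⟩ := (isExchangeSolution_iff hs hs1 ha hb hc hd Φ).1 hΦ
    -- The generators transform the component sum by their field automorphism alone, so fixed
    -- vectors have invariant sums.
    have hLs : invVar (siteR n n) (∑ w, Φ w) = ∑ w, Φ w := by rw [← sL.sum, hΦL]
    have hRs : invVar (siteR n 0) (∑ w, Φ w) = ∑ w, Φ w := by rw [← sR.sum, hΦR]
    have hBs (l : ℕ) (hl : l < n) :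
        swapVar (siteR n (l + 1)) (siteR n l) (∑ w, Φ w) = ∑ w, Φ w := by
      rw [← (sB l).sum, hΦB l hl]
    have hz : Φ - (∑ w, Φ w) • v = 0 := by
      refine huniq _ (Submodule.sub_mem (sector (n + 1) m) hΦs (Submodule.smul_mem _ _ hv)) ?_ ?_
        ?_ fun l hl => ?_
      · simp only [Pi.sub_apply, Pi.smul_apply, smul_eq_mul, Finset.sum_sub_distrib,
          ← Finset.mul_sum, hv1, mul_one, sub_self]
      · rw [map_sub, sL.smul, hLs, hΦL, hvL]
      · rw [map_sub, sR.smul, hRs, hΦR, hvR]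
      · rw [map_sub, (sB l).smul, hBs l hl, hΦB l hl, hvc l hl]
    refine ⟨(∑ w, Φ w) / q, (isInvariant_iff _).2 ⟨?_, ?_, fun l hl => ?_⟩, ?_⟩
    · rw [map_div₀, hLs, hqi]
    · rw [map_div₀, hRs, hqi]
    · rw [map_div₀, hBs l hl, hqs]
    · rw [hΨv, smul_smul, div_mul_cancel₀ _ hq0]
      exact sub_eq_zero.1 hz
  · rintro ⟨f, hf, rfl⟩
    rw [hΨv, smul_smul]
    refine hsol _ ((isInvariant_iff _).2 ?_)
    have hf := (isInvariant_iff f).1 hf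
    refine ⟨?_, ?_, fun l hl => ?_⟩
    · rw [map_mul, hf.1, hqi]
    · rw [map_mul, hf.2.1, hqi]
    · rw [map_mul, hf.2.2 l hl, hqs]

/-! ### Real and generic parameters -/

theorem ofReal_scatDet (w₀ : SectorWord (n + 1) m) (t a b c d y : ℝ) :
    scatDet w₀ (t : ℂ) (a : ℂ) (b : ℂ) (c : ℂ) (d : ℂ) (y : ℂ) (fun _ => 1) =
      (scatDet w₀ t a b c d y (fun _ => 1) : ℝ) := by
  have h := map_scatDet Complex.ofRealHom w₀ t a b c d y fun _ => 1
  have e : (Complex.ofRealHom ∘ fun _ : Fin (n + 1) => (1 : ℝ)) = fun _ => (1 : ℂ) := by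
    funext k
    simp
  rw [e] at h
  exact h.symm

theorem ne_one_of_rateGamma_pos {s a b : ℝ} (h : 0 < rateGamma s a b) : a ≠ 1 ∧ b ≠ 1 := by
  constructor <;> rintro rfl <;> simp [rateGamma] at h

/-- The first quantity is the ratio of the injection to the removal rate, the second is `s` times
the removal rate. -/
theorem rate_conditions {s a b : ℝ} (hs : 0 < s) (hα : 0 < rateAlpha s a b)
    (hγ : 0 < rateGamma s a b) :
    0 < -(a * b) ∧ 0 < (1 - s ^ 2) / ((a - 1) * (b - 1)) := by
  constructor
  · rw [← inv_rateGamma_mul_rateAlpha hγ.ne']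
    positivity
  · have e : (1 - s ^ 2) / ((a - 1) * (b - 1)) = s * rateGamma s a b := by
      rw [rateGamma, mul_div_assoc', mul_sub s, mul_inv_cancel₀ hs.ne', pow_two]
    rw [e]
    positivity

theorem hasUniqueLaurentSolution_of_rates_pos (hm : m ≤ n + 1) {t a b c d : ℝ} (ht : 0 < t)
    (ht1 : t ≠ 1) (hα : 0 < rateAlpha (Real.sqrt t) a b) (hγ : 0 < rateGamma (Real.sqrt t) a b)
    (hβ : 0 < rateBeta (Real.sqrt t) c d) (hδ : 0 < rateDelta (Real.sqrt t) c d) :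
    HasUniqueLaurentSolution (n + 1) m ((Real.sqrt t : ℝ) : ℂ) (a : ℂ) (b : ℂ) (c : ℂ) (d : ℂ) := by
  obtain ⟨w₀⟩ := nonempty_sectorWord hm
  have hs := Real.sqrt_pos.2 ht
  have hst := Real.sq_sqrt ht.le
  obtain ⟨ha, hb⟩ := ne_one_of_rateGamma_pos hγ
  obtain ⟨hc, hd⟩ := ne_one_of_rateGamma_pos (a := c) (b := d) hδ
  obtain ⟨h1, h2⟩ := rate_conditions hs hα hγ
  obtain ⟨h3, h4⟩ := rate_conditions (a := c) (b := d) hs hβ hδ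
  rw [hst] at h2 h4
  obtain ⟨y, hy, hdet⟩ := exists_scatDet_ne_zero w₀ ht ht1 h1 h2 h3 h4
  refine hasUniqueLaurentSolution (y := y) (by exact_mod_cast hs.ne') ?_ (by exact_mod_cast ha)
    (by exact_mod_cast hb) (by exact_mod_cast hc) (by exact_mod_cast hd) (by exact_mod_cast hy)
    w₀ ?_
  · rw [← Complex.ofReal_pow, hst]
    exact_mod_cast ht1
  · rw [← Complex.ofReal_pow, hst, ofReal_scatDet]
    exact_mod_cast hdet

theorem eval_scatDet (w₀ : SectorWord (n + 1) m) (s a b c d y : ℂ) :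
    MvPolynomial.eval ![s, a, b, c, d]
      (scatDet w₀ (MvPolynomial.X 0 ^ 2) (MvPolynomial.X 1) (MvPolynomial.X 2)
        (MvPolynomial.X 3) (MvPolynomial.X 4) (MvPolynomial.C y) (fun _ => 1)) =
      scatDet w₀ (s ^ 2) a b c d y (fun _ => 1) := by
  have e : (MvPolynomial.eval ![s, a, b, c, d] ∘ fun _ : Fin (n + 1) => 1) = fun _ => 1 := by
    funext k
    simp
  rw [map_scatDet, e]
  simp

theorem exists_polynomial_hasUniqueLaurentSolution (hm : m ≤ n + 1) :
    ∃ P : MvPolynomial (Fin 5) ℂ, P ≠ 0 ∧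
      ∀ s a b c d : ℂ, s ≠ 0 → s ^ 2 ≠ 1 → a ≠ 1 → b ≠ 1 → c ≠ 1 → d ≠ 1 →
        MvPolynomial.eval ![s, a, b, c, d] P ≠ 0 →
        HasUniqueLaurentSolution (n + 1) m s a b c d := by
  obtain ⟨w₀⟩ := nonempty_sectorWord hm
  -- A sample point with positive rates, corresponding to `s = 2`. Its spectral value `y` is then
  -- kept as a constant, so that the determinant becomes a polynomial in the five parameters, whose
  -- choice involves only `n` and `m`.
  obtain ⟨y, hy, hdet⟩ := exists_scatDet_ne_zero w₀ (t := 4) (a := 2) (b := -1) (c := 2) (d := -1)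
    (by norm_num) (by norm_num) (by norm_num) (by norm_num) (by norm_num) (by norm_num)
  refine ⟨scatDet w₀ (MvPolynomial.X 0 ^ 2) (MvPolynomial.X 1) (MvPolynomial.X 2)
    (MvPolynomial.X 3) (MvPolynomial.X 4) (MvPolynomial.C (y : ℂ)) (fun _ => 1), ?_, ?_⟩
  · intro h0
    have h := eval_scatDet w₀ 2 2 (-1) 2 (-1) y
    rw [h0, map_zero] at h
    apply hdet
    have h' := ofReal_scatDet w₀ 4 2 (-1) 2 (-1) y
    norm_num at h h'
    rw [← h] at h'
    exact_mod_cast h'.symm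
  · intro s a b c d hs hs1 ha hb hc hd hP
    rw [eval_scatDet] at hP
    exact hasUniqueLaurentSolution hs hs1 ha hb hc hd (by exact_mod_cast hy) w₀ hP

end Main

end

end OpenASEP

theorem mainTheorem4 (N m : ℕ) (hN : 1 ≤ N) (hm : m ≤ N) :
    (∀ t a b c d : ℝ, 0 < t → t ≠ 1 →
      0 < OpenASEP.rateAlpha (Real.sqrt t) a b → 0 < OpenASEP.rateGamma (Real.sqrt t) a b →
      0 < OpenASEP.rateBeta (Real.sqrt t) c d → 0 < OpenASEP.rateDelta (Real.sqrt t) c d →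
      OpenASEP.HasUniqueLaurentSolution N m
        ((Real.sqrt t : ℝ) : ℂ) (a : ℂ) (b : ℂ) (c : ℂ) (d : ℂ)) ∧
    (∃ P : MvPolynomial (Fin 5) ℂ, P ≠ 0 ∧
      ∀ s a b c d : ℂ, s ≠ 0 → s ^ 2 ≠ 1 → a ≠ 1 → b ≠ 1 → c ≠ 1 → d ≠ 1 →
        MvPolynomial.eval ![s, a, b, c, d] P ≠ 0 →
        OpenASEP.HasUniqueLaurentSolution N m s a b c d) := by
  obtain ⟨n, rfl⟩ : ∃ n, N = n + 1 := ⟨N - 1, by omega⟩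
  exact ⟨fun t a b c d ht ht1 hα hγ hβ hδ =>
    OpenASEP.hasUniqueLaurentSolution_of_rates_pos hm ht ht1 hα hγ hβ hδ,
    OpenASEP.exists_polynomial_hasUniqueLaurentSolution hm⟩
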